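/- Let $d\ge 1$, $\mathbb T^d=\{x\in\mathbb R^d: x_1,\dots,x_d\ge 0,\ 1-|x|\ge 0\}$ with $|x|=\sum_j|x_j|$, and let $W^T$ be one of the weights $$W^T(x)=\Big(\prod_{i=1}^d x_i^{\kappa_i-1/2}\Big)(1-|x|)^{\kappa_{d+1}-1/2}\quad(\kappa_1,\dots,\kappa_{d+1}\ge 0;\ \text{type }\mathbb Z_2^d),$$ $$W^T(x)=\prod_{i=1}^d x_i^{\kappa'-1/2}\prod_{1\le i<j\le d}|x_i-x_j|^{\kappa}\,(1-|x|)^{\mu-1/2}\quad(\kappa',\kappa,\mu\ge 0;\ \text{type } H_d).$$ Put $\psi(u)=(u_1^2,\dots,u_d^2)$ and $\psi^{-1}(x)=(\sqrt{x_1},\dots,\sqrt{x_d})$. Let $\Delta^T$ be the second order differential-difference operator on $\mathbb T^d$ given by $(\Delta^T f)\circ\psi=\tfrac14\,\Delta^B(f\circ\psi)$, where $\Delta^B=\sum_{j=1}^d\mathcal D_j^2-\langle x,\nabla\rangle^2-2\lambda\langle x,\nabla\rangle$, $\lambda=\sum_v\kappa_v+\mu+\frac{d-1}2$, and $\mathcal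 D_jF(x)=\partial_jF(x)+\sum_v\kappa_v\langle v,e_j\rangle\frac{F(x)-F(\sigma_vx)}{\langle x,v\rangle}$ are the Dunkl operators; here $\sigma_v$ is the reflection in $v^\perp$. For the type $\mathbb Z_2^d$ the sums run over $v=\sqrt2e_i$ with $\kappa_v=\kappa_i$, and $\mu=\kappa_{d+1}$. For the type $H_d$ they run over $v=\sqrt2e_i$ with $\kappa_v=\kappa'$ and over $v=e_i\pm e_j$, $i<j$, with $\kappa_v=\kappa/2$ (the multiplicities that belong to $W^T$ under $x=\psi(u)$). A function $g\in L^2(\mathbb T^d;W^T)$ is $\sqrt{-\Delta^T}f$ if $\int gP\,W^T=\sqrt\nu\int fP\,W^T$ for every polynomial $P$ and real $\nu$ with $-\Delta^TP=\nu P$. **Theorem.** There is a constant $C>0$ that depends only on $d$ and on the parameters of the weight, such that for every real- or complex-valued $f\in C^1(\mathbb T^d)$ with $\int_{\mathbb T^d}f\,W^T\,dx=0$ and $\int_{\mathbb T^d}|f|^2W^T\,dx=1$, the function $\sqrt{-\Delta^T}f$ exists in $L^2(\mathbb T^d;W^T)$, the minimum below is attained, and $$\Big[\min_{y\in\mathbb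 T^d}\int_{\mathbb T^d}\big(1-\langle\psi^{-1}(x),\psi^{-1}(y)\rangle\big)|f(x)|^2W^T(x)\,dx\Big]\cdot\Big[\int_{\mathbb T^d}\big|\sqrt{-\Delta^T}f(x)\big|^2W^T(x)\,dx\Big]\ \ge\ C.$$ -/

import Mathlib

open MeasureTheory
open scoped NNReal

noncomputable section

/-- The simplex `T^d = {x ∈ ℝ^d : x_1 ≥ 0, …, x_d ≥ 0, 1 - |x| ≥ 0}`. -/
def simplexT (d : ℕ) : Set (Fin d → ℝ) :=
  {x | (∀ i, 0 ≤ x i) ∧ 0 ≤ 1 - ∑ i, |x i|}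

/-- The map `ψ(u) = (u_1², …, u_d²)`; it carries the unit ball onto the simplex. -/
def psi {d : ℕ} (u : Fin d → ℝ) : Fin d → ℝ := fun i => u i ^ 2

/-- The inverse `ψ⁻¹(x) = (√x_1, …, √x_d)` on the simplex. -/
def psiInv {d : ℕ} (x : Fin d → ℝ) : Fin d → ℝ := fun i => √(x i)

/-- Index set of the pairs `i < j`. -/
abbrev OrderedPair (d : ℕ) : Type := {p : Fin d × Fin d // p.1 < p.2}

/-- Parameters of the two families of weights on the simplex: the type `ℤ₂^d`, with parameters
`κ_1, …, κ_{d+1} ≥ 0`, and the hyperoctahedral type `H_d`, with parameters `κ', κ, μ ≥ 0`. -/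
inductive SimplexWeight (d : ℕ) : Type where
  | signChange (κ : Fin (d + 1) → ℝ≥0) : SimplexWeight d
  | hyperoctahedral (κ' κ μ : ℝ≥0) : SimplexWeight d

/-- The weight function `W^T`:
`∏ x_i^{κ_i - 1/2} (1 - |x|)^{κ_{d+1} - 1/2}` for the type `ℤ₂^d`, and
`∏ x_i^{κ' - 1/2} ∏_{i<j} |x_i - x_j|^κ (1 - |x|)^{μ - 1/2}` for the type `H_d`. -/
def SimplexWeight.weight {d : ℕ} : SimplexWeight d → (Fin d → ℝ) → ℝ
  | .signChange κ => fun x =>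
      (∏ i : Fin d, x i ^ ((κ i.castSucc : ℝ) - 1 / 2)) *
        (1 - ∑ i, |x i|) ^ ((κ (Fin.last d) : ℝ) - 1 / 2)
  | .hyperoctahedral κ' κ μ => fun x =>
      (∏ i : Fin d, x i ^ ((κ' : ℝ) - 1 / 2)) *
        (∏ p : OrderedPair d, |x p.1.1 - x p.1.2| ^ (κ : ℝ)) *
        (1 - ∑ i, |x i|) ^ ((μ : ℝ) - 1 / 2)

/-- The measure `W^T(x) dx` on the simplex. -/
def SimplexWeight.measure {d : ℕ} (w : SimplexWeight d) : Measure (Fin d → ℝ) :=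
  (volume.restrict (simplexT d)).withDensity fun x => ENNReal.ofReal (w.weight x)

/-- The partial derivative `∂_j F`. -/
def partialD {d : ℕ} (j : Fin d) (F : (Fin d → ℝ) → ℝ) (x : Fin d → ℝ) : ℝ :=
  lineDeriv ℝ F x (Pi.single j 1)

/-- The reflection `σ_v x = x - (2⟨x, v⟩ / ‖v‖²) v`. -/
def rootReflection {d : ℕ} (v x : Fin d → ℝ) : Fin d → ℝ :=
  x - (2 * (x ⬝ᵥ v) / (v ⬝ᵥ v)) • v

/-- The Dunkl operator
`D_j F(x) = ∂_j F(x) + ∑_v κ_v ⟨v, e_j⟩ (F(x) - F(σ_v x)) / ⟨x, v⟩`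
for the positive roots `root a` with multiplicities `mult a`, `a ∈ ι`. The formula is meaningful
off the hyperplanes `⟨x, v⟩ = 0`, hence at almost every point. -/
def dunklOp {d : ℕ} {ι : Type} [Fintype ι] (root : ι → Fin d → ℝ) (mult : ι → ℝ) (j : Fin d)
    (F : (Fin d → ℝ) → ℝ) (x : Fin d → ℝ) : ℝ :=
  partialD j F x +
    ∑ a, mult a * root a j * ((F x - F (rootReflection (root a) x)) / (x ⬝ᵥ root a))

/-- The `κ`-Laplacian `Δ_κ = ∑_j D_j²` on `ℝ^d`. -/
def dunklLaplacian {d : ℕ} {ι : Type} [Fintype ι] (root : ι → Fin d → ℝ) (mult : ι → ℝ)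
    (F : (Fin d → ℝ) → ℝ) (x : Fin d → ℝ) : ℝ :=
  ∑ j, dunklOp root mult j (dunklOp root mult j F) x

/-- The Euler operator `⟨x, ∇⟩`. -/
def eulerOp {d : ℕ} (F : (Fin d → ℝ) → ℝ) (x : Fin d → ℝ) : ℝ :=
  ∑ i, x i * partialD i F x

/-- The analogue of the Dunkl-Laplace-Beltrami operator on the unit ball, for the weight
`∏_v |⟨x, v⟩|^{2 κ_v} (1 - ‖x‖²)^{μ - 1/2}`:
`Δ^B = Δ_κ - ⟨x, ∇⟩² - 2 λ ⟨x, ∇⟩`, with `λ = ∑_v κ_v + μ + (d - 1) / 2`. -/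
def ballLaplacian {d : ℕ} {ι : Type} [Fintype ι] (root : ι → Fin d → ℝ) (mult : ι → ℝ) (μ : ℝ)
    (F : (Fin d → ℝ) → ℝ) (x : Fin d → ℝ) : ℝ :=
  dunklLaplacian root mult F x - eulerOp (eulerOp F) x
    - 2 * ((∑ a, mult a) + μ + ((d : ℝ) - 1) / 2) * eulerOp F x

/-- Positive roots `√2 e_i` of the group `ℤ₂^d`. -/
def signChangeRoot {d : ℕ} (i : Fin d) : Fin d → ℝ := √2 • Pi.single i 1

/-- Positive roots `√2 e_i`, `e_i - e_j`, `e_i + e_j` (`i < j`) of the hyperoctahedral group. -/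
def hyperoctahedralRoot {d : ℕ} : Fin d ⊕ (OrderedPair d ⊕ OrderedPair d) → Fin d → ℝ
  | .inl i => √2 • Pi.single i 1
  | .inr (.inl p) => Pi.single p.1.1 1 - Pi.single p.1.2 1
  | .inr (.inr p) => Pi.single p.1.1 1 + Pi.single p.1.2 1

/-- Multiplicities on the positive roots of the hyperoctahedral group: `κ'` on `√2 e_i` and
`κ / 2` on `e_i ± e_j`, so that `∏_v |⟨u, v⟩|^{2 κ_v}` is, up to a constant factor,
`∏_i |u_i|^{2κ'} ∏_{i<j} |u_i² - u_j²|^κ`; this and `x = ψ(u)` give the factor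
`∏_{i<j} |x_i - x_j|^κ` of the weight on the simplex. -/
def hyperoctahedralMult {d : ℕ} (κ' κ : ℝ) : Fin d ⊕ (OrderedPair d ⊕ OrderedPair d) → ℝ
  | .inl _ => κ'
  | .inr _ => κ / 2

/-- The operator `Δ^B` on the ball that belongs to the weight `W^T` under `x = ψ(u)`. -/
def SimplexWeight.ballOp {d : ℕ} :
    SimplexWeight d → ((Fin d → ℝ) → ℝ) → (Fin d → ℝ) → ℝ
  | .signChange κ =>
      ballLaplacian signChangeRoot (fun i : Fin d => (κ i.castSucc : ℝ)) (κ (Fin.last d))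
  | .hyperoctahedral κ' κ μ =>
      ballLaplacian hyperoctahedralRoot (hyperoctahedralMult κ' κ) μ

/-- The analogue `Δ^T` of the Dunkl-Laplace-Beltrami operator on the simplex:
`(Δ^T f) ∘ ψ = (1/4) Δ^B (f ∘ ψ)`. -/
def SimplexWeight.laplacian {d : ℕ} (w : SimplexWeight d)
    (f : (Fin d → ℝ) → ℝ) (x : Fin d → ℝ) : ℝ :=
  (1 / 4) * w.ballOp (f ∘ psi) (psiInv x)

/-- `g = √(-Δ^T) f`: the function `g` is in `L²(W^T)`, and for every polynomial eigenfunction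
`-Δ^T P = ν P` the component of `g` along `P` is `√ν` times that of `f`. (The polynomial
eigenfunctions are the orthogonal polynomials of degree `n = 0, 1, …` for `W^T`, so this says
`proj_n g = √ν_n proj_n f` for all `n`, and it determines `g` almost everywhere.) -/
def SimplexWeight.IsSqrtNegLaplacian {d : ℕ} {𝕜 : Type*} [RCLike 𝕜] (w : SimplexWeight d)
    (f g : (Fin d → ℝ) → 𝕜) : Prop :=
  MemLp g 2 w.measure ∧
    ∀ (P : MvPolynomial (Fin d) ℝ) (ν : ℝ),
      (∀ᵐ x ∂volume.restrict (simplexT d),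
        -w.laplacian (fun z => MvPolynomial.eval z P) x = ν * MvPolynomial.eval x P) →
      ∫ x, g x * ((MvPolynomial.eval x P : ℝ) : 𝕜) ∂w.measure =
        ((√ν : ℝ) : 𝕜) * ∫ x, f x * ((MvPolynomial.eval x P : ℝ) : 𝕜) ∂w.measure

/-- The spread `∫_{T^d} (1 - ⟨ψ⁻¹(x), ψ⁻¹(y)⟩) |f(x)|² W^T(x) dx` of `f` around `y`. -/
def SimplexWeight.spread {d : ℕ} {𝕜 : Type*} [RCLike 𝕜] (w : SimplexWeight d)
    (f : (Fin d → ℝ) → 𝕜) (y : Fin d → ℝ) : ℝ :=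
  ∫ x, (1 - psiInv x ⬝ᵥ psiInv y) * ‖f x‖ ^ 2 ∂w.measure

end

/-! Write t = 1 - |x| (`bary none`), b = `expo none`, A = λ + 1, G = ∫ |√(-Δ^T) f|² W^T and M = ∫ t
|f|² W^T. The location y disappears at once: √(x_i y_i) ≤ (x_i + y_i)/2 and |y| ≤ 1 give 1 - ⟨√x,
√y⟩ ≥ t/2, so every spread is at least M/2. It remains to bound M·G from below.

The function r(x) = |x| satisfies Δ^T r = A t - b. Testing Green's identity with P² against r gives
b ∫ P² = A ∫ t P² + 2 ∫ t P·EP for a polynomial P, where E is the Euler operator. Since t (EP)² is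
at most the carré du champ of P, a weighted arithmetic-geometric inequality yields b ‖P‖² ≤ (A + s)
∫ t P² + s⁻¹ ⟨-Δ^T P, P⟩ for every s > 0 (`radial_inequality`). Orthogonal projection on polynomials
extends this to f, with G in place of the energy (`radial_inequality_of_isSqrt`). For f of mean zero
the eigenvalues that occur are n(n + λ) with n ≥ 1, hence A ≤ G (`spectral_gap`). The choice s =
2G/b then gives M·G ≥ b²/(2(b + 2)).

The analytic core is Green's identity `setIntegral_green`. The local part of Δ^T is a sum of
one-dimensional operators along the edges of the simplex, each integrated by parts on lines. The
factors |x_i - x_j|^κ are first made smooth by ε, and the reflection terms are handled by the swap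
symmetry of the weight. The algebraic core is that Δ^T maps polynomials to polynomials and is
triangular with respect to degree (`SimplexWeight.laplacian_eval`, `lapPoly_add_smul_mem_degLT`).
Symmetry and density of polynomials then give the spectral decomposition through the abstract
`EigenFiltration`. Existence of √(-Δ^T) f for f of class C¹ follows because projection on
polynomials does not increase the energy (`exists_isSqrt_toLp`). -/

/-! ### Polynomials by degree, and `Δ^T` as a triangular operator on them. -/

section PolynomialAlgebra

open MvPolynomial

variable {d : ℕ}

/-- Polynomials of total degree less than `n`. -/
noncomputable def degLT (d n : ℕ) : Submodule ℝ (MvPolynomial (Fin d) ℝ) where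
  carrier := {P | ∀ s : Fin d →₀ ℕ, n ≤ s.degree → P.coeff s = 0}
  add_mem' := fun {P Q} hP hQ s hs => by simp [hP s hs, hQ s hs]
  zero_mem' := fun s _ => by simp
  smul_mem' := fun c P hP s hs => by simp [hP s hs]

lemma mem_degLT {n : ℕ} {P : MvPolynomial (Fin d) ℝ} :
    P ∈ degLT d n ↔ ∀ s : Fin d →₀ ℕ, n ≤ s.degree → P.coeff s = 0 := Iff.rfl

/-- The strict degree bound makes the filtration start at the zero space, so the step from n to n +
1 adds exactly the degree n. -/
lemma degLT_zero : degLT d 0 = ⊥ := by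
  ext P
  simp only [mem_degLT, Submodule.mem_bot]
  exact ⟨fun h => MvPolynomial.ext _ _ fun s => by simpa using h s (Nat.zero_le _),
    fun h s _ => by simp [h]⟩

lemma degLT_mono : Monotone (degLT d) := fun _ _ h _ hP s hs => hP s (h.trans hs)

lemma mem_degLT_of_totalDegree_lt {n : ℕ} {P : MvPolynomial (Fin d) ℝ} (h : P.totalDegree < n) :
    P ∈ degLT d n := by
  intro s hs
  apply coeff_eq_zero_of_totalDegree_lt
  rw [← Finsupp.degree_apply]
  omega

lemma totalDegree_lt_of_mem_degLT {n : ℕ} {P : MvPolynomial (Fin d) ℝ} (h : P ∈ degLT d n)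
    (hP : P ≠ 0) : P.totalDegree < n := by
  by_contra hn
  push Not at hn
  obtain ⟨s, hs, hs'⟩ := Finset.exists_mem_eq_sup P.support (support_nonempty.2 hP)
    (fun s => s.degree)
  have h1 : P.totalDegree = s.degree := hs'
  exact mem_support_iff.1 hs (h s (h1 ▸ hn))

lemma exists_mem_degLT (P : MvPolynomial (Fin d) ℝ) : ∃ n, P ∈ degLT d n :=
  ⟨P.totalDegree + 1, mem_degLT_of_totalDegree_lt (Nat.lt_succ_self _)⟩

instance finiteDimensional_degLT (n : ℕ) : FiniteDimensional ℝ (degLT d n) := by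
  refine Submodule.finiteDimensional_of_le (S₂ := restrictTotalDegree (Fin d) ℝ n) fun P hP => ?_
  rw [mem_restrictTotalDegree]
  by_cases h : P = 0
  · simp [h]
  · exact (totalDegree_lt_of_mem_degLT hP h).le

lemma pderiv_mem_degLT {n : ℕ} {P : MvPolynomial (Fin d) ℝ} (hP : P ∈ degLT d (n + 1))
    (i : Fin d) : pderiv i P ∈ degLT d n := by
  intro s hs
  rw [coeff_pderiv, hP _ (by simpa using hs)]
  simp

lemma X_mul_mem_degLT {n : ℕ} {P : MvPolynomial (Fin d) ℝ} (hP : P ∈ degLT d n) (i : Fin d) :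
    X i * P ∈ degLT d (n + 1) := by
  by_cases h : P = 0
  · simp [h]
  refine mem_degLT_of_totalDegree_lt ?_
  have h1 := totalDegree_mul (X i) P
  have h2 := totalDegree_lt_of_mem_degLT hP h
  rw [totalDegree_X] at h1
  omega

lemma rename_mem_degLT {n : ℕ} {P : MvPolynomial (Fin d) ℝ} (hP : P ∈ degLT d n)
    (σ : Fin d → Fin d) : rename σ P ∈ degLT d n := by
  by_cases h : P = 0
  · simp [h]
  · exact mem_degLT_of_totalDegree_lt
      ((totalDegree_rename_le _ _).trans_lt (totalDegree_lt_of_mem_degLT hP h))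

/-- The Euler operator `∑ X_i ∂_i` on polynomials. -/
noncomputable def eulerPoly (d : ℕ) : MvPolynomial (Fin d) ℝ →ₗ[ℝ] MvPolynomial (Fin d) ℝ :=
  ∑ i, (LinearMap.mulLeft ℝ (X i)).comp (pderiv i).toLinearMap

lemma eulerPoly_apply (P : MvPolynomial (Fin d) ℝ) : eulerPoly d P = ∑ i, X i * pderiv i P := by
  simp [eulerPoly]

lemma coeff_eulerPoly (P : MvPolynomial (Fin d) ℝ) (s : Fin d →₀ ℕ) :
    (eulerPoly d P).coeff s = s.degree * P.coeff s := by
  classical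
  rw [eulerPoly_apply, coeff_sum, Finsupp.degree_eq_sum]
  push_cast
  rw [Finset.sum_mul]
  refine Finset.sum_congr rfl fun i _ => ?_
  rw [coeff_X_mul']
  split_ifs with h
  · rw [coeff_pderiv, tsub_add_cancel_of_le]
    · have : s i ≠ 0 := by simpa using h
      have h2 : (((s - Finsupp.single i 1 : Fin d →₀ ℕ) i : ℕ) : ℝ) + 1 = s i := by
        have : (s - Finsupp.single i 1 : Fin d →₀ ℕ) i + 1 = s i := by
          simp only [Finsupp.tsub_apply, Finsupp.single_eq_same]; omega
        exact_mod_cast this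
      rw [h2, mul_comm]
    · rw [Finsupp.single_le_iff]
      have : s i ≠ 0 := by simpa using h
      omega
  · have : s i = 0 := by simpa using h
    simp [this]

lemma eulerPoly_mem_degLT {n : ℕ} {P : MvPolynomial (Fin d) ℝ} (hP : P ∈ degLT d n) :
    eulerPoly d P ∈ degLT d n := fun s hs => by rw [coeff_eulerPoly, hP s hs, mul_zero]

lemma eulerPoly_sub_smul_mem_degLT {n : ℕ} {P : MvPolynomial (Fin d) ℝ}
    (hP : P ∈ degLT d (n + 1)) : eulerPoly d P - (n : ℝ) • P ∈ degLT d n := by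
  intro s hs
  rw [coeff_sub, coeff_smul, coeff_eulerPoly, smul_eq_mul]
  rcases hs.eq_or_lt with h | h
  · rw [h]; ring
  · rw [hP s h]; ring

/-- Induction over monomials: with σ the swap, X_k P - σ(X_k P) = X_k (P - σP) + (X_k - X_{σk}) σP,
and X_k - X_{σk} is 0 or ±(X_i - X_j). -/
lemma exists_sub_rename_swap (i j : Fin d) (P : MvPolynomial (Fin d) ℝ) :
    ∃ T : MvPolynomial (Fin d) ℝ, (X i - X j) * T = P - rename (Equiv.swap i j) P := by
  induction P using MvPolynomial.induction_on with
  | C c => exact ⟨0, by simp⟩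
  | add P Q hP hQ =>
    obtain ⟨T, hT⟩ := hP
    obtain ⟨U, hU⟩ := hQ
    exact ⟨T + U, by rw [mul_add, hT, hU, map_add]; ring⟩
  | mul_X P k hP =>
    obtain ⟨T, hT⟩ := hP
    rcases eq_or_ne k i with rfl | hi
    · refine ⟨X k * T + rename (Equiv.swap k j) P, ?_⟩
      simp only [map_mul, rename_X, Equiv.swap_apply_left]
      linear_combination X k * hT
    rcases eq_or_ne k j with rfl | hj
    · refine ⟨X k * T - rename (Equiv.swap i k) P, ?_⟩
      simp only [map_mul, rename_X, Equiv.swap_apply_right]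
      linear_combination X k * hT
    · refine ⟨X k * T, ?_⟩
      simp only [map_mul, rename_X, Equiv.swap_apply_of_ne_of_ne hi hj]
      linear_combination X k * hT

/-- The numerator of the Dunkl term of a pair. -/
noncomputable def pairNum (p : OrderedPair d) :
    MvPolynomial (Fin d) ℝ →ₗ[ℝ] MvPolynomial (Fin d) ℝ :=
  (LinearMap.mulLeft ℝ ((X p.1.1 - X p.1.2) * X p.1.1)).comp (pderiv p.1.1).toLinearMap
    - (LinearMap.mulLeft ℝ ((X p.1.1 - X p.1.2) * X p.1.2)).comp (pderiv p.1.2).toLinearMap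
    - (LinearMap.mulLeft ℝ (C (1 / 2) * (X p.1.1 + X p.1.2))).comp
        (LinearMap.id - (rename (Equiv.swap p.1.1 p.1.2)).toLinearMap)

lemma pairNum_apply (p : OrderedPair d) (P : MvPolynomial (Fin d) ℝ) :
    pairNum p P = (X p.1.1 * pderiv p.1.1 P - X p.1.2 * pderiv p.1.2 P) * (X p.1.1 - X p.1.2)
      - C (1 / 2) * (X p.1.1 + X p.1.2) * (P - rename (Equiv.swap p.1.1 p.1.2) P) := by
  simp only [pairNum, LinearMap.sub_apply, LinearMap.comp_apply, LinearMap.mulLeft_apply,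
    Derivation.coeFn_coe, LinearMap.id_apply, AlgHom.toLinearMap_apply]
  ring

/-- The numerator vanishes to second order on X_i = X_j. In the induction over monomials, a factor
X_i adds (X_i - X_j) · ½ [(X_i - X_j) P + (X_i + X_j)(P - σP)], whose bracket is again divisible by
X_i - X_j by `exists_sub_rename_swap`; a factor X_j is similar. -/
lemma exists_pairNum_eq (p : OrderedPair d) (P : MvPolynomial (Fin d) ℝ) :
    ∃ R : MvPolynomial (Fin d) ℝ, (X p.1.1 - X p.1.2) ^ 2 * R = pairNum p P := by
  obtain ⟨⟨i, j⟩, hij⟩ := p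
  have hij' : i ≠ j := ne_of_lt hij
  have half : (C (1 / 2) : MvPolynomial (Fin d) ℝ) * 2 = 1 := by
    rw [show (2 : MvPolynomial (Fin d) ℝ) = C 2 from rfl, ← C_mul]; norm_num
  induction P using MvPolynomial.induction_on with
  | C c => exact ⟨0, by simp [pairNum_apply]⟩
  | add P Q hP hQ =>
    obtain ⟨T, hT⟩ := hP
    obtain ⟨U, hU⟩ := hQ
    exact ⟨T + U, by rw [mul_add, hT, hU, map_add]⟩
  | mul_X P k hP =>
    obtain ⟨R, hR⟩ := hP
    obtain ⟨T, hT⟩ := exists_sub_rename_swap i j P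
    simp only [pairNum_apply] at hR ⊢
    rcases eq_or_ne k i with rfl | hi
    · refine ⟨X k * R + C (1 / 2) * P + C (1 / 2) * (X k + X j) * T, ?_⟩
      simp only [map_mul, rename_X, Equiv.swap_apply_left, pderiv_mul, pderiv_X_self,
        pderiv_X_of_ne hij']
      linear_combination X k * hR + C (1 / 2) * (X k + X j) * (X k - X j) * hT
        + (X k) * P * (X k - X j) * half
    rcases eq_or_ne k j with rfl | hj
    · refine ⟨X k * R + C (1 / 2) * P - C (1 / 2) * (X i + X k) * T, ?_⟩
      simp only [map_mul, rename_X, Equiv.swap_apply_right, pderiv_mul, pderiv_X_self,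
        pderiv_X_of_ne hij'.symm]
      linear_combination X k * hR - C (1 / 2) * (X i + X k) * (X i - X k) * hT
        - (X k) * P * (X i - X k) * half
    · refine ⟨X k * R, ?_⟩
      simp only [map_mul, rename_X, Equiv.swap_apply_of_ne_of_ne hi hj, pderiv_mul,
        pderiv_X_of_ne hi, pderiv_X_of_ne hj]
      linear_combination X k * hR

lemma X_sub_X_sq_ne_zero (p : OrderedPair d) :
    ((X p.1.1 - X p.1.2) ^ 2 : MvPolynomial (Fin d) ℝ) ≠ 0 := by
  refine pow_ne_zero _ (sub_ne_zero.2 fun h => ?_)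
  exact (ne_of_lt p.2) (X_injective h)

/-- The Dunkl term of a pair: the quotient of `pairNum` by `(X_i - X_j)²`. -/
noncomputable def pairTerm (p : OrderedPair d) :
    MvPolynomial (Fin d) ℝ →ₗ[ℝ] MvPolynomial (Fin d) ℝ where
  toFun P := (exists_pairNum_eq p P).choose
  map_add' P Q := by
    apply mul_left_cancel₀ (X_sub_X_sq_ne_zero p)
    rw [mul_add, (exists_pairNum_eq p _).choose_spec, (exists_pairNum_eq p _).choose_spec,
      (exists_pairNum_eq p _).choose_spec, map_add]
  map_smul' c P := by
    apply mul_left_cancel₀ (X_sub_X_sq_ne_zero p)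
    rw [RingHom.id_apply, mul_smul_comm, (exists_pairNum_eq p _).choose_spec,
      (exists_pairNum_eq p _).choose_spec, map_smul]

lemma sq_mul_pairTerm (p : OrderedPair d) (P : MvPolynomial (Fin d) ℝ) :
    (X p.1.1 - X p.1.2) ^ 2 * pairTerm p P = pairNum p P := (exists_pairNum_eq p P).choose_spec

lemma totalDegree_X_sub_X_sq (p : OrderedPair d) :
    ((X p.1.1 - X p.1.2) ^ 2 : MvPolynomial (Fin d) ℝ).totalDegree = 2 := by
  have hne : (X p.1.1 - X p.1.2 : MvPolynomial (Fin d) ℝ) ≠ 0 :=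
    sub_ne_zero.2 fun h => (ne_of_lt p.2) (X_injective h)
  have hh : (X p.1.1 - X p.1.2 : MvPolynomial (Fin d) ℝ).IsHomogeneous 1 :=
    (isHomogeneous_X _ _).sub (isHomogeneous_X _ _)
  have := (hh.pow 2).totalDegree (pow_ne_zero 2 hne)
  simpa using this

/-- The numerator raises the degree by at most one, and total degree is additive over a domain, so
division by a quadratic lowers the degree by at least one in all. -/
lemma pairTerm_mem_degLT {n : ℕ} {P : MvPolynomial (Fin d) ℝ} (hP : P ∈ degLT d (n + 1))
    (p : OrderedPair d) : pairTerm p P ∈ degLT d n := by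
  by_cases h : pairTerm p P = 0
  · simp [h]
  refine mem_degLT_of_totalDegree_lt ?_
  have h1 : pairNum p P ∈ degLT d (n + 2) := by
    rw [pairNum_apply]
    have e1 := pderiv_mem_degLT hP p.1.1
    have e2 := pderiv_mem_degLT hP p.1.2
    have e3 := (degLT d (n + 1)).sub_mem hP (rename_mem_degLT hP (Equiv.swap p.1.1 p.1.2))
    have e4 := (degLT d (n + 1)).sub_mem (X_mul_mem_degLT e1 p.1.1) (X_mul_mem_degLT e2 p.1.2)
    have e5 : ((X p.1.1 * pderiv p.1.1 P - X p.1.2 * pderiv p.1.2 P) * (X p.1.1 - X p.1.2)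
      - C (1 / 2) * (X p.1.1 + X p.1.2) * (P - rename (Equiv.swap p.1.1 p.1.2) P)) =
      (X p.1.1 * (X p.1.1 * pderiv p.1.1 P - X p.1.2 * pderiv p.1.2 P)
        - X p.1.2 * (X p.1.1 * pderiv p.1.1 P - X p.1.2 * pderiv p.1.2 P))
      - (1 / 2 : ℝ) • (X p.1.1 * (P - rename (Equiv.swap p.1.1 p.1.2) P)
        + X p.1.2 * (P - rename (Equiv.swap p.1.1 p.1.2) P)) := by
      rw [smul_eq_C_mul]; ring
    rw [e5]
    exact Submodule.sub_mem _
      (Submodule.sub_mem _ (X_mul_mem_degLT e4 _) (X_mul_mem_degLT e4 _))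
      (Submodule.smul_mem _ _
        (Submodule.add_mem _ (X_mul_mem_degLT e3 _) (X_mul_mem_degLT e3 _)))
  have h2 : pairNum p P ≠ 0 := by
    rw [← sq_mul_pairTerm]
    exact mul_ne_zero (X_sub_X_sq_ne_zero p) h
  have h3 := totalDegree_lt_of_mem_degLT h1 h2
  rw [← sq_mul_pairTerm, totalDegree_mul_of_isDomain (X_sub_X_sq_ne_zero p) h,
    totalDegree_X_sub_X_sq] at h3
  omega

/-- The number `λ` of the weight with exponents `a` and `κ`. -/
noncomputable def lamParam (a : Option (Fin d) → ℝ) (κ : ℝ) : ℝ :=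
  ∑ k, a k + κ * Fintype.card (OrderedPair d) - 1

/-- The operator `Δ^T` on polynomials. -/
noncomputable def lapPoly (a : Option (Fin d) → ℝ) (κ : ℝ) :
    MvPolynomial (Fin d) ℝ →ₗ[ℝ] MvPolynomial (Fin d) ℝ :=
  ∑ i, ((LinearMap.mulLeft ℝ (X i)).comp ((pderiv i).toLinearMap.comp (pderiv i).toLinearMap)
      + a (some i) • (pderiv i).toLinearMap)
    - (eulerPoly d).comp (eulerPoly d) - lamParam a κ • eulerPoly d + κ • ∑ p, pairTerm p

lemma lapPoly_apply (a : Option (Fin d) → ℝ) (κ : ℝ) (P : MvPolynomial (Fin d) ℝ) :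
    lapPoly a κ P = ∑ i, (X i * pderiv i (pderiv i P) + a (some i) • pderiv i P)
      - eulerPoly d (eulerPoly d P) - lamParam a κ • eulerPoly d P
      + κ • ∑ p, pairTerm p P := by
  simp [lapPoly, LinearMap.sum_apply]

/-- The eigenvalue `n (n + λ)` of `-Δ^T` on orthogonal polynomials of degree `n`. -/
noncomputable def eigVal (a : Option (Fin d) → ℝ) (κ : ℝ) (n : ℕ) : ℝ :=
  n * (n + lamParam a κ)

/-- Only -E² - λE preserves the degree, and it multiplies the part of degree n by -n(n + λ). All
other terms lower the degree. -/
lemma lapPoly_add_smul_mem_degLT (a : Option (Fin d) → ℝ) (κ : ℝ) {n : ℕ}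
    {P : MvPolynomial (Fin d) ℝ} (hP : P ∈ degLT d (n + 1)) :
    lapPoly a κ P + eigVal a κ n • P ∈ degLT d n := by
  have e1 := eulerPoly_sub_smul_mem_degLT hP
  have e2 := eulerPoly_mem_degLT e1
  have h1 : ∑ i, (X i * pderiv i (pderiv i P) + a (some i) • pderiv i P) ∈ degLT d n := by
    refine Submodule.sum_mem _ fun i _ => Submodule.add_mem _ ?_
      (Submodule.smul_mem _ _ (pderiv_mem_degLT hP i))
    -- Multiplication by a variable raises the index by one, so it cannot be bounded by index 0;
    -- there the derivatives of constants vanish instead.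
    cases n with
    | zero =>
      have : pderiv i P = 0 := by simpa [degLT_zero] using pderiv_mem_degLT hP i
      simp [this]
    | succ n => exact X_mul_mem_degLT (pderiv_mem_degLT (pderiv_mem_degLT hP i) i) i
  have h2 : ∑ p, pairTerm p P ∈ degLT d n :=
    Submodule.sum_mem _ fun p _ => pairTerm_mem_degLT hP p
  -- Factorization E² + λE - n(n + λ) = E(E - n) + (n + λ)(E - n).
  have h3 : lapPoly a κ P + eigVal a κ n • P =
      ∑ i, (X i * pderiv i (pderiv i P) + a (some i) • pderiv i P)
        - eulerPoly d (eulerPoly d P - (n : ℝ) • P)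
        - (n + lamParam a κ) • (eulerPoly d P - (n : ℝ) • P) + κ • ∑ p, pairTerm p P := by
    rw [lapPoly_apply, eigVal]
    simp only [map_sub, map_smul]
    module
  rw [h3]
  exact Submodule.add_mem _ (Submodule.sub_mem _ (Submodule.sub_mem _ h1 e2)
    (Submodule.smul_mem _ _ e1)) (Submodule.smul_mem _ _ h2)

end PolynomialAlgebra

/-! ### Derivatives of polynomial functions and of their pull-backs along `psi`. -/

section EvalDerivative

open MvPolynomial

variable {d : ℕ}

lemma hasFDerivAt_eval (P : MvPolynomial (Fin d) ℝ) (x : Fin d → ℝ) :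
    HasFDerivAt (fun z : Fin d → ℝ => eval z P)
      (∑ i, eval x (pderiv i P) • ContinuousLinearMap.proj (R := ℝ) (φ := fun _ : Fin d => ℝ) i)
      x := by
  induction P using MvPolynomial.induction_on with
  | C c => simpa using hasFDerivAt_const c x
  | add P Q hP hQ =>
    simp only [map_add, add_smul, Finset.sum_add_distrib]
    exact hP.add hQ
  | mul_X P k hP =>
    have h := hP.mul (hasFDerivAt_apply (𝕜 := ℝ) k x)
    simp only [map_mul, eval_X, pderiv_mul, map_add]
    refine h.congr_fderiv ?_
    have hX : ∀ i, eval x (pderiv i (X k)) = if i = k then (1 : ℝ) else 0 := fun i => by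
      rw [pderiv_X, Pi.single_apply]
      split_ifs with h1 h2 h2
      · simp
      · exact absurd h1.symm h2
      · exact absurd h2.symm h1
      · simp
    ext v
    simp only [hX, add_apply, smul_apply,
      sum_apply, ContinuousLinearMap.proj_apply, smul_eq_mul, add_mul,
      Finset.sum_add_distrib, Finset.mul_sum]
    simp
    rw [add_comm]
    congr 1
    exact Finset.sum_congr rfl fun i _ => by ring

lemma contDiff_eval (P : MvPolynomial (Fin d) ℝ) {n : WithTop ℕ∞} :
    ContDiff ℝ n (fun z : Fin d → ℝ => eval z P) := by
  induction P using MvPolynomial.induction_on with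
  | C c => simpa using contDiff_const
  | add P Q hP hQ => simpa using hP.add hQ
  | mul_X P k hP => simpa using hP.mul (contDiff_apply ℝ ℝ k)

lemma eval_rename_perm (σ : Equiv.Perm (Fin d)) (P : MvPolynomial (Fin d) ℝ) (x : Fin d → ℝ) :
    eval x (rename σ P) = eval (fun i => x (σ i)) P := by
  rw [eval_rename]; rfl

lemma hasDerivAt_eval_psi (P : MvPolynomial (Fin d) ℝ) (u : Fin d → ℝ) (j : Fin d) :
    HasDerivAt (fun t : ℝ => eval (psi (u + t • Pi.single j 1)) P)
      (2 * u j * eval (psi u) (pderiv j P)) 0 := by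
  have h1 : HasDerivAt (fun t : ℝ => psi (u + t • Pi.single j (1 : ℝ)))
      (Pi.single j (2 * u j)) 0 := by
    rw [hasDerivAt_pi]
    intro l
    have h2 : HasDerivAt (fun t : ℝ => (u l + t * (Pi.single j 1 : Fin d → ℝ) l) ^ 2)
        (2 * (u l + 0 * (Pi.single j 1 : Fin d → ℝ) l) * (1 * (Pi.single j 1 : Fin d → ℝ) l)) 0 := by
      simpa using ((((hasDerivAt_id (0 : ℝ)).mul_const
        ((Pi.single j 1 : Fin d → ℝ) l)).const_add (u l)).fun_pow 2)
    refine h2.congr_deriv ?_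
    rcases eq_or_ne l j with rfl | h
    · simp
    · simp [h]
  have h0 : psi (u + (0 : ℝ) • Pi.single j (1 : ℝ)) = psi u := by simp
  have h3 := (h0 ▸ hasFDerivAt_eval P (psi u) :
    HasFDerivAt (fun z : Fin d → ℝ => eval z P) _ (psi (u + (0 : ℝ) • Pi.single j (1 : ℝ))))
  refine (h3.comp_hasDerivAt (0 : ℝ) h1).congr_deriv ?_
  simp [Pi.single_apply]
  ring

lemma partialD_eval_psi (P : MvPolynomial (Fin d) ℝ) (u : Fin d → ℝ) (j : Fin d) :
    partialD j (fun v => eval (psi v) P) u = 2 * u j * eval (psi u) (pderiv j P) :=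
  (hasDerivAt_eval_psi P u j).deriv

lemma eval_eulerPoly (P : MvPolynomial (Fin d) ℝ) (x : Fin d → ℝ) :
    eval x (eulerPoly d P) = ∑ i, x i * eval x (pderiv i P) := by
  simp [eulerPoly_apply]

lemma eulerOp_eval_psi (P : MvPolynomial (Fin d) ℝ) (c : ℝ) :
    eulerOp (fun v : Fin d → ℝ => c * eval (psi v) P) =
      fun v => (2 * c) * eval (psi v) (eulerPoly d P) := by
  funext u
  rw [eval_eulerPoly, eulerOp, Finset.mul_sum]
  refine Finset.sum_congr rfl fun i _ => ?_
  have : partialD i (fun v : Fin d → ℝ => c * eval (psi v) P) u =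
      c * (2 * u i * eval (psi u) (pderiv i P)) :=
    ((hasDerivAt_eval_psi P u i).const_mul c).deriv
  rw [this]
  simp only [psi]
  ring

lemma psi_psiInv {x : Fin d → ℝ} (hx : ∀ i, 0 ≤ x i) : psi (psiInv x) = x := by
  funext i
  simp [psi, psiInv, Real.sq_sqrt (hx i)]

end EvalDerivative

/-! ### Sums over pairs and triples of indices. -/

section PairSums

variable {d : ℕ}

/-- Passes from sums over roots, indexed by i < j, to full double sums, where antisymmetry arguments
apply. -/
lemma sum_orderedPair_add_swap {M : Type*} [AddCommMonoid M] (f : Fin d → Fin d → M)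
    (hf : ∀ i, f i i = 0) :
    ∑ p : OrderedPair d, (f p.1.1 p.1.2 + f p.1.2 p.1.1) = ∑ i, ∑ j, f i j := by
  rw [Finset.sum_add_distrib]
  have h1 : ∑ p : OrderedPair d, f p.1.1 p.1.2 = ∑ i, ∑ j, if i < j then f i j else 0 := by
    rw [← Finset.sum_product' Finset.univ Finset.univ (fun i j => if i < j then f i j else 0),
      Finset.univ_product_univ, ← Finset.sum_filter]
    exact (Finset.sum_subtype (Finset.univ.filter fun q : Fin d × Fin d => q.1 < q.2)
      (fun q => by simp) (fun q => f q.1 q.2)).symm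
  have h2 : ∑ p : OrderedPair d, f p.1.2 p.1.1 = ∑ i, ∑ j, if j < i then f i j else 0 := by
    rw [Finset.sum_comm,
      ← Finset.sum_product' Finset.univ Finset.univ (fun j i => if j < i then f i j else 0),
      Finset.univ_product_univ, ← Finset.sum_filter]
    exact (Finset.sum_subtype (Finset.univ.filter fun q : Fin d × Fin d => q.1 < q.2)
      (fun q => by simp) (fun q => f q.2 q.1)).symm
  rw [h1, h2, ← Finset.sum_add_distrib]
  refine Finset.sum_congr rfl fun i _ => ?_
  rw [← Finset.sum_add_distrib]
  refine Finset.sum_congr rfl fun j _ => ?_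
  rcases lt_trichotomy i j with h | rfl | h
  · simp [h, h.not_gt]
  · simp [hf]
  · simp [h, h.not_gt]

lemma sum_orderedPair_incident (j : Fin d) (φ : Fin d → ℝ) (hφ : φ j = 0) :
    ∑ p : OrderedPair d, ((if p.1.1 = j then φ p.1.2 else 0) + (if p.1.2 = j then φ p.1.1 else 0))
      = ∑ l, φ l := by
  rw [sum_orderedPair_add_swap (fun i k => if i = j then φ k else 0)]
  · rw [Finset.sum_eq_single j]
    · simp
    · intro b _ hb; simp [hb]
    · simp
  · intro i
    rcases eq_or_ne i j with rfl | h
    · simpa using hφ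
    · simp [h]

lemma sum_sum_eq_zero_of_antisymm {ι : Type*} [Fintype ι] (f : ι → ι → ℝ)
    (hf : ∀ i j, f i j = -f j i) : ∑ i, ∑ j, f i j = 0 := by
  have h : ∑ i, ∑ j, f i j = -∑ i, ∑ j, f i j := by
    conv_lhs => rw [Finset.sum_comm]
    rw [← Finset.sum_neg_distrib]
    refine Finset.sum_congr rfl fun i _ => ?_
    rw [← Finset.sum_neg_distrib]
    exact Finset.sum_congr rfl fun j _ => hf j i
  linarith

/-- Each of the six permutations of the indices leaves the triple sum unchanged, so six times the
sum is the sum of the symmetrization. -/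
lemma sum_sum_sum_eq_zero_of_symmetrized {ι : Type*} [Fintype ι] (f : ι → ι → ι → ℝ)
    (hf : ∀ i j k, f i j k + f i k j + f j i k + f j k i + f k i j + f k j i = 0) :
    ∑ i, ∑ j, ∑ k, f i j k = 0 := by
  have e1 : ∑ i, ∑ j, ∑ k, f i k j = ∑ i, ∑ j, ∑ k, f i j k :=
    Finset.sum_congr rfl fun i _ => Finset.sum_comm
  have e2 : ∑ i, ∑ j, ∑ k, f j i k = ∑ i, ∑ j, ∑ k, f i j k := Finset.sum_comm
  have e3 : ∑ i, ∑ j, ∑ k, f j k i = ∑ i, ∑ j, ∑ k, f i j k := by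
    rw [Finset.sum_comm]
    exact Finset.sum_congr rfl fun i _ => Finset.sum_comm
  have e4 : ∑ i, ∑ j, ∑ k, f k i j = ∑ i, ∑ j, ∑ k, f i j k := 
    (Finset.sum_congr rfl fun i _ => Finset.sum_comm).trans e2
  have e5 : ∑ i, ∑ j, ∑ k, f k j i = ∑ i, ∑ j, ∑ k, f i j k := by
    rw [← e4]
    exact Finset.sum_comm
  have h := Finset.sum_congr (rfl : (Finset.univ : Finset ι) = Finset.univ) fun i _ =>
    Finset.sum_congr (rfl : (Finset.univ : Finset ι) = Finset.univ) fun j _ =>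
    Finset.sum_congr (rfl : (Finset.univ : Finset ι) = Finset.univ) fun k _ => hf i j k
  simp only [Finset.sum_add_distrib, Finset.sum_const_zero, e1, e2, e3, e4, e5] at h
  linarith

end PairSums

/-! ### Dunkl operators on functions of the squared coordinates. -/

section Dunkl

open MvPolynomial

variable {d : ℕ}

/-- The point with the sign of the `j`-th coordinate changed. -/
def flipSign (j : Fin d) (u : Fin d → ℝ) : Fin d → ℝ := Function.update u j (-u j)

/-- The point with the coordinates `i` and `j` swapped. -/
def swapCoord (i j : Fin d) (u : Fin d → ℝ) : Fin d → ℝ := fun m => u (Equiv.swap i j m)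

/-- The point with the coordinates `i` and `j` swapped and their signs changed. -/
def swapNeg (i j : Fin d) (u : Fin d → ℝ) : Fin d → ℝ :=
  fun m => if m = i then -u j else if m = j then -u i else u m

lemma swapCoord_comm (i j : Fin d) (u : Fin d → ℝ) : swapCoord i j u = swapCoord j i u := by
  unfold swapCoord
  rw [Equiv.swap_comm]

lemma swapNeg_comm (i j : Fin d) (u : Fin d → ℝ) : swapNeg i j u = swapNeg j i u := by
  funext m
  simp only [swapNeg]
  split_ifs with h1 h2 <;> simp_all

lemma rootReflection_sqrt_two_single (i : Fin d) (u : Fin d → ℝ) :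
    rootReflection (√2 • Pi.single i 1) u = flipSign i u := by
  have h2 : √2 * √2 = 2 := Real.mul_self_sqrt (by norm_num)
  funext m
  rcases eq_or_ne m i with rfl | h
  · simp [rootReflection, flipSign, dotProduct_smul, h2]
    linear_combination (-u m) * h2
  · simp [rootReflection, flipSign, h]

lemma rootReflection_single_sub_single {i j : Fin d} (hij : i ≠ j) (u : Fin d → ℝ) :
    rootReflection (Pi.single i 1 - Pi.single j 1) u = swapCoord i j u := by
  funext m
  rcases eq_or_ne m i with rfl | hi
  · simp [rootReflection, swapCoord, hij, hij.symm]
    ring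
  rcases eq_or_ne m j with rfl | hj
  · simp [rootReflection, swapCoord, hij, hij.symm]
    ring
  · simp [rootReflection, swapCoord, hi, hj, Equiv.swap_apply_of_ne_of_ne]

lemma rootReflection_single_add_single {i j : Fin d} (hij : i ≠ j) (u : Fin d → ℝ) :
    rootReflection (Pi.single i 1 + Pi.single j 1) u = swapNeg i j u := by
  funext m
  rcases eq_or_ne m i with rfl | hi
  · simp [rootReflection, swapNeg, hij, hij.symm]
    ring
  rcases eq_or_ne m j with rfl | hj
  · simp [rootReflection, swapNeg, hij, hij.symm]
    ring
  · simp [rootReflection, swapNeg, hi, hj]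

lemma dunklOp_signChangeRoot (mult : Fin d → ℝ) (j : Fin d) (G : (Fin d → ℝ) → ℝ)
    (u : Fin d → ℝ) :
    dunklOp signChangeRoot mult j G u =
      partialD j G u + mult j * ((G u - G (flipSign j u)) / u j) := by
  have h2 : √2 ≠ 0 := by positivity
  rw [dunklOp, Finset.sum_eq_single j]
  · congr 1
    rw [signChangeRoot, rootReflection_sqrt_two_single]
    simp only [Pi.smul_apply, Pi.single_eq_same, smul_eq_mul, dotProduct_smul,
      dotProduct_single]
    -- On the hyperplane u_j = 0 both quotients have denominator zero and take the default value 0.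
    by_cases hu : u j = 0
    · simp [hu]
    · field_simp
  · intro b _ hb
    simp [signChangeRoot, hb.symm]
  · simp

/-- Only pairs containing j contribute. For e_i - e_j the sign of the root component and that of ⟨u,
v⟩ both change with the position of j in the pair, so the quotient does not depend on the order. -/
lemma dunklOp_hyperoctahedralRoot (κ' κ : ℝ) (j : Fin d) (G : (Fin d → ℝ) → ℝ)
    (u : Fin d → ℝ) :
    dunklOp hyperoctahedralRoot (hyperoctahedralMult κ' κ) j G u =
      partialD j G u + κ' * ((G u - G (flipSign j u)) / u j) +
        κ / 2 * ∑ l, if l = j then 0 else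
          (G u - G (swapCoord j l u)) / (u j - u l) + (G u - G (swapNeg j l u)) / (u j + u l) := by
  have key := dunklOp_signChangeRoot (fun _ => κ') j G u
  rw [dunklOp] at key ⊢
  rw [Fintype.sum_sum_type, Fintype.sum_sum_type, add_assoc, ← add_left_cancel key]
  congr 2
  rw [← Finset.sum_add_distrib, ← sum_orderedPair_incident j _ (by simp), Finset.mul_sum]
  refine Finset.sum_congr rfl fun p _ => ?_
  have hp : p.1.1 ≠ p.1.2 := ne_of_lt p.2
  simp only [hyperoctahedralRoot, hyperoctahedralMult, rootReflection_single_sub_single hp,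
    rootReflection_single_add_single hp, Pi.sub_apply, Pi.add_apply, dotProduct_sub,
    dotProduct_add, dotProduct_single, mul_one]
  rcases eq_or_ne p.1.1 j with rfl | h1
  · simp [hp, hp.symm]
    ring
  rcases eq_or_ne p.1.2 j with rfl | h2
  · simp [hp, hp.symm]
    rw [swapCoord_comm p.1.2, swapNeg_comm p.1.2, add_comm (u p.1.2),
      ← neg_sub (u p.1.1) (u p.1.2), div_neg]
    ring
  · simp [h1, h2, h1.symm, h2.symm]

/-- The points of `ℝ^d` off all reflection hyperplanes of the hyperoctahedral group. -/
def genericBall (d : ℕ) : Set (Fin d → ℝ) :=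
  {u | (∀ i, u i ≠ 0) ∧ ∀ i j, i ≠ j → u i ^ 2 ≠ u j ^ 2}

/-- Openness allows differentiating an identity that is known only off the hyperplanes. -/
lemma isOpen_genericBall : IsOpen (genericBall d) := by
  have h : genericBall d = (⋂ i, {u | u i ≠ 0}) ∩ ⋂ i, ⋂ j, ⋂ _ : i ≠ j,
      {u | u i ^ 2 ≠ u j ^ 2} := by
    ext u; simp [genericBall]
  rw [h]
  refine (isOpen_iInter_of_finite fun i => ?_).inter (isOpen_iInter_of_finite fun i =>
    isOpen_iInter_of_finite fun j => isOpen_iInter_of_finite fun _ => ?_)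
  · exact isOpen_ne_fun (continuous_apply i) continuous_const
  · exact isOpen_ne_fun ((continuous_apply i).pow 2) ((continuous_apply j).pow 2)

lemma psi_flipSign (j : Fin d) (u : Fin d → ℝ) : psi (flipSign j u) = psi u := by
  funext m
  rcases eq_or_ne m j with rfl | h <;> simp [psi, flipSign, *]

lemma psi_swapCoord (i j : Fin d) (u : Fin d → ℝ) :
    psi (swapCoord i j u) = swapCoord i j (psi u) := rfl

lemma psi_swapNeg (i j : Fin d) (u : Fin d → ℝ) :
    psi (swapNeg i j u) = swapCoord i j (psi u) := by
  funext m
  rcases eq_or_ne m i with rfl | hi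
  · simp [psi, swapNeg, swapCoord]
  rcases eq_or_ne m j with rfl | hj
  · simp [psi, swapNeg, swapCoord, hi]
  · simp [psi, swapNeg, swapCoord, hi, hj, Equiv.swap_apply_of_ne_of_ne]

lemma mem_genericBall_of_psi {u v : Fin d → ℝ} (σ : Equiv.Perm (Fin d))
    (h : psi v = fun m => psi u (σ m)) (hu : u ∈ genericBall d) : v ∈ genericBall d := by
  have h' : ∀ m, v m ^ 2 = u (σ m) ^ 2 := fun m => congrFun h m
  refine ⟨fun i hi => ?_, fun i j hij => ?_⟩
  · have := h' i
    rw [hi] at this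
    exact hu.1 (σ i) (by simpa using this.symm)
  · rw [h', h']
    exact hu.2 _ _ (σ.injective.ne hij)

lemma flipSign_mem_genericBall {u : Fin d → ℝ} (hu : u ∈ genericBall d) (j : Fin d) :
    flipSign j u ∈ genericBall d :=
  mem_genericBall_of_psi 1 (by rw [psi_flipSign]; rfl) hu

lemma swapCoord_mem_genericBall {u : Fin d → ℝ} (hu : u ∈ genericBall d) (i j : Fin d) :
    swapCoord i j u ∈ genericBall d :=
  mem_genericBall_of_psi (Equiv.swap i j) rfl hu

lemma swapNeg_mem_genericBall {u : Fin d → ℝ} (hu : u ∈ genericBall d) (i j : Fin d) :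
    swapNeg i j u ∈ genericBall d :=
  mem_genericBall_of_psi (Equiv.swap i j) (psi_swapNeg i j u) hu

/-- The Dunkl operator `D_j` of `P ∘ ψ` is `u_j` times this function of `ψ(u)`. -/
noncomputable def dunklQuot (κ : ℝ) (P : MvPolynomial (Fin d) ℝ) (j : Fin d) (x : Fin d → ℝ) : ℝ :=
  2 * eval x (pderiv j P) +
    κ * ∑ l, (eval x P - eval x (rename (Equiv.swap j l) P)) / (x j - x l)

lemma eval_swapCoord (i j : Fin d) (P : MvPolynomial (Fin d) ℝ) (x : Fin d → ℝ) :
    eval (swapCoord i j x) P = eval x (rename (Equiv.swap i j) P) :=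
  (eval_rename_perm _ _ _).symm

lemma dunklOp_signChangeRoot_eval (mult : Fin d → ℝ) (P : MvPolynomial (Fin d) ℝ) (j : Fin d)
    (u : Fin d → ℝ) :
    dunklOp signChangeRoot mult j (fun v => eval (psi v) P) u =
      u j * dunklQuot 0 P j (psi u) := by
  rw [dunklOp_signChangeRoot, partialD_eval_psi, psi_flipSign, dunklQuot]
  simp
  ring

/-- Both reflections in e_j ± e_l induce the same swap of the squares, and 1/(u_j - u_l) + 1/(u_j +
u_l) = 2u_j/(u_j² - u_l²) produces the factor u_j. The sign change fixes ψ(u), so κ' drops out. -/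
lemma dunklOp_hyperoctahedralRoot_eval (κ' κ : ℝ) (P : MvPolynomial (Fin d) ℝ) (j : Fin d)
    {u : Fin d → ℝ} (hu : u ∈ genericBall d) :
    dunklOp hyperoctahedralRoot (hyperoctahedralMult κ' κ) j (fun v => eval (psi v) P) u =
      u j * dunklQuot κ P j (psi u) := by
  rw [dunklOp_hyperoctahedralRoot, partialD_eval_psi, psi_flipSign, dunklQuot, sub_self, zero_div,
    mul_zero, add_zero, mul_add]
  congr 1
  · ring
  rw [Finset.mul_sum, Finset.mul_sum, Finset.mul_sum]
  refine Finset.sum_congr rfl fun l _ => ?_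
  rcases eq_or_ne l j with rfl | h
  · simp
  have h1 := hu.2 l j h
  have h2 : u j - u l ≠ 0 := fun h0 => h1 (by rw [sub_eq_zero.1 h0])
  have h3 : u j + u l ≠ 0 := fun h0 => h1 (by rw [eq_neg_of_add_eq_zero_left h0]; ring)
  have h4 : psi u j - psi u l ≠ 0 := by
    rw [show psi u j - psi u l = (u j - u l) * (u j + u l) by simp only [psi]; ring]
    exact mul_ne_zero h2 h3
  rw [if_neg h, psi_swapCoord, psi_swapNeg, eval_swapCoord]
  have h5 : psi u j - psi u l = (u j - u l) * (u j + u l) := by simp only [psi]; ring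
  rw [h5]
  field_simp
  ring

lemma dunklOp_signChangeRoot_mul (mult : Fin d → ℝ) (j : Fin d) (q : (Fin d → ℝ) → ℝ)
    {u : Fin d → ℝ} (hu : u ∈ genericBall d) :
    dunklOp signChangeRoot mult j (fun v => v j * q (psi v)) u =
      partialD j (fun v => v j * q (psi v)) u + 2 * mult j * q (psi u) := by
  rw [dunklOp_signChangeRoot, psi_flipSign]
  have := hu.1 j
  simp [flipSign]
  field_simp
  ring

/-- The second application of D_j meets a function odd in u_j, whence the term 2κ'q. With α = u_j, β
= u_l and q' the swapped value, (αq - βq')/(α - β) + (αq + βq')/(α + β) = 2(α²q - β²q')/(α² - β²).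
The formula for G is needed only off the hyperplanes, which is where a first application of D_j is
known. -/
lemma dunklOp_hyperoctahedralRoot_mul (κ' κ : ℝ) (j : Fin d) (q G : (Fin d → ℝ) → ℝ)
    (hG : ∀ v ∈ genericBall d, G v = v j * q (psi v)) {u : Fin d → ℝ} (hu : u ∈ genericBall d) :
    dunklOp hyperoctahedralRoot (hyperoctahedralMult κ' κ) j G u =
      partialD j (fun v => v j * q (psi v)) u + 2 * κ' * q (psi u) +
        κ * ∑ l, (psi u j * q (psi u) - psi u l * q (swapCoord j l (psi u))) /
          (psi u j - psi u l) := by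
  rw [dunklOp_hyperoctahedralRoot]
  have hp : partialD j G u = partialD j (fun v => v j * q (psi v)) u :=
    Filter.EventuallyEq.lineDeriv_eq
      (Filter.eventuallyEq_of_mem (isOpen_genericBall.mem_nhds hu) fun v hv => hG v hv)
  have huj := hu.1 j
  rw [hp, hG u hu, hG _ (flipSign_mem_genericBall hu j), psi_flipSign]
  congr 1
  · congr 1
    simp [flipSign]
    field_simp
    ring
  rw [Finset.mul_sum, Finset.mul_sum]
  refine Finset.sum_congr rfl fun l _ => ?_
  rcases eq_or_ne l j with rfl | h
  · simp
  have h1 := hu.2 l j h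
  have h2 : u j - u l ≠ 0 := fun h0 => h1 (by rw [sub_eq_zero.1 h0])
  have h3 : u j + u l ≠ 0 := fun h0 => h1 (by rw [eq_neg_of_add_eq_zero_left h0]; ring)
  have h5 : psi u j - psi u l = (u j - u l) * (u j + u l) := by simp only [psi]; ring
  rw [if_neg h, hG _ (swapCoord_mem_genericBall hu j l), hG _ (swapNeg_mem_genericBall hu j l),
    psi_swapCoord, psi_swapNeg, h5]
  have h6 : swapCoord j l u j = u l := by simp [swapCoord]
  have h7 : swapNeg j l u j = - u l := by simp [swapNeg]
  rw [h6, h7]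
  simp only [psi]
  field_simp
  ring

lemma partialD_mul_dunklQuot (κ : ℝ) (P : MvPolynomial (Fin d) ℝ) (j : Fin d)
    {u : Fin d → ℝ} (hu : u ∈ genericBall d) :
    partialD j (fun v => v j * dunklQuot κ P j (psi v)) u =
      dunklQuot κ P j (psi u) + 4 * psi u j * eval (psi u) (pderiv j (pderiv j P)) +
        2 * κ * ∑ l, psi u j *
          ((eval (psi u) (pderiv j P) - eval (psi u) (rename (Equiv.swap j l) (pderiv l P))) /
              (psi u j - psi u l) -
            (eval (psi u) P - eval (psi u) (rename (Equiv.swap j l) P)) /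
              (psi u j - psi u l) ^ 2) := by
  have hX : ∀ l, HasDerivAt (fun t : ℝ => psi (u + t • Pi.single j 1) l)
      (2 * u j * eval (psi u) (pderiv j (X l))) 0 := fun l => by
    simpa using hasDerivAt_eval_psi (X l) u j
  have hl : ∀ l ∈ Finset.univ, HasDerivAt (fun t : ℝ => (eval (psi (u + t • Pi.single j 1)) P -
        eval (psi (u + t • Pi.single j 1)) (rename (Equiv.swap j l) P)) /
          (psi (u + t • Pi.single j 1) j - psi (u + t • Pi.single j 1) l))
      (2 * u j * ((eval (psi u) (pderiv j P) -
            eval (psi u) (rename (Equiv.swap j l) (pderiv l P))) / (psi u j - psi u l) -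
          (eval (psi u) P - eval (psi u) (rename (Equiv.swap j l) P)) /
            (psi u j - psi u l) ^ 2)) 0 := by
    intro l _
    rcases eq_or_ne l j with rfl | h
    · simpa using hasDerivAt_const (0 : ℝ) (0 : ℝ)
    have hne : psi u j - psi u l ≠ 0 := sub_ne_zero.2 (hu.2 j l h.symm)
    have hr := hasDerivAt_eval_psi (rename (Equiv.swap j l) P) u j
    -- Differentiating a swapped polynomial in X_j means differentiating the original in X_l.
    have hr' : pderiv j (rename (Equiv.swap j l) P) =
        rename (Equiv.swap j l) (pderiv l P) := by
      have := pderiv_rename (R := ℝ) (Equiv.swap j l).injective l P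
      simpa using this
    rw [hr'] at hr
    have hden := (hX j).sub (hX l)
    have := (((hasDerivAt_eval_psi P u j).fun_sub hr).fun_div hden (by simpa using hne))
    refine this.congr_deriv ?_
    rw [pderiv_X_self, pderiv_X_of_ne h]
    simp only [Pi.sub_apply, zero_smul, add_zero, map_one, map_zero, mul_one, mul_zero, sub_zero]
    field_simp
  have hs := ((hasDerivAt_eval_psi (pderiv j P) u j).const_mul 2).fun_add
    ((HasDerivAt.fun_sum hl).const_mul κ)
  have hj : HasDerivAt (fun t : ℝ => (u + t • Pi.single j 1 : Fin d → ℝ) j) 1 0 := by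
    simpa using (hasDerivAt_id (0 : ℝ)).const_add (u j)
  have := (hj.fun_mul hs).deriv
  refine Eq.trans this ?_
  simp only [zero_smul, add_zero, ← Finset.mul_sum]
  rw [dunklQuot]
  simp only [psi]
  ring

end Dunkl

/-! ### The differential-difference operator agrees with the polynomial operator. -/

section Laplacian

open MvPolynomial

variable {d : ℕ}

/-- The points of `ℝ^d` with pairwise distinct coordinates. -/
def distinctPts (d : ℕ) : Set (Fin d → ℝ) := {x | ∀ i j, i ≠ j → x i ≠ x j}

/-- Two transpositions sharing one index compose to a 3-cycle, and the same 3-cycle has several such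
factorizations. -/
lemma swapCoord_swapCoord_rotate (x : Fin d → ℝ) {j l m : Fin d} (hjl : j ≠ l) (hjm : j ≠ m)
    (hlm : l ≠ m) : swapCoord j m (swapCoord j l x) = swapCoord l j (swapCoord l m x) := by
  funext n
  simp only [swapCoord, Equiv.swap_apply_def]
  grind

/-- The letters stand for the values of a function at the six permutations of three coordinates: `P`
for the identity, `sab`, `sac`, `sbc` for the transpositions, `A`, `B` for the 3-cycles. The
coefficient of each value vanishes separately. -/
lemma lagrange_symmetrized {a b c P sab sac sbc A B : ℝ} (hab : a - b ≠ 0) (hac : a - c ≠ 0)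
    (hbc : b - c ≠ 0) :
    (a * ((P - sac) / (a - c)) - b * ((sab - A) / (b - c))) / (a - b) +
    (a * ((P - sab) / (a - b)) - c * ((sac - B) / (c - b))) / (a - c) +
    (b * ((P - sbc) / (b - c)) - a * ((sab - B) / (a - c))) / (b - a) +
    (b * ((P - sab) / (b - a)) - c * ((sbc - A) / (c - a))) / (b - c) +
    (c * ((P - sbc) / (c - b)) - a * ((sac - A) / (a - b))) / (c - a) +
    (c * ((P - sac) / (c - a)) - b * ((sbc - B) / (b - a))) / (c - b) = 0 := by
  have hba : b - a = -(a - b) := by ring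
  have hca : c - a = -(a - c) := by ring
  have hcb : c - b = -(b - c) := by ring
  rw [hba, hca, hcb]
  simp only [div_neg]
  field_simp
  ring

/-- This is the κ² part of the sum of the D_j². It cancels for the same reason that Dunkl Laplacians
contain no products of two distinct reflections: symmetrize over the order of j, l, m. -/
lemma sum_dunklQuot_swap_eq_zero (P : MvPolynomial (Fin d) ℝ) {x : Fin d → ℝ}
    (hx : x ∈ distinctPts d) :
    ∑ j, ∑ l, ∑ m, (x j * ((eval x P - eval (swapCoord j m x) P) / (x j - x m)) -
      x l * ((eval (swapCoord j l x) P - eval (swapCoord j m (swapCoord j l x)) P) /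
        (swapCoord j l x j - swapCoord j l x m))) / (x j - x l) = 0 := by
  set t : Fin d → Fin d → Fin d → ℝ := fun j l m =>
    (x j * ((eval x P - eval (swapCoord j m x) P) / (x j - x m)) -
      x l * ((eval (swapCoord j l x) P - eval (swapCoord j m (swapCoord j l x)) P) /
        (swapCoord j l x j - swapCoord j l x m))) / (x j - x l) with ht
  set r : Fin d → Fin d → ℝ := fun j l => (eval x P - eval (swapCoord j l x) P) / (x j - x l)
    with hr
  have hself : ∀ (i : Fin d) (y : Fin d → ℝ), swapCoord i i y = y := fun i y => by
    funext m; simp [swapCoord]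
  have hinv : ∀ (i k : Fin d) (y : Fin d → ℝ), swapCoord i k (swapCoord i k y) = y :=
    fun i k y => by funext m; simp [swapCoord]
  -- The terms with m = l ≠ j equal `r j l` and are removed first; `r` is antisymmetric, so its sum
  -- vanishes by itself. The other coincidences of indices give 0 through division by zero.
  have h1 : ∑ j, ∑ l, ∑ m, (t j l m - if m = l then r j l else 0) = 0 := by
    apply sum_sum_sum_eq_zero_of_symmetrized
    have hdeg : ∀ j l m, (j = l ∨ j = m ∨ l = m) →
        t j l m - (if m = l then r j l else 0) = 0 := by
      intro j l m h
      rcases eq_or_ne j l with rfl | hjl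
      · simp [ht, hr]
      have hne : x j - x l ≠ 0 := sub_ne_zero.2 (hx _ _ hjl)
      rcases h with h | rfl | rfl
      · exact absurd h hjl
      · simp [ht, hself, hjl]
      · have h6 : swapCoord j l x j = x l := by simp [swapCoord]
        have h7 : swapCoord j l x l = x j := by simp [swapCoord]
        simp only [ht, hr, hinv, h6, h7, if_true]
        have hne' : x l - x j ≠ 0 := by rw [← neg_sub]; exact neg_ne_zero.2 hne
        rw [show x l - x j = -(x j - x l) by ring]
        field_simp
        ring
    intro j l m
    by_cases h : j = l ∨ j = m ∨ l = m
    · rw [hdeg j l m h, hdeg j m l (by tauto), hdeg l j m (by grind), hdeg l m j (by grind),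
        hdeg m j l (by grind), hdeg m l j (by grind)]
      simp
    push Not at h
    obtain ⟨hjl, hjm, hlm⟩ := h
    have hA : ∀ {a b c : Fin d}, a ≠ b → a ≠ c → b ≠ c → swapCoord a b x a - swapCoord a b x c =
        x b - x c := fun {a b c} h1 h2 h3 => by
      simp [swapCoord, Equiv.swap_apply_of_ne_of_ne h2.symm h3.symm]
    have eA1 := swapCoord_swapCoord_rotate x hjl hjm hlm
    have eA2 := swapCoord_swapCoord_rotate x hlm hjl.symm hjm.symm
    have eB1 := swapCoord_swapCoord_rotate x hjm hjl hlm.symm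
    have eB2 := swapCoord_swapCoord_rotate x hlm.symm hjm.symm hjl.symm
    simp only [ht, hjl, hjm, hlm, hjl.symm, hjm.symm, hlm.symm, if_false, sub_zero,
      hA hjl hjm hlm, hA hjm hjl hlm.symm, hA hjl.symm hlm hjm, hA hlm hjl.symm hjm.symm,
      hA hjm.symm hlm.symm hjl, hA hlm.symm hjm.symm hjl.symm]
    rw [← eA2, ← eA1, ← eB2, ← eB1, swapCoord_comm l j x, swapCoord_comm m j x,
      swapCoord_comm m l x]
    exact lagrange_symmetrized (sub_ne_zero.2 (hx _ _ hjl)) (sub_ne_zero.2 (hx _ _ hjm))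
      (sub_ne_zero.2 (hx _ _ hlm))
  simp only [Finset.sum_sub_distrib, Finset.sum_ite_eq', Finset.mem_univ, if_true] at h1
  have h2 : ∑ j, ∑ l, r j l = 0 := by
    apply sum_sum_eq_zero_of_antisymm
    intro j l
    simp only [hr]
    rw [swapCoord_comm l j, ← neg_sub (x j) (x l), div_neg, neg_neg]
  rw [h2, sub_zero] at h1
  exact h1

/-- The κ² terms cancel by `sum_dunklQuot_swap_eq_zero`, the bare difference quotients cancel by
antisymmetry in j and l, and the remaining terms linear in κ combine, pair by pair, into four times
`pairTerm`. -/
lemma sum_dunklQuot (κ' κ : ℝ) (P : MvPolynomial (Fin d) ℝ) {x : Fin d → ℝ}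
    (hx : x ∈ distinctPts d) :
    ∑ j, (dunklQuot κ P j x + 4 * x j * eval x (pderiv j (pderiv j P)) +
        2 * κ * ∑ l, x j *
          ((eval x (pderiv j P) - eval x (rename (Equiv.swap j l) (pderiv l P))) / (x j - x l) -
            (eval x P - eval x (rename (Equiv.swap j l) P)) / (x j - x l) ^ 2) +
        2 * κ' * dunklQuot κ P j x +
        κ * ∑ l, (x j * dunklQuot κ P j x - x l * dunklQuot κ P j (swapCoord j l x)) /
          (x j - x l)) =
      4 * (∑ j, (x j * eval x (pderiv j (pderiv j P)) + (κ' + 1 / 2) * eval x (pderiv j P)) +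
        κ * ∑ p, eval x (pairTerm p P)) := by
  have hZ := sum_dunklQuot_swap_eq_zero P hx
  have hA : ∑ j, ∑ l, (eval x P - eval (swapCoord j l x) P) / (x j - x l) = 0 := by
    apply sum_sum_eq_zero_of_antisymm
    intro j l
    rw [swapCoord_comm l j, ← neg_sub (x j) (x l), div_neg, neg_neg]
  have hpair : ∑ p : OrderedPair d, eval x (pairTerm p P) * 4 = ∑ j, ∑ l,
      ((4 * x j * eval x (pderiv j P) - 2 * x j * eval (swapCoord j l x) (pderiv l P)
        - 2 * x l * eval (swapCoord j l x) (pderiv j P)) / (x j - x l) -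
      2 * x j * (eval x P - eval (swapCoord j l x) P) / (x j - x l) ^ 2) := by
    rw [← sum_orderedPair_add_swap _ (fun i => by simp)]
    refine Finset.sum_congr rfl fun p _ => ?_
    have hne : x p.1.1 - x p.1.2 ≠ 0 := sub_ne_zero.2 (hx _ _ (ne_of_lt p.2))
    have h1 := congrArg (eval x) (sq_mul_pairTerm p P)
    rw [pairNum_apply] at h1
    simp only [map_mul, map_sub, map_add, map_pow, eval_X, eval_C, ← eval_swapCoord] at h1
    have h2 : eval x (pairTerm p P) = ((x p.1.1 * eval x (pderiv p.1.1 P) -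
        x p.1.2 * eval x (pderiv p.1.2 P)) * (x p.1.1 - x p.1.2) -
        1 / 2 * (x p.1.1 + x p.1.2) * (eval x P - eval (swapCoord p.1.1 p.1.2 x) P)) /
          (x p.1.1 - x p.1.2) ^ 2 := by
      rw [eq_div_iff (pow_ne_zero 2 hne), ← h1]; ring
    rw [h2, swapCoord_comm p.1.2 p.1.1, ← neg_sub (x p.1.1) (x p.1.2), div_neg, neg_sq]
    field_simp
    ring
  have hquot : ∀ j y, dunklQuot κ P j y = 2 * eval y (pderiv j P) +
      κ * ∑ m, (eval y P - eval (swapCoord j m y) P) / (y j - y m) := by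
    intro j y
    simp only [dunklQuot, eval_swapCoord]
  have hsum : ∀ j, ∑ l, (x j * dunklQuot κ P j x - x l * dunklQuot κ P j (swapCoord j l x)) /
      (x j - x l) = ∑ l, (2 * x j * eval x (pderiv j P) -
        2 * x l * eval (swapCoord j l x) (pderiv j P)) / (x j - x l) +
      κ * ∑ l, ∑ m, (x j * ((eval x P - eval (swapCoord j m x) P) / (x j - x m)) -
        x l * ((eval (swapCoord j l x) P - eval (swapCoord j m (swapCoord j l x)) P) /
        (swapCoord j l x j - swapCoord j l x m))) / (x j - x l) := by
    intro j
    rw [Finset.mul_sum, ← Finset.sum_add_distrib]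
    refine Finset.sum_congr rfl fun l _ => ?_
    rw [hquot, hquot, ← Finset.sum_div, Finset.sum_sub_distrib, ← Finset.mul_sum,
      ← Finset.mul_sum]
    ring
  simp only [hsum]
  simp only [hquot, ← eval_swapCoord]
  simp only [mul_add, Finset.sum_add_distrib, ← Finset.mul_sum, hZ]
  have h4 : 4 * (κ * ∑ p : OrderedPair d, eval x (pairTerm p P)) =
      κ * ∑ p : OrderedPair d, eval x (pairTerm p P) * 4 := by
    rw [← Finset.sum_mul]; ring
  rw [h4, hpair]
  have hA' : ∑ j, κ * ∑ l, (eval x P - eval (swapCoord j l x) P) / (x j - x l) = 0 := by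
    rw [← Finset.mul_sum, hA, mul_zero]
  have h5 : ∑ j, ∑ l,
      ((4 * x j * eval x (pderiv j P) - 2 * x j * eval (swapCoord j l x) (pderiv l P)
        - 2 * x l * eval (swapCoord j l x) (pderiv j P)) / (x j - x l) -
      2 * x j * (eval x P - eval (swapCoord j l x) P) / (x j - x l) ^ 2) =
      2 * (∑ j, x j * ∑ l, ((eval x (pderiv j P) - eval (swapCoord j l x) (pderiv l P)) /
        (x j - x l) - (eval x P - eval (swapCoord j l x) P) / (x j - x l) ^ 2)) +
      ∑ j, ∑ l, (2 * x j * eval x (pderiv j P) -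
        2 * x l * eval (swapCoord j l x) (pderiv j P)) / (x j - x l) := by
    rw [Finset.mul_sum, ← Finset.sum_add_distrib]
    refine Finset.sum_congr rfl fun j _ => ?_
    rw [Finset.mul_sum, Finset.mul_sum, ← Finset.sum_add_distrib]
    refine Finset.sum_congr rfl fun l _ => ?_
    ring
  rw [h5]
  simp only [mul_add, ← Finset.mul_sum, hA, mul_assoc]
  ring

lemma psi_mem_distinctPts {u : Fin d → ℝ} (hu : u ∈ genericBall d) : psi u ∈ distinctPts d :=
  fun i j hij => hu.2 i j hij

lemma dunklLaplacian_hyperoctahedralRoot (κ' κ : ℝ) (P : MvPolynomial (Fin d) ℝ)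
    {u : Fin d → ℝ} (hu : u ∈ genericBall d) :
    dunklLaplacian hyperoctahedralRoot (hyperoctahedralMult κ' κ) (fun v => eval (psi v) P) u =
      4 * (∑ j, (psi u j * eval (psi u) (pderiv j (pderiv j P)) +
        (κ' + 1 / 2) * eval (psi u) (pderiv j P)) + κ * ∑ p, eval (psi u) (pairTerm p P)) := by
  rw [dunklLaplacian, ← sum_dunklQuot κ' κ P (psi_mem_distinctPts hu)]
  refine Finset.sum_congr rfl fun j _ => ?_
  rw [dunklOp_hyperoctahedralRoot_mul κ' κ j (dunklQuot κ P j) _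
    (fun v hv => dunklOp_hyperoctahedralRoot_eval κ' κ P j hv) hu, partialD_mul_dunklQuot κ P j hu]

lemma dunklLaplacian_signChangeRoot (mult : Fin d → ℝ) (P : MvPolynomial (Fin d) ℝ)
    {u : Fin d → ℝ} (hu : u ∈ genericBall d) :
    dunklLaplacian signChangeRoot mult (fun v => eval (psi v) P) u =
      4 * ∑ j, (psi u j * eval (psi u) (pderiv j (pderiv j P)) +
        (mult j + 1 / 2) * eval (psi u) (pderiv j P)) := by
  rw [dunklLaplacian, Finset.mul_sum]
  refine Finset.sum_congr rfl fun j _ => ?_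
  have h : dunklOp signChangeRoot mult j (fun v => eval (psi v) P) =
      fun v => v j * dunklQuot 0 P j (psi v) :=
    funext fun v => dunklOp_signChangeRoot_eval mult P j v
  rw [h, dunklOp_signChangeRoot_mul mult j _ hu, partialD_mul_dunklQuot 0 P j hu, dunklQuot]
  ring

/-- The exponents `a` of the weight, shifted by one: the barycentric coordinate `k` enters with
the power `a k - 1`. -/
noncomputable def SimplexWeight.expo : SimplexWeight d → Option (Fin d) → ℝ
  | .signChange κ => fun k => k.elim ((κ (Fin.last d) : ℝ) + 1 / 2)
      fun i => (κ i.castSucc : ℝ) + 1 / 2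
  | .hyperoctahedral κ' _ μ => fun k => k.elim ((μ : ℝ) + 1 / 2) fun _ => (κ' : ℝ) + 1 / 2

/-- The exponent of the factors `|x_i - x_j|`. -/
def SimplexWeight.pairExpo : SimplexWeight d → ℝ
  | .signChange _ => 0
  | .hyperoctahedral _ κ _ => κ

lemma SimplexWeight.laplacian_eval (w : SimplexWeight d) (P : MvPolynomial (Fin d) ℝ)
    {x : Fin d → ℝ} (hx : ∀ i, 0 < x i) (hx' : x ∈ distinctPts d) :
    w.laplacian (fun z => eval z P) x = eval x (lapPoly w.expo w.pairExpo P) := by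
  have hψ : psi (psiInv x) = x := psi_psiInv fun i => (hx i).le
  have hu : psiInv x ∈ genericBall d := by
    refine ⟨fun i => (Real.sqrt_pos.2 (hx i)).ne', fun i j hij => ?_⟩
    have h := hx' i j hij
    simp only [psiInv, Real.sq_sqrt (hx _).le]
    exact h
  have hE : ∀ P : MvPolynomial (Fin d) ℝ, eulerOp (fun v : Fin d → ℝ => eval (psi v) P) =
      fun v => 2 * eval (psi v) (eulerPoly d P) := fun P => by
    simpa using eulerOp_eval_psi P 1
  have hEE : eulerOp (fun v : Fin d → ℝ => 2 * eval (psi v) (eulerPoly d P)) =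
      fun v => 4 * eval (psi v) (eulerPoly d (eulerPoly d P)) := by
    rw [eulerOp_eval_psi]; norm_num
  have hcomp : (fun z : Fin d → ℝ => eval z P) ∘ psi = fun v => eval (psi v) P := rfl
  rw [lapPoly_apply]
  cases w with
  | signChange κ =>
    have hlam : (∑ i : Fin d, (κ i.castSucc : ℝ)) + κ (Fin.last d) + ((d : ℝ) - 1) / 2 =
        lamParam (SimplexWeight.signChange κ).expo (SimplexWeight.signChange κ).pairExpo := by
      simp only [lamParam, SimplexWeight.expo, SimplexWeight.pairExpo, Fintype.sum_option,
        Option.elim, Finset.sum_add_distrib, Finset.sum_const, Finset.card_univ, Fintype.card_fin]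
      simp only [nsmul_eq_mul]
      ring
    simp only [SimplexWeight.laplacian, SimplexWeight.ballOp, ballLaplacian, hcomp, hE, hEE,
      dunklLaplacian_signChangeRoot _ P hu, hψ, hlam]
    simp only [map_sub, map_add, map_sum, map_mul, eval_X, smul_eval, SimplexWeight.expo,
      Option.elim, SimplexWeight.pairExpo]
    ring
  | hyperoctahedral κ' κ μ =>
    -- The d + 1 exponents are each shifted by 1/2, which with the -1 in `lamParam` gives (d - 1)/2.
    -- The two roots e_i ± e_j of multiplicity κ/2 give κ for each pair.
    have hlam : (∑ i, hyperoctahedralMult (d := d) κ' κ i) + μ + ((d : ℝ) - 1) / 2 =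
        lamParam (SimplexWeight.hyperoctahedral (d := d) κ' κ μ).expo
          (SimplexWeight.hyperoctahedral (d := d) κ' κ μ).pairExpo := by
      simp only [lamParam, SimplexWeight.expo, SimplexWeight.pairExpo, Fintype.sum_option,
        Option.elim, Finset.sum_add_distrib, Finset.sum_const, Finset.card_univ, Fintype.card_fin,
        Fintype.sum_sum_type, hyperoctahedralMult, Fintype.card_sum]
      simp only [nsmul_eq_mul]
      push_cast
      ring
    simp only [SimplexWeight.laplacian, SimplexWeight.ballOp, ballLaplacian, hcomp, hE, hEE,
      dunklLaplacian_hyperoctahedralRoot _ _ P hu, hψ, hlam]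
    simp only [map_sub, map_add, map_sum, map_mul, eval_X, smul_eval, SimplexWeight.expo,
      Option.elim, SimplexWeight.pairExpo]
    ring

end Laplacian

/-! ### Barycentric coordinates and integrability of the Dirichlet density. -/

section Simplex

open Set Filter Topology

variable {d : ℕ}

/-- The barycentric coordinates on the simplex. -/
def bary (k : Option (Fin d)) (x : Fin d → ℝ) : ℝ := k.elim (1 - ∑ i, x i) fun i => x i

/-- The interior of the simplex. -/
def openSimplex (d : ℕ) : Set (Fin d → ℝ) := {x | ∀ k, 0 < bary k x}

@[simp] lemma bary_none (x : Fin d → ℝ) : bary none x = 1 - ∑ i, x i := rfl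

@[simp] lemma bary_some (i : Fin d) (x : Fin d → ℝ) : bary (some i) x = x i := rfl

@[fun_prop] lemma continuous_bary (k : Option (Fin d)) : Continuous (bary k) := by
  cases k with
  | none => exact continuous_const.sub (continuous_finsetSum _ fun i _ => continuous_apply i)
  | some i => exact continuous_apply i

@[fun_prop] lemma measurable_bary (k : Option (Fin d)) : Measurable (bary k) :=
  (continuous_bary k).measurable

lemma sum_bary (x : Fin d → ℝ) : ∑ k, bary k x = 1 := by
  simp [Fintype.sum_option]

lemma mem_simplexT_iff {x : Fin d → ℝ} : x ∈ simplexT d ↔ ∀ k, 0 ≤ bary k x := by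
  rw [Option.forall]
  simp only [simplexT, mem_ofPred_eq, bary_none, bary_some]
  constructor
  · rintro ⟨h1, h2⟩
    refine ⟨?_, h1⟩
    rwa [Finset.sum_congr rfl fun i _ => abs_of_nonneg (h1 i)] at h2
  · rintro ⟨h1, h2⟩
    refine ⟨h2, ?_⟩
    rwa [Finset.sum_congr rfl fun i _ => abs_of_nonneg (h2 i)]

lemma openSimplex_subset : openSimplex d ⊆ simplexT d := fun _ hx =>
  mem_simplexT_iff.2 fun k => (hx k).le

lemma isOpen_openSimplex : IsOpen (openSimplex d) := by
  have : openSimplex d = ⋂ k, {x | 0 < bary k x} := by ext; simp [openSimplex]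
  rw [this]
  exact isOpen_iInter_of_finite fun k => isOpen_lt continuous_const (continuous_bary k)

lemma measurableSet_openSimplex : MeasurableSet (openSimplex d) :=
  isOpen_openSimplex.measurableSet

lemma bary_le_one {x : Fin d → ℝ} (hx : x ∈ simplexT d) (k : Option (Fin d)) : bary k x ≤ 1 := by
  rw [← sum_bary x]
  exact Finset.single_le_sum (fun m _ => mem_simplexT_iff.1 hx m) (Finset.mem_univ k)

lemma bary_nonneg {x : Fin d → ℝ} (hx : x ∈ simplexT d) (k : Option (Fin d)) : 0 ≤ bary k x :=
  mem_simplexT_iff.1 hx k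

lemma isClosed_simplexT : IsClosed (simplexT d) := by
  have : simplexT d = ⋂ k, {x | 0 ≤ bary k x} := by
    ext x; simp only [mem_simplexT_iff, mem_iInter, mem_ofPred_eq]
  rw [this]
  exact isClosed_iInter fun k => isClosed_le continuous_const (continuous_bary k)

lemma isCompact_simplexT : IsCompact (simplexT d) := by
  refine Metric.isCompact_of_isClosed_isBounded isClosed_simplexT ?_
  refine (Metric.isBounded_Icc (0 : Fin d → ℝ) 1).subset fun x hx => ⟨fun i => ?_, fun i => ?_⟩
  · exact bary_nonneg hx (some i)
  · exact bary_le_one hx (some i)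

lemma bary_convexComb (k : Option (Fin d)) (x y : Fin d → ℝ) {s t : ℝ} (hst : s + t = 1) :
    bary k (s • x + t • y) = s * bary k x + t * bary k y := by
  cases k with
  | none =>
    simp only [bary_none, Pi.add_apply, Pi.smul_apply, smul_eq_mul, Finset.sum_add_distrib,
      ← Finset.mul_sum]
    linear_combination -hst
  | some i => simp

lemma convex_simplexT : Convex ℝ (simplexT d) := by
  intro x hx y hy s t hs ht hst
  rw [mem_simplexT_iff] at *
  intro k
  rw [bary_convexComb k x y hst]
  exact add_nonneg (mul_nonneg hs (hx k)) (mul_nonneg ht (hy k))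

lemma openSimplex_nonempty : (openSimplex d).Nonempty := by
  refine ⟨fun _ => 1 / (d + 1 : ℝ), fun k => ?_⟩
  have : (0 : ℝ) < d + 1 := by positivity
  cases k with
  | none =>
    simp only [bary_none, Finset.sum_const, Finset.card_univ, Fintype.card_fin, nsmul_eq_mul]
    rw [mul_one_div, sub_pos, div_lt_one this]
    linarith
  | some i => simp only [bary_some]; positivity

lemma volume_setOf_linear_eq {f : (Fin d → ℝ) →ₗ[ℝ] ℝ} (hf : f ≠ 0) (c : ℝ) :
    volume {x | f x = c} = 0 := by
  by_cases h : ∃ x₀, f x₀ = c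
  · obtain ⟨x₀, h₀⟩ := h
    have h1 : {x | f x = c} = (fun x => x + (-x₀)) ⁻¹' (LinearMap.ker f : Set (Fin d → ℝ)) := by
      ext x
      simp [h₀, sub_eq_zero, ← sub_eq_add_neg]
    rw [h1, measure_preimage_add_right]
    refine Measure.addHaar_submodule _ _ fun h2 => hf ?_
    exact LinearMap.ker_eq_top.1 h2
  · have : {x | f x = c} = ∅ := by
      ext x
      simp only [mem_ofPred_eq, mem_empty_iff_false, iff_false]
      exact fun hx => h ⟨x, hx⟩
    rw [this, measure_empty]

lemma ae_mem_distinctPts : ∀ᵐ x : Fin d → ℝ, x ∈ distinctPts d := by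
  have : ∀ i j : Fin d, i ≠ j → ∀ᵐ x : Fin d → ℝ, x i ≠ x j := by
    intro i j hij
    have hf : (LinearMap.proj (R := ℝ) (φ := fun _ : Fin d => ℝ) i - LinearMap.proj j) ≠ 0 := fun h => by
      have h1 : (Pi.single i 1 : Fin d → ℝ) i - (Pi.single i 1 : Fin d → ℝ) j = 0 :=
        LinearMap.congr_fun h (Pi.single i 1)
      simp [hij.symm] at h1
    have h0 := volume_setOf_linear_eq hf 0
    rw [ae_iff]
    simpa [sub_eq_zero] using h0
  simpa only [distinctPts, mem_ofPred_eq, ae_all_iff, eventually_imp_distrib_left] using this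

lemma ae_bary_ne_zero (k : Option (Fin d)) : ∀ᵐ x : Fin d → ℝ, bary k x ≠ 0 := by
  rw [ae_iff]
  cases k with
  | none =>
    by_cases hd : Nonempty (Fin d)
    · obtain ⟨i⟩ := hd
      have hf : (∑ i, LinearMap.proj (R := ℝ) (φ := fun _ : Fin d => ℝ) i) ≠ 0 := fun h => by
        simpa [LinearMap.sum_apply] using LinearMap.congr_fun h (Pi.single i 1)
      convert volume_setOf_linear_eq hf 1 using 2
      ext x
      simp only [bary_none, ne_eq, Decidable.not_not, mem_ofPred_eq, LinearMap.sum_apply,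
        LinearMap.proj_apply]
      constructor <;> intro h <;> linarith
    · have : IsEmpty (Fin d) := not_nonempty_iff.1 hd
      simp
  | some i =>
    have hf : (LinearMap.proj i : (Fin d → ℝ) →ₗ[ℝ] ℝ) ≠ 0 := fun h => by
      simpa using LinearMap.congr_fun h (Pi.single i 1)
    simpa using volume_setOf_linear_eq hf 0

lemma simplexT_ae_eq : (simplexT d : Set (Fin d → ℝ)) =ᵐ[volume] openSimplex d := by
  have h : ∀ᵐ x : Fin d → ℝ, ∀ k, bary k x ≠ 0 := ae_all_iff.2 ae_bary_ne_zero
  filter_upwards [h] with x hx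
  refine propext ⟨fun h k => ?_, fun h => openSimplex_subset h⟩
  exact lt_of_le_of_ne (bary_nonneg h k) (hx k).symm

lemma restrict_simplexT : (volume.restrict (simplexT d) : Measure (Fin d → ℝ)) =
    volume.restrict (openSimplex d) := Measure.restrict_congr_set simplexT_ae_eq

lemma measurePreserving_of_linear_involution (f : (Fin d → ℝ) →ₗ[ℝ] (Fin d → ℝ))
    (hf : ∀ x, f (f x) = x) : MeasurePreserving f volume volume := by
  have h1 : f.comp f = LinearMap.id := LinearMap.ext hf
  have h2 : LinearMap.det f * LinearMap.det f = 1 := by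
    rw [← LinearMap.det_comp, h1, LinearMap.det_id]
  have h3 : LinearMap.det f ≠ 0 := fun h => by simp [h] at h2
  refine ⟨f.continuous_of_finiteDimensional.measurable, ?_⟩
  rw [Real.map_linearMap_volume_pi_eq_smul_volume_pi h3]
  have h4 : |(LinearMap.det f)⁻¹| = 1 := by
    rw [abs_inv, inv_eq_one]
    rcases mul_self_eq_one_iff.1 h2 with h | h <;> simp [h]
  simp [h4]

lemma continuous_swapCoord (i j : Fin d) : Continuous (swapCoord i j) :=
  continuous_pi fun _ => continuous_apply _

lemma measurePreserving_swapCoord (i j : Fin d) :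
    MeasurePreserving (swapCoord i j) volume volume :=
  measurePreserving_of_linear_involution
    { toFun := swapCoord i j, map_add' := fun _ _ => rfl, map_smul' := fun _ _ => rfl }
    fun x => by
      funext m
      change swapCoord i j (swapCoord i j x) m = x m
      simp [swapCoord]

/-- The affine involution exchanging the barycentric coordinates `none` and `some i`. -/
def baryFlip (i : Fin d) (x : Fin d → ℝ) : Fin d → ℝ := Function.update x i (1 - ∑ j, x j)

lemma sum_update_eq (i : Fin d) (x : Fin d → ℝ) (c : ℝ) :
    ∑ j, Function.update x i c j = c + (∑ j, x j - x i) := by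
  have h := Finset.sum_sdiff (f := x) (Finset.subset_univ {i})
  rw [Finset.sum_singleton] at h
  rw [Finset.sum_update_of_mem (Finset.mem_univ i)]
  linarith

lemma bary_baryFlip (i : Fin d) (x : Fin d → ℝ) (k : Option (Fin d)) :
    bary k (baryFlip i x) = bary (Equiv.swap none (some i) k) x := by
  cases k with
  | none =>
    simp only [bary_none, baryFlip, sum_update_eq, Equiv.swap_apply_left, bary_some]
    ring
  | some j =>
    rcases eq_or_ne j i with rfl | h
    · simp [baryFlip]
    · rw [Equiv.swap_apply_of_ne_of_ne (by simp) (by simpa using h)]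
      simp [baryFlip, h]

lemma baryFlip_baryFlip (i : Fin d) (x : Fin d → ℝ) : baryFlip i (baryFlip i x) = x := by
  funext j
  have := bary_baryFlip i (baryFlip i x) (some j)
  rwa [bary_baryFlip i x, ← Equiv.Perm.mul_apply, Equiv.swap_mul_self] at this

lemma measurePreserving_baryFlip (i : Fin d) :
    MeasurePreserving (baryFlip i) (volume : Measure (Fin d → ℝ)) volume := by
  let f : (Fin d → ℝ) →ₗ[ℝ] (Fin d → ℝ) :=
    { toFun := fun x => Function.update x i (-∑ j, x j)
      map_add' := fun x y => by
        funext m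
        rcases eq_or_ne m i with rfl | h
        · simp [Finset.sum_add_distrib]; ring
        · simp [h]
      map_smul' := fun c x => by
        funext m
        rcases eq_or_ne m i with rfl | h
        · simp [Finset.mul_sum]
        · simp [h] }
  have hf : MeasurePreserving f volume volume := measurePreserving_of_linear_involution f fun x => by
    funext m
    simp only [f, LinearMap.coe_mk, AddHom.coe_mk, sum_update_eq]
    rcases eq_or_ne m i with rfl | h
    · simp
    · simp [h]
  have h := (measurePreserving_add_right (volume : Measure (Fin d → ℝ)) (Pi.single i 1)).comp hf
  convert h using 1
  funext x m
  rcases eq_or_ne m i with rfl | h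
  · simp [baryFlip, f]; ring
  · simp [baryFlip, f, h]

lemma measurableEmbedding_baryFlip (i : Fin d) : MeasurableEmbedding (baryFlip i) :=
  (MeasurableEquiv.ofInvolutive (baryFlip i) (baryFlip_baryFlip i)
    (measurePreserving_baryFlip i).measurable).measurableEmbedding

lemma measurableEmbedding_swapCoord (i j : Fin d) : MeasurableEmbedding (swapCoord i j) :=
  (MeasurableEquiv.ofInvolutive (swapCoord i j) (fun x => by funext m; simp [swapCoord])
    (measurePreserving_swapCoord i j).measurable).measurableEmbedding

/-- The Dirichlet density `∏ (bary k)^(a k - 1)`. -/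
noncomputable def dirichletDensity (a : Option (Fin d) → ℝ) (x : Fin d → ℝ) : ℝ :=
  ∏ k, bary k x ^ (a k - 1)

lemma measurable_dirichletDensity (a : Option (Fin d) → ℝ) : Measurable (dirichletDensity a) :=
  Finset.measurable_prod _ fun k _ => (measurable_bary k).pow_const _

lemma dirichletDensity_pos (a : Option (Fin d) → ℝ) {x : Fin d → ℝ} (hx : x ∈ openSimplex d) :
    0 < dirichletDensity a x := Finset.prod_pos fun k _ => Real.rpow_pos_of_pos (hx k) _

lemma dirichletDensity_baryFlip (a : Option (Fin d) → ℝ) (i : Fin d) (x : Fin d → ℝ) :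
    dirichletDensity a (baryFlip i x) =
      dirichletDensity (fun k => a (Equiv.swap none (some i) k)) x := by
  simp only [dirichletDensity, bary_baryFlip]
  exact Fintype.prod_equiv (Equiv.swap none (some i)) _ _ fun k => by simp

/-- Away from the face 1 - |x| = 0 the corresponding factor is bounded, and what remains is
dominated by a product of the one-variable integrable functions t^(a_i - 1) on (0, 1). -/
lemma integrableOn_dirichletDensity_aux {a : Option (Fin d) → ℝ} (ha : ∀ k, 0 < a k) {ε : ℝ}
    (hε : 0 < ε) :
    IntegrableOn (dirichletDensity a) (openSimplex d ∩ {x | ε ≤ bary none x}) := by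
  have hcont : ContinuousOn (fun t : ℝ => t ^ (a none - 1)) (Icc ε 1) := fun t ht =>
    (Real.continuousAt_rpow_const _ _ (Or.inl (hε.trans_le ht.1).ne')).continuousWithinAt
  obtain ⟨C, hC⟩ := isCompact_Icc.exists_bound_of_continuousOn hcont
  let g : Fin d → ℝ → ℝ := fun i => (Ioo (0 : ℝ) 1).indicator fun t => t ^ (a (some i) - 1)
  have hg : ∀ i, Integrable (g i) volume := fun i => by
    rw [integrable_indicator_iff measurableSet_Ioo]
    rw [← intervalIntegrable_iff_integrableOn_Ioo_of_le zero_le_one]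
    exact intervalIntegral.intervalIntegrable_rpow' (by linarith [ha (some i)])
  have hG : Integrable (fun x : Fin d → ℝ => C * ∏ i, g i (x i)) volume :=
    (Integrable.fintype_prod hg).const_mul C
  refine hG.integrableOn.mono' (measurable_dirichletDensity a).aestronglyMeasurable ?_
  refine (ae_restrict_iff' (measurableSet_openSimplex.inter
    (measurableSet_le measurable_const (measurable_bary none)))).2 (ae_of_all _ fun x hx => ?_)
  have hx1 := hx.1
  have hx' := openSimplex_subset hx.1
  rw [Real.norm_of_nonneg (dirichletDensity_pos a hx.1).le, dirichletDensity, Fintype.prod_option]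
  have h1 := (le_abs_self _).trans (hC (bary none x) ⟨hx.2, bary_le_one hx' none⟩)
  refine mul_le_mul h1 (le_of_eq (Finset.prod_congr rfl fun i _ => ?_))
    (Finset.prod_nonneg fun i _ => (Real.rpow_pos_of_pos (hx1 (some i)) _).le)
    ((norm_nonneg _).trans (hC (bary none x) ⟨hx.2, bary_le_one hx' none⟩))
  have h2 : x i < 1 := by
    have h3 : x i ≤ ∑ j, x j :=
      Finset.single_le_sum (fun m _ => bary_nonneg hx' (some m)) (Finset.mem_univ i)
    have := hx1 none
    simp only [bary_none] at this
    linarith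
  have h4 : x i ∈ Ioo (0 : ℝ) 1 := ⟨hx1 (some i), h2⟩
  simp only [g, indicator_of_mem h4, bary_some]

lemma baryFlip_preimage_openSimplex (i : Fin d) :
    baryFlip i ⁻¹' openSimplex d = openSimplex d := by
  ext x
  simp only [openSimplex, mem_preimage, mem_ofPred_eq, bary_baryFlip]
  exact (Equiv.swap none (some i)).forall_congr_left.trans (by simp)

/-- The d + 1 barycentric coordinates sum to 1, so one of them is at least 1/(d + 1); the
volume-preserving `baryFlip` moves it to the place `none`. -/
lemma integrableOn_dirichletDensity {a : Option (Fin d) → ℝ} (ha : ∀ k, 0 < a k) :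
    IntegrableOn (dirichletDensity a) (openSimplex d) := by
  have hd : (0 : ℝ) < 1 / (d + 1) := by positivity
  have hcover : openSimplex d ⊆ ⋃ k, openSimplex d ∩ {x | 1 / (d + 1 : ℝ) ≤ bary k x} := by
    intro x hx
    by_contra hn
    simp only [mem_iUnion, not_exists, mem_inter_iff, hx, true_and, mem_ofPred_eq, not_le] at hn
    have h1 := Finset.sum_lt_sum_of_nonempty (Finset.univ_nonempty (α := Option (Fin d)))
      fun k _ => hn k
    rw [sum_bary] at h1
    simp at h1
    rw [mul_inv_cancel₀ (by positivity)] at h1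
    exact lt_irrefl _ h1
  refine IntegrableOn.mono_set ?_ hcover
  rw [integrableOn_finite_iUnion]
  intro k
  cases k with
  | none => exact integrableOn_dirichletDensity_aux ha hd
  | some i =>
    have h := integrableOn_dirichletDensity_aux
      (a := fun k => a (Equiv.swap none (some i) k)) (fun k => ha _) hd
    rw [← (measurePreserving_baryFlip i).integrableOn_comp_preimage
      (measurableEmbedding_baryFlip i)] at h
    rw [preimage_inter, baryFlip_preimage_openSimplex] at h
    convert h using 1
    · funext x
      simp [dirichletDensity_baryFlip]
    · ext x
      simp only [mem_inter_iff, mem_preimage, mem_ofPred_eq, bary_baryFlip,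
        Equiv.swap_apply_left]

end Simplex

/-! ### Integration by parts along the edges of the simplex. -/

section IntegrationByParts

open Set Filter Topology

variable {d : ℕ}

lemma uniqueDiffOn_simplexT : UniqueDiffOn ℝ (simplexT d) := by
  refine uniqueDiffOn_convex convex_simplexT ?_
  exact openSimplex_nonempty.mono (interior_maximal openSimplex_subset isOpen_openSimplex)

lemma simplexT_mem_nhds {x : Fin d → ℝ} (hx : x ∈ openSimplex d) : simplexT d ∈ 𝓝 x :=
  mem_of_superset (isOpen_openSimplex.mem_nhds hx) openSimplex_subset

lemma ContDiffOn.differentiableAt_of_mem_openSimplex {q : (Fin d → ℝ) → ℝ}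
    (hq : ContDiffOn ℝ 1 q (simplexT d)) {x : Fin d → ℝ} (hx : x ∈ openSimplex d) :
    DifferentiableAt ℝ q x :=
  (hq.contDiffAt (simplexT_mem_nhds hx)).differentiableAt one_ne_zero

lemma ContDiffOn.exists_bound_simplexT {q : (Fin d → ℝ) → ℝ}
    (hq : ContDiffOn ℝ 1 q (simplexT d)) : ∃ C, 0 ≤ C ∧ ∀ x ∈ simplexT d, |q x| ≤ C := by
  obtain ⟨C, hC⟩ := isCompact_simplexT.exists_bound_of_continuousOn hq.continuousOn
  obtain ⟨x, hx⟩ := openSimplex_nonempty (d := d)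
  exact ⟨C, (norm_nonneg _).trans (hC x (openSimplex_subset hx)), hC⟩

lemma ContDiffOn.exists_fderivWithin_bound_simplexT {q : (Fin d → ℝ) → ℝ}
    (hq : ContDiffOn ℝ 1 q (simplexT d)) :
    ∃ C, 0 ≤ C ∧ ∀ x ∈ simplexT d, ‖fderivWithin ℝ q (simplexT d) x‖ ≤ C := by
  obtain ⟨C, hC⟩ := isCompact_simplexT.exists_bound_of_continuousOn
    (hq.continuousOn_fderivWithin uniqueDiffOn_simplexT le_rfl)
  obtain ⟨x, hx⟩ := openSimplex_nonempty (d := d)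
  exact ⟨C, (norm_nonneg _).trans (hC x (openSimplex_subset hx)), hC⟩

lemma ContDiffOn.exists_fderiv_bound_openSimplex {q : (Fin d → ℝ) → ℝ}
    (hq : ContDiffOn ℝ 1 q (simplexT d)) :
    ∃ C, 0 ≤ C ∧ ∀ x ∈ openSimplex d, ‖fderiv ℝ q x‖ ≤ C := by
  obtain ⟨C, h0, hC⟩ := hq.exists_fderivWithin_bound_simplexT
  refine ⟨C, h0, fun x hx => ?_⟩
  rw [← fderivWithin_of_mem_nhds (simplexT_mem_nhds hx)]
  exact hC x (openSimplex_subset hx)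

lemma ContDiffOn.exists_lipschitz_simplexT {q : (Fin d → ℝ) → ℝ}
    (hq : ContDiffOn ℝ 1 q (simplexT d)) :
    ∃ C, 0 ≤ C ∧ ∀ x ∈ simplexT d, ∀ y ∈ simplexT d, |q x - q y| ≤ C * ‖x - y‖ := by
  obtain ⟨C, h0, hC⟩ := hq.exists_fderivWithin_bound_simplexT
  refine ⟨C, h0, fun x hx y hy => ?_⟩
  exact convex_simplexT.norm_image_sub_le_of_norm_fderivWithin_le
    (hq.differentiableOn one_ne_zero) hC hy hx

lemma ContDiffOn.measurable_indicator_openSimplex {q : (Fin d → ℝ) → ℝ}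
    (hq : ContDiffOn ℝ 1 q (simplexT d)) : Measurable ((openSimplex d).indicator q) := by
  classical
  rw [← piecewise_eq_indicator]
  exact (hq.continuousOn.mono openSimplex_subset).measurable_piecewise
    (g := fun _ => (0 : ℝ)) continuousOn_const measurableSet_openSimplex

/-- Translation invariance gives ∫ (Φ(x + v) - Φ(x)) dx = 0, and by Fubini the same integral equals
∫ Φ'. Fubini also makes Φ' integrable on almost every segment, so the fundamental theorem is
required only there. -/
lemma integral_eq_zero_of_line_ftc {Φ Φ' : (Fin d → ℝ) → ℝ} (v : Fin d → ℝ)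
    (hΦ : Integrable Φ) (hΦ' : Integrable Φ') (hm : Measurable Φ')
    (h : ∀ x, IntervalIntegrable (fun s : ℝ => Φ' (x + s • v)) volume 0 1 →
      Φ (x + v) - Φ x = ∫ s in (0 : ℝ)..1, Φ' (x + s • v)) :
    ∫ x, Φ' x = 0 := by
  let ν : Measure ℝ := volume.restrict (Ioc 0 1)
  have hmeas : Measurable fun z : (Fin d → ℝ) × ℝ => Φ' (z.1 + z.2 • v) :=
    hm.comp (by fun_prop)
  have hint : Integrable (fun z : (Fin d → ℝ) × ℝ => Φ' (z.1 + z.2 • v)) (volume.prod ν) := by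
    rw [integrable_prod_iff' hmeas.aestronglyMeasurable]
    refine ⟨ae_of_all _ fun s => hΦ'.comp_add_right (s • v), ?_⟩
    have : (fun s : ℝ => ∫ x, ‖Φ' (x + s • v)‖) = fun _ => ∫ x, ‖Φ' x‖ :=
      funext fun s => integral_add_right_eq_self (fun x => ‖Φ' x‖) (s • v)
    simp only [this]
    exact integrable_const _
  have h1 : ∫ x, (Φ (x + v) - Φ x) = 0 := by
    rw [integral_sub (hΦ.comp_add_right v) hΦ, integral_add_right_eq_self, sub_self]
  have h2 : ∫ x, (Φ (x + v) - Φ x) = ∫ x, ∫ s, Φ' (x + s • v) ∂ν := by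
    refine integral_congr_ae ?_
    filter_upwards [hint.prod_right_ae] with x hx
    rw [h x, intervalIntegral.integral_of_le zero_le_one]
    rwa [intervalIntegrable_iff_integrableOn_Ioc_of_le zero_le_one]
  rw [h2, integral_integral_swap hint] at h1
  have h3 : (fun s : ℝ => ∫ x, Φ' (x + s • v)) = fun _ => ∫ x, Φ' x :=
    funext fun s => integral_add_right_eq_self Φ' (s • v)
  rw [h3] at h1
  simpa [ν] using h1

/-- Exponents below 1 make φ' unbounded at α and β. The majorant ω keeps φ continuous there, and the
fundamental theorem tolerates two exceptional points. -/
lemma sub_eq_integral_of_support_Ioo {α β : ℝ} {φ φ' ω : ℝ → ℝ}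
    (hder : ∀ s ∈ Ioo α β, HasDerivAt φ (φ' s) s) (hφ : ∀ s ∉ Ioo α β, φ s = 0)
    (hφ' : ∀ s ∉ Ioo α β, φ' s = 0) (hω : Continuous ω) (hle : ∀ s, |φ s| ≤ ω s)
    (hω0 : ∀ s ∉ Ioo α β, ω s = 0) (hint : IntervalIntegrable φ' volume 0 1) :
    φ 1 - φ 0 = ∫ s in (0 : ℝ)..1, φ' s := by
  have hcont : Continuous φ := by
    rw [continuous_iff_continuousAt]
    intro s
    by_cases hs : s ∈ Ioo α β
    · exact (hder s hs).continuousAt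
    · rw [ContinuousAt, hφ s hs]
      refine squeeze_zero_norm hle ?_
      rw [← hω0 s hs]
      exact hω.tendsto s
  symm
  refine integral_eq_of_hasDerivAt_off_countable φ φ' (s := {α, β}) (by simp)
    hcont.continuousOn ?_ hint
  rintro s ⟨_, hs⟩
  simp only [mem_insert_iff, mem_singleton_iff, not_or] at hs
  by_cases h : s ∈ Ioo α β
  · exact hder s h
  rw [hφ' s h]
  have hev : ∀ᶠ y in 𝓝 s, φ y = 0 := by
    rcases lt_or_ge s α with h1 | h1
    · filter_upwards [Iio_mem_nhds h1] with y hy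
      exact hφ y fun hy' => lt_asymm hy'.1 hy
    · have h2 : β < s := by
        by_contra h3
        push Not at h3
        exact h ⟨lt_of_le_of_ne h1 (Ne.symm hs.1), lt_of_le_of_ne h3 hs.2⟩
      filter_upwards [Ioi_mem_nhds h2] with y hy
      exact hφ y fun hy' => lt_asymm hy'.2 hy
  exact (hasDerivAt_const s (0 : ℝ)).congr_of_eventuallyEq hev

/-- The vertex of the simplex belonging to a barycentric coordinate. -/
def baryVertex (k : Option (Fin d)) : Fin d → ℝ := k.elim 0 fun i => Pi.single i 1

/-- The edge of the simplex from the vertex `l` to the vertex `k`. -/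
def baryEdge (k l : Option (Fin d)) : Fin d → ℝ := baryVertex k - baryVertex l

lemma bary_add_smul_baryVertex (m k : Option (Fin d)) (x : Fin d → ℝ) (s : ℝ) :
    bary m (x + s • baryVertex k) =
      bary m x + s * ((if m = k then 1 else 0) - if m = none then 1 else 0) := by
  cases k with
  | none => cases m <;> simp [baryVertex]
  | some i =>
    cases m with
    | none =>
      simp [baryVertex, Finset.sum_add_distrib, ← Finset.mul_sum]
      ring
    | some j => simp [baryVertex, Pi.single_apply]

lemma bary_add_smul_baryEdge (m k l : Option (Fin d)) (x : Fin d → ℝ) (s : ℝ) :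
    bary m (x + s • baryEdge k l) =
      bary m x + s * ((if m = k then 1 else 0) - if m = l then 1 else 0) := by
  have h : x + s • baryEdge k l = x + s • baryVertex k + (-s) • baryVertex l := by
    rw [baryEdge]; module
  rw [h, bary_add_smul_baryVertex, bary_add_smul_baryVertex]
  ring

/-- The integrand of the integration by parts along an edge. -/
noncomputable def edgeDiv (a : Option (Fin d) → ℝ) (k l : Option (Fin d)) (q : (Fin d → ℝ) → ℝ)
    (x : Fin d → ℝ) : ℝ :=
  (bary k x * bary l x * fderiv ℝ q x (baryEdge k l) +
    (a k * bary l x - a l * bary k x) * q x) * dirichletDensity a x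

lemma dirichletDensity_eq_erase (a : Option (Fin d) → ℝ) {k l : Option (Fin d)} (hkl : k ≠ l)
    (x : Fin d → ℝ) : dirichletDensity a x = bary k x ^ (a k - 1) * (bary l x ^ (a l - 1) *
      ∏ m ∈ (Finset.univ.erase k).erase l, bary m x ^ (a m - 1)) := by
  rw [dirichletDensity, ← Finset.mul_prod_erase _ _ (Finset.mem_univ k),
    ← Finset.mul_prod_erase (Finset.univ.erase k) _
      (Finset.mem_erase.2 ⟨hkl.symm, Finset.mem_univ l⟩)]

/-- Along an edge direction only the coordinates k and l vary, with slopes 1 and -1, so the function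
on the line is c·q·(α + s)^(a_k) (β - s)^(a_l): the extra factors bary_k bary_l turn the exponents a
- 1 into the positive exponents a. -/
lemma line_ftc_edge {a : Option (Fin d) → ℝ} (ha : ∀ k, 0 < a k) {k l : Option (Fin d)}
    (hkl : k ≠ l) {q : (Fin d → ℝ) → ℝ} (hq : ContDiffOn ℝ 1 q (simplexT d)) (x : Fin d → ℝ)
    (hint : IntervalIntegrable (fun s : ℝ => (openSimplex d).indicator (edgeDiv a k l q)
      (x + s • baryEdge k l)) volume 0 1) :
    (openSimplex d).indicator (fun y => bary k y * bary l y * q y * dirichletDensity a y)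
        (x + baryEdge k l) -
      (openSimplex d).indicator (fun y => bary k y * bary l y * q y * dirichletDensity a y) x =
      ∫ s in (0 : ℝ)..1, (openSimplex d).indicator (edgeDiv a k l q) (x + s • baryEdge k l) := by
  set v := baryEdge k l with hv
  set Φ := (openSimplex d).indicator fun y => bary k y * bary l y * q y * dirichletDensity a y
    with hΦ
  have hk : ∀ s : ℝ, bary k (x + s • v) = bary k x + s := fun s => by
    rw [hv, bary_add_smul_baryEdge]; simp [hkl]
  have hl : ∀ s : ℝ, bary l (x + s • v) = bary l x - s := fun s => by
    rw [hv, bary_add_smul_baryEdge]; simp [hkl.symm]; ring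
  have hm : ∀ m, m ≠ k → m ≠ l → ∀ s : ℝ, bary m (x + s • v) = bary m x := fun m h1 h2 s => by
    rw [hv, bary_add_smul_baryEdge]; simp [h1, h2]
  have hends : Φ (x + v) - Φ x = Φ (x + (1 : ℝ) • v) - Φ (x + (0 : ℝ) • v) := by simp
  rw [hends]
  -- If another coordinate is not positive, the whole line misses the open simplex and both sides
  -- vanish.
  by_cases hpos : ∀ m, m ≠ k → m ≠ l → 0 < bary m x
  swap
  · push Not at hpos
    obtain ⟨m, h1, h2, h3⟩ := hpos
    have hnot : ∀ s : ℝ, x + s • v ∉ openSimplex d := fun s hs => by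
      have := hs m
      rw [hm m h1 h2] at this
      linarith
    have h0 : ∀ s : ℝ, Φ (x + s • v) = 0 := fun s => indicator_of_notMem (hnot s) _
    rw [h0, h0]
    simp [indicator_of_notMem (hnot _)]
  have hmem : ∀ s : ℝ, x + s • v ∈ openSimplex d ↔ s ∈ Ioo (-bary k x) (bary l x) := by
    intro s
    constructor
    · intro hs
      have h1 := hs k
      have h2 := hs l
      rw [hk] at h1
      rw [hl] at h2
      constructor <;> linarith
    · rintro ⟨h1, h2⟩ m
      by_cases hmk : m = k
      · rw [hmk, hk]; linarith
      by_cases hml : m = l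
      · rw [hml, hl]; linarith
      · rw [hm m hmk hml]; exact hpos m hmk hml
  set c := ∏ m ∈ (Finset.univ.erase k).erase l, bary m x ^ (a m - 1) with hc
  have hc0 : 0 ≤ c := Finset.prod_nonneg fun m hm' => by
    simp only [Finset.mem_erase] at hm'
    exact (Real.rpow_pos_of_pos (hpos m hm'.2.1 hm'.1) _).le
  have hcs : ∀ s : ℝ, ∏ m ∈ (Finset.univ.erase k).erase l, bary m (x + s • v) ^ (a m - 1) = c :=
    fun s => Finset.prod_congr rfl fun m hm' => by
      simp only [Finset.mem_erase] at hm'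
      rw [hm m hm'.2.1 hm'.1]
  have hpow : ∀ t e : ℝ, 0 < t → t * t ^ (e - 1) = t ^ e := fun t e ht => by
    rw [Real.rpow_sub_one ht.ne', mul_div_cancel₀ _ ht.ne']
  obtain ⟨C, hC0, hC⟩ := hq.exists_bound_simplexT
  have hΦs : ∀ s ∈ Ioo (-bary k x) (bary l x), Φ (x + s • v) =
      c * (q (x + s • v) * ((bary k x + s) ^ a k * (bary l x - s) ^ a l)) := by
    intro s hs
    have h1 : 0 < bary k x + s := by linarith [hs.1]
    have h2 : 0 < bary l x - s := by linarith [hs.2]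
    rw [hΦ, indicator_of_mem ((hmem s).2 hs), dirichletDensity_eq_erase a hkl, hcs, hk, hl,
      ← hpow _ (a k) h1, ← hpow _ (a l) h2]
    ring
  -- The majorant is continuous and vanishes off the interval because 0^a = 0 for a > 0.
  refine sub_eq_integral_of_support_Ioo (α := -bary k x) (β := bary l x)
    (φ := fun s => Φ (x + s • v))
    (ω := fun s => c * (C * (max (bary k x + s) 0 ^ a k * max (bary l x - s) 0 ^ a l)))
    ?_ ?_ ?_ ?_ ?_ ?_ hint
  · intro s hs
    have h1 : 0 < bary k x + s := by linarith [hs.1]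
    have h2 : 0 < bary l x - s := by linarith [hs.2]
    have hmem' := (hmem s).2 hs
    have hline : HasDerivAt (fun s : ℝ => x + s • v) v s := by
      simpa using ((hasDerivAt_id s).smul_const v).const_add x
    have hq' := (hq.differentiableAt_of_mem_openSimplex hmem').hasFDerivAt.comp_hasDerivAt s hline
    have hk' := ((hasDerivAt_id s).const_add (bary k x)).rpow_const (p := a k) (Or.inl h1.ne')
    have hl' := ((hasDerivAt_id s).const_sub (bary l x)).rpow_const (p := a l) (Or.inl h2.ne')
    have hder := (hq'.mul (hk'.mul hl')).const_mul c
    refine (hder.congr_of_eventuallyEq ?_).congr_deriv ?_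
    · filter_upwards [Ioo_mem_nhds hs.1 hs.2] with y hy
      exact hΦs y hy
    · rw [indicator_of_mem hmem', edgeDiv, dirichletDensity_eq_erase a hkl, hcs, hk, hl]
      simp only [id, Function.comp_apply, Pi.mul_apply]
      rw [← hpow _ (a k) h1, ← hpow _ (a l) h2]
      ring
  · exact fun s hs => indicator_of_notMem (fun h => hs ((hmem s).1 h)) _
  · exact fun s hs => indicator_of_notMem (fun h => hs ((hmem s).1 h)) _
  · refine continuous_const.mul (continuous_const.mul (Continuous.mul ?_ ?_))
    · exact ((continuous_const.add continuous_id).max continuous_const).rpow_const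
        fun _ => Or.inr (ha k).le
    · exact ((continuous_const.sub continuous_id).max continuous_const).rpow_const
        fun _ => Or.inr (ha l).le
  · intro s
    by_cases hs : s ∈ Ioo (-bary k x) (bary l x)
    · have h1 : 0 < bary k x + s := by linarith [hs.1]
      have h2 : 0 < bary l x - s := by linarith [hs.2]
      have hp : 0 ≤ (bary k x + s) ^ a k * (bary l x - s) ^ a l := by positivity
      simp only [hΦs s hs]
      rw [abs_mul, abs_mul, abs_of_nonneg hc0, abs_of_nonneg hp, max_eq_left h1.le,
        max_eq_left h2.le]
      have := hC _ (openSimplex_subset ((hmem s).2 hs))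
      gcongr
    · have : Φ (x + s • v) = 0 := indicator_of_notMem (fun h => hs ((hmem s).1 h)) _
      simp only [this, abs_zero]
      positivity
  · intro s hs
    have h : bary k x + s ≤ 0 ∨ bary l x - s ≤ 0 := by
      by_contra hn
      push Not at hn
      exact hs ⟨by linarith, by linarith⟩
    rcases h with h | h
    · simp [max_eq_right h, Real.zero_rpow (ha k).ne']
    · simp [max_eq_right h, Real.zero_rpow (ha l).ne']

lemma integrableOn_mul_dirichletDensity {a : Option (Fin d) → ℝ} (ha : ∀ k, 0 < a k)
    {g : (Fin d → ℝ) → ℝ} (hg : Measurable ((openSimplex d).indicator g)) {C : ℝ}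
    (hC : ∀ x ∈ openSimplex d, |g x| ≤ C) :
    IntegrableOn (fun x => g x * dirichletDensity a x) (openSimplex d) := by
  have h1 : AEStronglyMeasurable g (volume.restrict (openSimplex d)) :=
    (aestronglyMeasurable_indicator_iff measurableSet_openSimplex).1 hg.aestronglyMeasurable
  exact (integrableOn_dirichletDensity ha).bdd_mul h1
    ((ae_restrict_iff' measurableSet_openSimplex).2 (ae_of_all _ fun x hx => hC x hx))

lemma norm_baryEdge_le (k l : Option (Fin d)) : ‖baryEdge k l‖ ≤ 2 := by
  have h : ∀ k : Option (Fin d), ‖baryVertex k‖ ≤ 1 := fun k => by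
    cases k with
    | none => simp [baryVertex]
    | some i => simp [baryVertex, Pi.norm_single]
  exact (norm_sub_le _ _).trans (by linarith [h k, h l])

lemma ContDiffOn.exists_bound_fderiv_baryEdge {q : (Fin d → ℝ) → ℝ}
    (hq : ContDiffOn ℝ 1 q (simplexT d)) :
    ∃ C, 0 ≤ C ∧ ∀ k l, ∀ x ∈ openSimplex d, |fderiv ℝ q x (baryEdge k l)| ≤ C := by
  obtain ⟨C, h0, hC⟩ := hq.exists_fderiv_bound_openSimplex
  refine ⟨C * 2, by positivity, fun k l x hx => ?_⟩
  exact ((fderiv ℝ q x).le_opNorm _).trans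
    (mul_le_mul (hC x hx) (norm_baryEdge_le k l) (norm_nonneg _) h0)

/-- Integration by parts along an edge of the simplex. -/
theorem setIntegral_edgeDiv {a : Option (Fin d) → ℝ} (ha : ∀ k, 0 < a k) (k l : Option (Fin d))
    {q : (Fin d → ℝ) → ℝ} (hq : ContDiffOn ℝ 1 q (simplexT d)) :
    IntegrableOn (edgeDiv a k l q) (openSimplex d) ∧
      ∫ x in openSimplex d, edgeDiv a k l q x = 0 := by
  obtain ⟨C, hC0, hC⟩ := hq.exists_bound_simplexT
  obtain ⟨C', hC0', hC'⟩ := hq.exists_bound_fderiv_baryEdge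
  have hqm := hq.measurable_indicator_openSimplex
  have hb : ∀ x ∈ openSimplex d, ∀ m, |bary m x| ≤ 1 := fun x hx m => by
    rw [abs_of_pos (hx m)]
    exact bary_le_one (openSimplex_subset hx) m
  have hfm : Measurable fun x => fderiv ℝ q x (baryEdge k l) :=
    measurable_fderiv_apply_const ℝ q (baryEdge k l)
  have hind : ∀ x ∈ openSimplex d, (openSimplex d).indicator q x = q x := fun x hx =>
    indicator_of_mem hx q
  have hI : IntegrableOn (edgeDiv a k l q) (openSimplex d) := by
    refine integrableOn_mul_dirichletDensity ha (C := C' + (|a k| + |a l|) * C) ?_ ?_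
    · have : Measurable fun x => bary k x * bary l x * fderiv ℝ q x (baryEdge k l) +
          (a k * bary l x - a l * bary k x) * (openSimplex d).indicator q x := by fun_prop
      convert this.indicator measurableSet_openSimplex using 1
      refine indicator_congr fun x hx => ?_
      rw [hind x hx]
    · intro x hx
      refine (abs_add_le _ _).trans (add_le_add ?_ ?_)
      · rw [abs_mul, abs_mul]
        have := mul_le_one₀ (hb x hx k) (abs_nonneg _) (hb x hx l)
        calc _ ≤ 1 * C' := mul_le_mul this (hC' k l x hx) (abs_nonneg _) zero_le_one
          _ = C' := one_mul _
      · rw [abs_mul]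
        refine mul_le_mul ?_ (hC x (openSimplex_subset hx)) (abs_nonneg _) (by positivity)
        refine (abs_sub _ _).trans (add_le_add ?_ ?_)
        · rw [abs_mul]; exact mul_le_of_le_one_right (abs_nonneg _) (hb x hx l)
        · rw [abs_mul]; exact mul_le_of_le_one_right (abs_nonneg _) (hb x hx k)
  refine ⟨hI, ?_⟩
  rcases eq_or_ne k l with rfl | hkl
  · have : ∀ x, edgeDiv a k k q x = 0 := fun x => by
      simp [edgeDiv, baryEdge]
    simp [this]
  rw [← integral_indicator measurableSet_openSimplex]
  have hI1 : IntegrableOn (fun y => bary k y * bary l y * q y * dirichletDensity a y)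
      (openSimplex d) := by
    refine integrableOn_mul_dirichletDensity ha (C := C) ?_ ?_
    · have : Measurable fun x => bary k x * bary l x * (openSimplex d).indicator q x := by fun_prop
      convert this.indicator measurableSet_openSimplex using 1
      refine indicator_congr fun x hx => ?_
      rw [hind x hx]
    · intro x hx
      rw [abs_mul, abs_mul]
      have := mul_le_one₀ (hb x hx k) (abs_nonneg _) (hb x hx l)
      calc _ ≤ 1 * C := mul_le_mul this (hC x (openSimplex_subset hx)) (abs_nonneg _) zero_le_one
        _ = C := one_mul _
  refine integral_eq_zero_of_line_ftc (baryEdge k l)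
    ((integrable_indicator_iff measurableSet_openSimplex).2 hI1)
    ((integrable_indicator_iff measurableSet_openSimplex).2 hI) ?_
    fun x hx => line_ftc_edge ha hkl hq x hx
  have : Measurable fun x => (bary k x * bary l x * fderiv ℝ q x (baryEdge k l) +
      (a k * bary l x - a l * bary k x) * (openSimplex d).indicator q x) *
        dirichletDensity a x := by
    have := measurable_dirichletDensity a
    fun_prop
  convert this.indicator measurableSet_openSimplex using 1
  refine indicator_congr fun x hx => ?_
  rw [hind x hx, edgeDiv]

end IntegrationByParts

/-! ### The smoothed pair weight and the carré du champ. -/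

section EnergyForm

open Set Filter Topology

variable {d : ℕ}

/-- The difference of the two coordinates of a pair. -/
def pairDiff (p : OrderedPair d) (x : Fin d → ℝ) : ℝ := x p.1.1 - x p.1.2

@[fun_prop] lemma continuous_pairDiff (p : OrderedPair d) : Continuous (pairDiff p) :=
  (continuous_apply _).sub (continuous_apply _)

/-- The regularization `∏ (|x_i - x_j|² + ε)^(κ/2)` of the factor `∏ |x_i - x_j|^κ`. -/
noncomputable def pairWeight (κ ε : ℝ) (x : Fin d → ℝ) : ℝ :=
  Real.exp (κ / 2 * ∑ p : OrderedPair d, Real.log (pairDiff p x ^ 2 + ε))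

lemma pairWeight_pos (κ ε : ℝ) (x : Fin d → ℝ) : 0 < pairWeight κ ε x := Real.exp_pos _

lemma measurable_pairWeight (κ ε : ℝ) : Measurable (pairWeight (d := d) κ ε) := by
  unfold pairWeight
  have : ∀ p : OrderedPair d, Measurable (pairDiff p) := fun p => (continuous_pairDiff p).measurable
  fun_prop

lemma abs_pairDiff_le_one {x : Fin d → ℝ} (hx : x ∈ simplexT d) (p : OrderedPair d) :
    |pairDiff p x| ≤ 1 := by
  have h1 := bary_nonneg hx (some p.1.1)
  have h2 := bary_nonneg hx (some p.1.2)
  have h3 := bary_le_one hx (some p.1.1)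
  have h4 := bary_le_one hx (some p.1.2)
  simp only [bary_some] at h1 h2 h3 h4
  rw [pairDiff, abs_le]
  constructor <;> linarith

lemma pairWeight_le {κ ε : ℝ} (hκ : 0 ≤ κ) (hε : 0 ≤ ε) (hε' : ε ≤ 1) {x : Fin d → ℝ}
    (hx : x ∈ simplexT d) :
    pairWeight κ ε x ≤ Real.exp (κ / 2 * ∑ _p : OrderedPair d, Real.log 2) := by
  refine Real.exp_le_exp.2 (mul_le_mul_of_nonneg_left (Finset.sum_le_sum fun p _ => ?_)
    (by positivity))
  have h1 : pairDiff p x ^ 2 ≤ 1 := by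
    rw [← sq_abs]; exact pow_le_one₀ (abs_nonneg _) (abs_pairDiff_le_one hx p)
  -- The value ε = 0 is allowed; on the diagonal the default log 0 = 0 still obeys the bound.
  rcases (add_nonneg (sq_nonneg (pairDiff p x)) hε).eq_or_lt with h | h
  · rw [← h, Real.log_zero]; exact Real.log_nonneg (by norm_num)
  · exact Real.log_le_log h (by linarith)

lemma sum_orderedPair_swapCoord (g : ℝ → ℝ → ℝ) (hg : ∀ s t, g s t = g t s) (i j : Fin d)
    (x : Fin d → ℝ) : ∑ p : OrderedPair d, g (swapCoord i j x p.1.1) (swapCoord i j x p.1.2) =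
      ∑ p : OrderedPair d, g (x p.1.1) (x p.1.2) := by
  have h : ∀ y : Fin d → ℝ, ∑ p : OrderedPair d, g (y p.1.1) (y p.1.2) * 2 =
      ∑ k, ∑ l, if k = l then 0 else g (y k) (y l) := by
    intro y
    rw [← sum_orderedPair_add_swap _ (fun i => by simp)]
    refine Finset.sum_congr rfl fun p _ => ?_
    have := (ne_of_lt p.2)
    rw [if_neg this, if_neg this.symm, hg (y p.1.2)]
    ring
  have h2 : (∑ k, ∑ l, if k = l then 0 else g (swapCoord i j x k) (swapCoord i j x l)) =
      ∑ k, ∑ l, if k = l then 0 else g (x k) (x l) := by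
    rw [← Equiv.sum_comp (Equiv.swap i j) fun k => ∑ l, if k = l then 0 else g (x k) (x l)]
    refine Finset.sum_congr rfl fun k _ => ?_
    rw [← Equiv.sum_comp (Equiv.swap i j) fun l => if Equiv.swap i j k = l then 0 else
      g (x (Equiv.swap i j k)) (x l)]
    refine Finset.sum_congr rfl fun l _ => ?_
    simp [swapCoord]
  have h3 := (h (swapCoord i j x)).trans (h2.trans (h x).symm)
  rw [← Finset.sum_mul, ← Finset.sum_mul] at h3
  linarith

lemma pairWeight_swapCoord (κ ε : ℝ) (i j : Fin d) (x : Fin d → ℝ) :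
    pairWeight κ ε (swapCoord i j x) = pairWeight κ ε x := by
  unfold pairWeight pairDiff
  rw [sum_orderedPair_swapCoord (fun s t => Real.log ((s - t) ^ 2 + ε))]
  intro s t
  rw [← neg_sub, neg_sq]

lemma hasFDerivAt_pairWeight (κ : ℝ) {ε : ℝ} (hε : 0 < ε) (x : Fin d → ℝ) :
    ∃ D : (Fin d → ℝ) →L[ℝ] ℝ, HasFDerivAt (pairWeight κ ε) D x ∧ ∀ v, D v =
      pairWeight κ ε x * (κ * ∑ p : OrderedPair d,
        pairDiff p x / (pairDiff p x ^ 2 + ε) * pairDiff p v) := by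
  have hδ : ∀ p : OrderedPair d, HasFDerivAt (pairDiff p)
      (ContinuousLinearMap.proj (R := ℝ) (φ := fun _ : Fin d => ℝ) p.1.1 -
        ContinuousLinearMap.proj p.1.2) x := fun p =>
    (hasFDerivAt_apply _ _).sub (hasFDerivAt_apply _ _)
  have hpos : ∀ p : OrderedPair d, pairDiff p x ^ 2 + ε ≠ 0 := fun p => by positivity
  have hl := HasFDerivAt.fun_sum (u := Finset.univ) fun (p : OrderedPair d) _ =>
    ((((hδ p).pow 2).add_const ε).log (hpos p))
  have := (hl.const_mul (κ / 2)).exp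
  refine ⟨_, this, fun v => ?_⟩
  simp only [smul_apply, sum_apply, smul_eq_mul,
    pairWeight, sub_apply, ContinuousLinearMap.proj_apply, pairDiff]
  congr 1
  rw [Finset.mul_sum, Finset.mul_sum]
  refine Finset.sum_congr rfl fun p _ => ?_
  have := hpos p
  simp only [pairDiff] at this
  simp
  field_simp

/-- The purpose of ε: for small κ the factor |x_i - x_j|^κ is not differentiable on the diagonal, so
edge integration by parts does not apply to it directly. -/
lemma contDiff_pairWeight (κ : ℝ) {ε : ℝ} (hε : 0 < ε) {n : WithTop ℕ∞} :
    ContDiff ℝ n (pairWeight (d := d) κ ε) := by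
  unfold pairWeight pairDiff
  refine Real.contDiff_exp.comp (contDiff_const.mul (ContDiff.sum fun p _ => ContDiff.log ?_ ?_))
  · exact (((contDiff_apply ℝ ℝ p.1.1).sub (contDiff_apply ℝ ℝ p.1.2)).pow 2).add contDiff_const
  · intro x; positivity

/-- The regularized carré du champ of the operator `Δ^T`. -/
noncomputable def carre (κ ε : ℝ) (F G : (Fin d → ℝ) → ℝ) (x : Fin d → ℝ) : ℝ :=
  1 / 2 * ∑ k, ∑ l, bary k x * bary l x *
      (fderiv ℝ F x (baryEdge k l) * fderiv ℝ G x (baryEdge k l)) +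
    κ / 4 * ∑ p : OrderedPair d, (x p.1.1 + x p.1.2) *
      ((F x - F (swapCoord p.1.1 p.1.2 x)) * (G x - G (swapCoord p.1.1 p.1.2 x))) /
        (pairDiff p x ^ 2 + ε)

lemma swapCoord_mem_openSimplex {x : Fin d → ℝ} (hx : x ∈ openSimplex d) (i j : Fin d) :
    swapCoord i j x ∈ openSimplex d := by
  intro k
  cases k with
  | none =>
    have : ∑ m, swapCoord i j x m = ∑ m, x m := Equiv.sum_comp (Equiv.swap i j) x
    rw [bary_none, this]
    exact hx none
  | some m => exact hx (some _)

lemma norm_sub_swapCoord_le (p : OrderedPair d) (x : Fin d → ℝ) :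
    ‖x - swapCoord p.1.1 p.1.2 x‖ ≤ |pairDiff p x| := by
  rw [pi_norm_le_iff_of_nonneg (abs_nonneg _)]
  intro m
  rw [Real.norm_eq_abs, Pi.sub_apply, swapCoord, pairDiff, Equiv.swap_apply_def]
  split_ifs with h1 h2
  · rw [h1]
  · rw [h2, abs_sub_comm]
  · simp

lemma ContDiffOn.exists_bound_sub_swapCoord {F : (Fin d → ℝ) → ℝ}
    (hF : ContDiffOn ℝ 1 F (simplexT d)) : ∃ C, 0 ≤ C ∧ ∀ p : OrderedPair d,
      ∀ x ∈ openSimplex d, |F x - F (swapCoord p.1.1 p.1.2 x)| ≤ C * |pairDiff p x| := by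
  obtain ⟨C, h0, hC⟩ := hF.exists_lipschitz_simplexT
  refine ⟨C, h0, fun p x hx => ?_⟩
  exact (hC _ (openSimplex_subset hx) _
    (openSimplex_subset (swapCoord_mem_openSimplex hx _ _))).trans
    (mul_le_mul_of_nonneg_left (norm_sub_swapCoord_le p x) h0)

lemma sq_div_sq_add_le_one (t : ℝ) {ε : ℝ} (hε : 0 ≤ ε) : t ^ 2 / (t ^ 2 + ε) ≤ 1 :=
  div_le_one_of_le₀ (by linarith) (by positivity)

/-- The bound is uniform in ε: a C¹ function is Lipschitz on the simplex, so each difference under a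
swap is at most a constant times |x_i - x_j|, and the square in the denominator is compensated. -/
lemma exists_bound_carre {κ : ℝ} (hκ : 0 ≤ κ) {F G : (Fin d → ℝ) → ℝ}
    (hF : ContDiffOn ℝ 1 F (simplexT d)) (hG : ContDiffOn ℝ 1 G (simplexT d)) :
    ∃ C, ∀ ε, 0 ≤ ε → ∀ x ∈ openSimplex d, |carre κ ε F G x| ≤ C := by
  obtain ⟨A, hA0, hA⟩ := hF.exists_bound_fderiv_baryEdge
  obtain ⟨B, hB0, hB⟩ := hG.exists_bound_fderiv_baryEdge
  obtain ⟨A', hA0', hA'⟩ := hF.exists_bound_sub_swapCoord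
  obtain ⟨B', hB0', hB'⟩ := hG.exists_bound_sub_swapCoord
  refine ⟨1 / 2 * ∑ _k : Option (Fin d), ∑ _l : Option (Fin d), A * B +
    κ / 4 * ∑ _p : OrderedPair d, 2 * (A' * B'), fun ε hε x hx => ?_⟩
  have hb : ∀ m, |bary m x| ≤ 1 := fun m => by
    rw [abs_of_pos (hx m)]; exact bary_le_one (openSimplex_subset hx) m
  refine (abs_add_le _ _).trans (add_le_add ?_ ?_)
  · rw [abs_mul, abs_of_pos (by norm_num : (0 : ℝ) < 1 / 2)]
    refine mul_le_mul_of_nonneg_left ?_ (by norm_num)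
    refine (Finset.abs_sum_le_sum_abs _ _).trans (Finset.sum_le_sum fun k _ => ?_)
    refine (Finset.abs_sum_le_sum_abs _ _).trans (Finset.sum_le_sum fun l _ => ?_)
    rw [abs_mul, abs_mul, abs_mul (fderiv ℝ F x _)]
    calc _ ≤ 1 * (A * B) := mul_le_mul (mul_le_one₀ (hb k) (abs_nonneg _) (hb l))
          (mul_le_mul (hA k l x hx) (hB k l x hx) (abs_nonneg _) hA0) (by positivity) zero_le_one
      _ = A * B := one_mul _
  · rw [abs_mul, abs_of_nonneg (by positivity : (0 : ℝ) ≤ κ / 4)]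
    refine mul_le_mul_of_nonneg_left ?_ (by positivity)
    refine (Finset.abs_sum_le_sum_abs _ _).trans (Finset.sum_le_sum fun p _ => ?_)
    have h1 := hb (some p.1.1)
    have h2 := hb (some p.1.2)
    have h3 : |x p.1.1 + x p.1.2| ≤ 2 := (abs_add_le _ _).trans (by
      simp only [bary_some] at h1 h2; linarith)
    rw [abs_div, abs_mul, abs_mul (F x - _),
      abs_of_nonneg (by positivity : 0 ≤ pairDiff p x ^ 2 + ε)]
    have h4 : |F x - F (swapCoord p.1.1 p.1.2 x)| * |G x - G (swapCoord p.1.1 p.1.2 x)| ≤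
        A' * B' * pairDiff p x ^ 2 := by
      refine (mul_le_mul (hA' p x hx) (hB' p x hx) (abs_nonneg _) (by positivity)).trans_eq ?_
      rw [← sq_abs (pairDiff p x)]; ring
    calc _ ≤ 2 * (A' * B' * pairDiff p x ^ 2) / (pairDiff p x ^ 2 + ε) := by gcongr
      _ = 2 * (A' * B') * (pairDiff p x ^ 2 / (pairDiff p x ^ 2 + ε)) := by ring
      _ ≤ 2 * (A' * B') := mul_le_of_le_one_right (by positivity) (sq_div_sq_add_le_one _ hε)

lemma ContDiffOn.aestronglyMeasurable_openSimplex {F : (Fin d → ℝ) → ℝ}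
    (hF : ContDiffOn ℝ 1 F (simplexT d)) :
    AEStronglyMeasurable F (volume.restrict (openSimplex d)) :=
  (aestronglyMeasurable_indicator_iff measurableSet_openSimplex).1
    hF.measurable_indicator_openSimplex.aestronglyMeasurable

lemma ContDiffOn.aestronglyMeasurable_swapCoord {F : (Fin d → ℝ) → ℝ}
    (hF : ContDiffOn ℝ 1 F (simplexT d)) (i j : Fin d) :
    AEStronglyMeasurable (fun x => F (swapCoord i j x)) (volume.restrict (openSimplex d)) := by
  have h := (hF.measurable_indicator_openSimplex.comp
    (continuous_swapCoord i j).measurable).aestronglyMeasurable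
      (μ := volume.restrict (openSimplex d))
  refine h.congr ((ae_restrict_iff' measurableSet_openSimplex).2 (ae_of_all _ fun x hx => ?_))
  exact indicator_of_mem (swapCoord_mem_openSimplex hx i j) F

lemma aestronglyMeasurable_carre (κ ε : ℝ) {F G : (Fin d → ℝ) → ℝ}
    (hF : ContDiffOn ℝ 1 F (simplexT d)) (hG : ContDiffOn ℝ 1 G (simplexT d)) :
    AEStronglyMeasurable (carre κ ε F G) (volume.restrict (openSimplex d)) := by
  have h1 := hF.aestronglyMeasurable_openSimplex
  have h2 := hG.aestronglyMeasurable_openSimplex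
  have h3 := fun i j => hF.aestronglyMeasurable_swapCoord i j
  have h4 := fun i j => hG.aestronglyMeasurable_swapCoord i j
  unfold carre
  refine AEStronglyMeasurable.add ?_ ?_
  · refine Measurable.aestronglyMeasurable ?_
    refine measurable_const.mul (Finset.measurable_sum _ fun k _ =>
      Finset.measurable_sum _ fun l _ => ?_)
    have e1 := measurable_fderiv_apply_const ℝ F (baryEdge k l)
    have e2 := measurable_fderiv_apply_const ℝ G (baryEdge k l)
    fun_prop
  · refine aestronglyMeasurable_const.mul (Finset.aestronglyMeasurable_fun_sum _ fun p _ => ?_)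
    have e1 : Measurable fun x : Fin d → ℝ => x p.1.1 + x p.1.2 := by fun_prop
    have e2 : Measurable fun x : Fin d → ℝ => (pairDiff p x ^ 2 + ε)⁻¹ := by
      have := (continuous_pairDiff p).measurable
      fun_prop
    simp only [div_eq_mul_inv]
    exact (e1.aestronglyMeasurable.mul ((h1.sub (h3 _ _)).mul (h2.sub (h4 _ _)))).mul
      e2.aestronglyMeasurable

lemma carre_self_nonneg {κ ε : ℝ} (hκ : 0 ≤ κ) (hε : 0 ≤ ε) (F : (Fin d → ℝ) → ℝ)
    {x : Fin d → ℝ} (hx : x ∈ openSimplex d) : 0 ≤ carre κ ε F F x := by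
  refine add_nonneg (mul_nonneg (by norm_num) (Finset.sum_nonneg fun k _ =>
    Finset.sum_nonneg fun l _ => ?_)) (mul_nonneg (by positivity) (Finset.sum_nonneg fun p _ => ?_))
  · exact mul_nonneg (mul_nonneg (hx k).le (hx l).le) (mul_self_nonneg _)
  · have h1 := (hx (some p.1.1)).le
    have h2 := (hx (some p.1.2)).le
    simp only [bary_some] at h1 h2
    exact div_nonneg (mul_nonneg (add_nonneg h1 h2) (mul_self_nonneg _)) (by positivity)

lemma carre_comm (κ ε : ℝ) (F G : (Fin d → ℝ) → ℝ) (x : Fin d → ℝ) :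
    carre κ ε F G x = carre κ ε G F x := by
  unfold carre
  congr 2
  · refine Finset.sum_congr rfl fun k _ => Finset.sum_congr rfl fun l _ => by ring
  · refine Finset.sum_congr rfl fun p _ => by ring

lemma carre_sub_sub (κ ε : ℝ) {F G : (Fin d → ℝ) → ℝ} (hF : ContDiffOn ℝ 1 F (simplexT d))
    (hG : ContDiffOn ℝ 1 G (simplexT d)) {x : Fin d → ℝ} (hx : x ∈ openSimplex d) :
    carre κ ε (fun y => F y - G y) (fun y => F y - G y) x =
      carre κ ε F F x - 2 * carre κ ε F G x + carre κ ε G G x := by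
  unfold carre
  rw [fderiv_fun_sub (hF.differentiableAt_of_mem_openSimplex hx)
    (hG.differentiableAt_of_mem_openSimplex hx)]
  simp only [Finset.mul_sum, mul_add]
  have h1 : ∀ A B C A' B' C' : ℝ, A + A' - (B + B') + (C + C') = (A - B + C) + (A' - B' + C') :=
    fun _ _ _ _ _ _ => by ring
  rw [h1]
  simp only [← Finset.sum_sub_distrib, ← Finset.sum_add_distrib]
  congr 1
  · refine Finset.sum_congr rfl fun k _ => Finset.sum_congr rfl fun l _ => ?_
    simp only [sub_apply]
    ring
  · refine Finset.sum_congr rfl fun p _ => ?_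
    ring

end EnergyForm

/-! ### Pointwise form of Green's identity for the smoothed weight. -/

section Green

open Set Filter Topology MvPolynomial

variable {d : ℕ}

/-- The derivative of a polynomial in the direction of a vertex of the simplex. -/
noncomputable def vertexDeriv (k : Option (Fin d)) :
    MvPolynomial (Fin d) ℝ →ₗ[ℝ] MvPolynomial (Fin d) ℝ :=
  k.elim 0 fun i => (pderiv i).toLinearMap

@[simp] lemma vertexDeriv_none (P : MvPolynomial (Fin d) ℝ) : vertexDeriv none P = 0 := rfl

@[simp] lemma vertexDeriv_some (i : Fin d) (P : MvPolynomial (Fin d) ℝ) :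
    vertexDeriv (some i) P = pderiv i P := rfl

lemma fderiv_eval_baryVertex (P : MvPolynomial (Fin d) ℝ) (x : Fin d → ℝ) (k : Option (Fin d)) :
    fderiv ℝ (fun z => eval z P) x (baryVertex k) = eval x (vertexDeriv k P) := by
  rw [(hasFDerivAt_eval P x).fderiv]
  cases k with
  | none => simp [baryVertex]
  | some i => simp [baryVertex, Pi.single_apply]

lemma fderiv_eval_baryEdge (P : MvPolynomial (Fin d) ℝ) (x : Fin d → ℝ) (k l : Option (Fin d)) :
    fderiv ℝ (fun z => eval z P) x (baryEdge k l) =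
      eval x (vertexDeriv k P) - eval x (vertexDeriv l P) := by
  rw [baryEdge, map_sub, fderiv_eval_baryVertex, fderiv_eval_baryVertex]

lemma sum_bary_mul_vertexDeriv (P : MvPolynomial (Fin d) ℝ) (x : Fin d → ℝ) :
    ∑ k, bary k x * eval x (vertexDeriv k P) = eval x (eulerPoly d P) := by
  simp [Fintype.sum_option, eval_eulerPoly]

/-- Both sides are the covariance of u and w when the weights y have total mass 1. -/
lemma sum_polarization {ι : Type*} [Fintype ι] (y u w : ι → ℝ) (hy : ∑ k, y k = 1) :
    1 / 2 * ∑ k, ∑ l, y k * y l * ((u k - u l) * (w k - w l)) =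
      ∑ k, y k * (u k * w k) - (∑ k, y k * u k) * ∑ k, y k * w k := by
  have h : ∀ k l, y k * y l * ((u k - u l) * (w k - w l)) =
      (y k * (u k * w k)) * y l + y k * (y l * (u l * w l)) - (y k * u k) * (y l * w l) -
        (y k * w k) * (y l * u l) := fun k l => by ring
  simp only [h, Finset.sum_sub_distrib, Finset.sum_add_distrib, ← Finset.mul_sum,
    ← Finset.sum_mul, hy]
  ring

lemma sum_antisymm_weights {ι : Type*} [Fintype ι] (y a u : ι → ℝ) (hy : ∑ k, y k = 1) :
    1 / 2 * ∑ k, ∑ l, (a k * y l - a l * y k) * (u k - u l) =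
      ∑ k, a k * u k - (∑ k, a k) * ∑ k, y k * u k := by
  have h : ∀ k l, (a k * y l - a l * y k) * (u k - u l) =
      (a k * u k) * y l + y k * (a l * u l) - (y k * u k) * a l - a k * (y l * u l) :=
    fun k l => by ring
  simp only [h, Finset.sum_sub_distrib, Finset.sum_add_distrib, ← Finset.mul_sum,
    ← Finset.sum_mul, hy]
  ring

/-- The part of `Δ^T` that does not involve the pairs of coordinates. -/
noncomputable def localLap (a : Option (Fin d) → ℝ) (P : MvPolynomial (Fin d) ℝ)
    (x : Fin d → ℝ) : ℝ :=
  ∑ i, (x i * eval x (pderiv i (pderiv i P)) + a (some i) * eval x (pderiv i P)) -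
    eval x (eulerPoly d (eulerPoly d P)) + eval x (eulerPoly d P) -
    (∑ k, a k) * eval x (eulerPoly d P)

lemma eval_eulerPoly_eulerPoly (P : MvPolynomial (Fin d) ℝ) (x : Fin d → ℝ) :
    eval x (eulerPoly d (eulerPoly d P)) = eval x (eulerPoly d P) +
      ∑ i, ∑ j, x i * x j * eval x (pderiv i (pderiv j P)) := by
  rw [eval_eulerPoly, eval_eulerPoly, ← Finset.sum_add_distrib]
  refine Finset.sum_congr rfl fun i _ => ?_
  rw [eulerPoly_apply, map_sum, map_sum, Finset.mul_sum]
  have h : ∀ j, x i * eval x (pderiv i (X j * pderiv j P)) =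
      (if i = j then x i * eval x (pderiv j P) else 0) +
        x i * x j * eval x (pderiv i (pderiv j P)) := by
    intro j
    rw [pderiv_mul]
    rcases eq_or_ne i j with rfl | hij
    · simp; ring
    · rw [pderiv_X_of_ne hij.symm]; simp [hij]; ring
  simp only [h, Finset.sum_add_distrib]
  simp

/-- Decomposes the local part of `Δ^T` into operators along edges. With barycentric weights, the
covariance formula turns the edge derivatives into ∑ x_i ∂_i² minus the quadratic part of E². -/
lemma sum_edge_secondOrder (a : Option (Fin d) → ℝ) (P : MvPolynomial (Fin d) ℝ)
    (x : Fin d → ℝ) :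
    1 / 2 * ∑ k, ∑ l, (bary k x * bary l x *
        (eval x (vertexDeriv k (vertexDeriv k P - vertexDeriv l P)) -
          eval x (vertexDeriv l (vertexDeriv k P - vertexDeriv l P))) +
      (a k * bary l x - a l * bary k x) *
        (eval x (vertexDeriv k P) - eval x (vertexDeriv l P))) = localLap a P x := by
  simp only [Finset.sum_add_distrib, mul_add (1 / 2 : ℝ)]
  rw [sum_antisymm_weights (fun k => bary k x) a (fun k => eval x (vertexDeriv k P)) (sum_bary x),
    sum_bary_mul_vertexDeriv]
  have h : ∀ k l, bary k x * bary l x *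
        (eval x (vertexDeriv k (vertexDeriv k P - vertexDeriv l P)) -
          eval x (vertexDeriv l (vertexDeriv k P - vertexDeriv l P))) =
      (bary k x * eval x (vertexDeriv k (vertexDeriv k P))) * bary l x +
      bary k x * (bary l x * eval x (vertexDeriv l (vertexDeriv l P))) -
      bary k x * bary l x * eval x (vertexDeriv k (vertexDeriv l P)) -
      bary l x * bary k x * eval x (vertexDeriv l (vertexDeriv k P)) := by
    intro k l
    simp only [map_sub]
    ring
  have hsw : ∑ k, ∑ l, bary l x * bary k x * eval x (vertexDeriv l (vertexDeriv k P)) =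
      ∑ k, ∑ l, bary k x * bary l x * eval x (vertexDeriv k (vertexDeriv l P)) := Finset.sum_comm
  simp only [h, Finset.sum_sub_distrib, Finset.sum_add_distrib, hsw, ← Finset.mul_sum,
    ← Finset.sum_mul, sum_bary]
  simp only [localLap, Fintype.sum_option, bary_none, bary_some, vertexDeriv_none,
    vertexDeriv_some, map_zero, mul_zero, zero_add, Finset.sum_const_zero,
    eval_eulerPoly_eulerPoly, Finset.sum_add_distrib]
  ring

lemma sum_edge_pairDiff (P : MvPolynomial (Fin d) ℝ) (p : OrderedPair d) (x : Fin d → ℝ) :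
    1 / 2 * ∑ k, ∑ l, bary k x * bary l x *
        ((eval x (vertexDeriv k P) - eval x (vertexDeriv l P)) * pairDiff p (baryEdge k l)) =
      x p.1.1 * eval x (pderiv p.1.1 P) - x p.1.2 * eval x (pderiv p.1.2 P) -
        pairDiff p x * eval x (eulerPoly d P) := by
  have h : ∀ k l, pairDiff p (baryEdge k l) =
      pairDiff p (baryVertex k) - pairDiff p (baryVertex l) := fun k l => by
    simp only [pairDiff, baryEdge, Pi.sub_apply]; ring
  simp only [h]
  rw [sum_polarization (fun k => bary k x) (fun k => eval x (vertexDeriv k P))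
    (fun k => pairDiff p (baryVertex k)) (sum_bary x), sum_bary_mul_vertexDeriv]
  simp only [Fintype.sum_option, vertexDeriv_none, vertexDeriv_some, bary_some, pairDiff,
    baryVertex, Option.elim, Pi.zero_apply, map_zero, mul_zero, zero_add,
    Pi.single_apply, mul_sub, Finset.sum_sub_distrib, mul_ite, mul_one, Finset.sum_ite_eq,
    Finset.mem_univ, if_true]
  ring

/-- The function whose integral against the regularized weight vanishes by Green's identity. -/
noncomputable def greenIntegrand (a : Option (Fin d) → ℝ) (κ ε : ℝ) (F : (Fin d → ℝ) → ℝ)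
    (P : MvPolynomial (Fin d) ℝ) (x : Fin d → ℝ) : ℝ :=
  carre κ ε F (fun z => eval z P) x + F x * (localLap a P x +
    κ * ∑ p, pairDiff p x ^ 2 / (pairDiff p x ^ 2 + ε) *
      (eval x (pairTerm p P) - eval x (eulerPoly d P)))

/-- The antisymmetric part of a pair in Green's identity. -/
noncomputable def pairFlux (ε : ℝ) (P : MvPolynomial (Fin d) ℝ) (p : OrderedPair d)
    (x : Fin d → ℝ) : ℝ :=
  (x p.1.1 + x p.1.2) * (eval x P - eval (swapCoord p.1.1 p.1.2 x) P) / (pairDiff p x ^ 2 + ε)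

lemma fderiv_edge_product (κ : ℝ) {ε : ℝ} (hε : 0 < ε) {F : (Fin d → ℝ) → ℝ}
    (hF : ContDiffOn ℝ 1 F (simplexT d)) (Q : MvPolynomial (Fin d) ℝ) {x : Fin d → ℝ}
    (hx : x ∈ openSimplex d) (k l : Option (Fin d)) :
    fderiv ℝ (fun y => pairWeight κ ε y * (F y * eval y Q)) x (baryEdge k l) =
      pairWeight κ ε x * (F x * (eval x (vertexDeriv k Q) - eval x (vertexDeriv l Q)) +
        fderiv ℝ F x (baryEdge k l) * eval x Q +
        F x * eval x Q * (κ * ∑ p : OrderedPair d,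
          pairDiff p x / (pairDiff p x ^ 2 + ε) * pairDiff p (baryEdge k l))) := by
  obtain ⟨D, hD, hDv⟩ := hasFDerivAt_pairWeight κ hε x
  have hF' := (hF.differentiableAt_of_mem_openSimplex hx).hasFDerivAt
  have h := hD.fun_mul (hF'.fun_mul (hasFDerivAt_eval Q x))
  rw [h.fderiv, ← fderiv_eval_baryEdge, (hasFDerivAt_eval Q x).fderiv]
  simp only [add_apply, smul_apply, smul_eq_mul, hDv]
  ring

/-- Differentiating the pair weight produces first-order terms that differ from those of `pairTerm`
by the flux ½κF·`pairFlux`. One part, ¼κ(F - σF)·`pairFlux`, is the nonlocal carré du champ; the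
rest is ¼κ(F + σF)·`pairFlux`, which is odd under the swap σ. -/
lemma sum_edgeDiv_eq (a : Option (Fin d) → ℝ) (κ : ℝ) {ε : ℝ} (hε : 0 < ε)
    {F : (Fin d → ℝ) → ℝ} (hF : ContDiffOn ℝ 1 F (simplexT d)) (P : MvPolynomial (Fin d) ℝ)
    {x : Fin d → ℝ} (hx : x ∈ openSimplex d) :
    1 / 2 * ∑ k, ∑ l, edgeDiv a k l (fun y => pairWeight κ ε y *
        (F y * eval y (vertexDeriv k P - vertexDeriv l P))) x =
      (greenIntegrand a κ ε F P x + κ / 4 * ∑ p : OrderedPair d,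
        (2 * (F x * pairFlux ε P p x) - (F x - F (swapCoord p.1.1 p.1.2 x)) * pairFlux ε P p x)) *
      (pairWeight κ ε x * dirichletDensity a x) := by
  have h : ∀ k l, edgeDiv a k l (fun y => pairWeight κ ε y *
        (F y * eval y (vertexDeriv k P - vertexDeriv l P))) x =
      (bary k x * bary l x * (fderiv ℝ F x (baryEdge k l) *
          (eval x (vertexDeriv k P) - eval x (vertexDeriv l P))) +
        F x * (bary k x * bary l x *
          (eval x (vertexDeriv k (vertexDeriv k P - vertexDeriv l P)) -
            eval x (vertexDeriv l (vertexDeriv k P - vertexDeriv l P))) +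
          (a k * bary l x - a l * bary k x) *
          (eval x (vertexDeriv k P) - eval x (vertexDeriv l P))) +
        F x * κ * ∑ p : OrderedPair d, pairDiff p x / (pairDiff p x ^ 2 + ε) *
          (bary k x * bary l x *
        ((eval x (vertexDeriv k P) - eval x (vertexDeriv l P)) * pairDiff p (baryEdge k l)))) *
      (pairWeight κ ε x * dirichletDensity a x) := by
    intro k l
    have e : ∑ p : OrderedPair d, pairDiff p x / (pairDiff p x ^ 2 + ε) *
          (bary k x * bary l x *
        ((eval x (vertexDeriv k P) - eval x (vertexDeriv l P)) * pairDiff p (baryEdge k l))) =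
        bary k x * bary l x * (eval x (vertexDeriv k P) - eval x (vertexDeriv l P)) *
        ∑ p : OrderedPair d, pairDiff p x / (pairDiff p x ^ 2 + ε) * pairDiff p (baryEdge k l) := by
      rw [Finset.mul_sum]
      exact Finset.sum_congr rfl fun p _ => by ring
    rw [edgeDiv, fderiv_edge_product κ hε hF _ hx, e]
    simp only [map_sub]
    ring
  simp only [h, ← Finset.sum_mul, ← mul_assoc (1 / 2 : ℝ)]
  congr 1
  have hsw : ∑ k, ∑ l, ∑ p : OrderedPair d, pairDiff p x / (pairDiff p x ^ 2 + ε) *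
          (bary k x * bary l x *
        ((eval x (vertexDeriv k P) - eval x (vertexDeriv l P)) * pairDiff p (baryEdge k l))) =
      2 * ∑ p : OrderedPair d, pairDiff p x / (pairDiff p x ^ 2 + ε) *
        (x p.1.1 * eval x (pderiv p.1.1 P) - x p.1.2 * eval x (pderiv p.1.2 P) -
        pairDiff p x * eval x (eulerPoly d P)) := by
    simp only [← sum_edge_pairDiff]
    rw [Finset.mul_sum]
    have : ∀ k : Option (Fin d), ∑ l, ∑ p : OrderedPair d, pairDiff p x / (pairDiff p x ^ 2 + ε) *
          (bary k x * bary l x *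
        ((eval x (vertexDeriv k P) - eval x (vertexDeriv l P)) * pairDiff p (baryEdge k l))) =
        ∑ p : OrderedPair d, ∑ l, pairDiff p x / (pairDiff p x ^ 2 + ε) *
          (bary k x * bary l x *
        ((eval x (vertexDeriv k P) - eval x (vertexDeriv l P)) * pairDiff p (baryEdge k l))) :=
      fun k => Finset.sum_comm
    simp only [this]
    rw [Finset.sum_comm]
    refine Finset.sum_congr rfl fun p _ => ?_
    simp only [← Finset.mul_sum]
    ring
  simp only [Finset.sum_add_distrib, ← Finset.mul_sum, hsw, mul_add (1 / 2 : ℝ)]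
  have hsecond := sum_edge_secondOrder a P x
  simp only [Finset.sum_add_distrib, mul_add (1 / 2 : ℝ)] at hsecond
  have hpt : ∀ p : OrderedPair d, eval x (pairTerm p P) * pairDiff p x ^ 2 =
      (x p.1.1 * eval x (pderiv p.1.1 P) - x p.1.2 * eval x (pderiv p.1.2 P)) * pairDiff p x -
        1 / 2 * (x p.1.1 + x p.1.2) * (eval x P - eval (swapCoord p.1.1 p.1.2 x) P) := by
    intro p
    have h1 := congrArg (eval x) (sq_mul_pairTerm p P)
    rw [pairNum_apply] at h1
    simp only [map_mul, map_sub, map_add, map_pow, eval_X, eval_C, ← eval_swapCoord] at h1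
    rw [pairDiff, ← h1]; ring
  have hpairs : ∑ p : OrderedPair d, pairDiff p x / (pairDiff p x ^ 2 + ε) *
        (x p.1.1 * eval x (pderiv p.1.1 P) - x p.1.2 * eval x (pderiv p.1.2 P) -
        pairDiff p x * eval x (eulerPoly d P)) =
      ∑ p : OrderedPair d, pairDiff p x ^ 2 / (pairDiff p x ^ 2 + ε) *
        (eval x (pairTerm p P) - eval x (eulerPoly d P)) +
      1 / 2 * ∑ p : OrderedPair d, pairFlux ε P p x := by
    rw [Finset.mul_sum, ← Finset.sum_add_distrib]
    refine Finset.sum_congr rfl fun p _ => ?_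
    have hne : pairDiff p x ^ 2 + ε ≠ 0 := by positivity
    rw [pairFlux]
    field_simp
    linear_combination -2 * hpt p
  rw [hpairs, greenIntegrand, carre, ← hsecond]
  simp only [fderiv_eval_baryEdge]
  have hc : ∀ p : OrderedPair d, (x p.1.1 + x p.1.2) *
      ((F x - F (swapCoord p.1.1 p.1.2 x)) * (eval x P - eval (swapCoord p.1.1 p.1.2 x) P)) /
        (pairDiff p x ^ 2 + ε) = (F x - F (swapCoord p.1.1 p.1.2 x)) * pairFlux ε P p x :=
    fun p => by rw [pairFlux]; ring
  simp only [hc, Finset.sum_sub_distrib, ← Finset.mul_sum]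
  ring

end Green

/-! ### Green's identity: integration and removal of the smoothing. -/

section Green

open Set Filter Topology MvPolynomial

variable {d : ℕ}

/-- The regularized weight on the simplex. -/
noncomputable def regWeight (a : Option (Fin d) → ℝ) (κ ε : ℝ) (x : Fin d → ℝ) : ℝ :=
  pairWeight κ ε x * dirichletDensity a x

lemma regWeight_pos (a : Option (Fin d) → ℝ) (κ ε : ℝ) {x : Fin d → ℝ} (hx : x ∈ openSimplex d) :
    0 < regWeight a κ ε x := mul_pos (pairWeight_pos κ ε x) (dirichletDensity_pos a hx)

lemma measurable_regWeight (a : Option (Fin d) → ℝ) (κ ε : ℝ) : Measurable (regWeight a κ ε) :=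
  (measurable_pairWeight κ ε).mul (measurable_dirichletDensity a)

lemma integrableOn_mul_regWeight {a : Option (Fin d) → ℝ} (ha : ∀ k, 0 < a k) {κ ε : ℝ}
    (hκ : 0 ≤ κ) (hε : 0 ≤ ε) (hε' : ε ≤ 1) {g : (Fin d → ℝ) → ℝ} {C : ℝ}
    (hg : AEStronglyMeasurable g (volume.restrict (openSimplex d)))
    (hC : ∀ x ∈ openSimplex d, |g x| ≤ C) :
    IntegrableOn (fun x => g x * regWeight a κ ε x) (openSimplex d) := by
  have h1 : IntegrableOn (regWeight a κ ε) (openSimplex d) := by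
    refine (integrableOn_dirichletDensity ha).bdd_mul
      (c := Real.exp (κ / 2 * ∑ _p : OrderedPair d, Real.log 2))
      (measurable_pairWeight κ ε).aestronglyMeasurable
      ((ae_restrict_iff' measurableSet_openSimplex).2 (ae_of_all _ fun x hx => ?_))
    · rw [Real.norm_of_nonneg (pairWeight_pos κ ε x).le]
      exact pairWeight_le hκ hε hε' (openSimplex_subset hx)
  exact h1.bdd_mul hg
    ((ae_restrict_iff' measurableSet_openSimplex).2 (ae_of_all _ fun x hx => hC x hx))

lemma swapCoord_swapCoord (i j : Fin d) (x : Fin d → ℝ) : swapCoord i j (swapCoord i j x) = x := by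
  funext m; simp [swapCoord]

lemma preimage_swapCoord_openSimplex (i j : Fin d) :
    swapCoord i j ⁻¹' openSimplex d = openSimplex d := by
  ext x
  refine ⟨fun h => ?_, fun h => swapCoord_mem_openSimplex h i j⟩
  have := swapCoord_mem_openSimplex h i j
  rwa [swapCoord_swapCoord] at this

lemma bary_swapCoord (i j : Fin d) (x : Fin d → ℝ) (k : Option (Fin d)) :
    bary k (swapCoord i j x) = bary (k.map (Equiv.swap i j)) x := by
  cases k with
  | none =>
    have : ∑ m, swapCoord i j x m = ∑ m, x m := Equiv.sum_comp (Equiv.swap i j) x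
    simp [this]
  | some m => rfl

lemma regWeight_swapCoord {a : Option (Fin d) → ℝ} (ha : ∀ i j, a (some i) = a (some j)) (κ ε : ℝ)
    (i j : Fin d) (x : Fin d → ℝ) : regWeight a κ ε (swapCoord i j x) = regWeight a κ ε x := by
  rw [regWeight, regWeight, pairWeight_swapCoord, dirichletDensity, dirichletDensity]
  congr 1
  simp only [bary_swapCoord, Fintype.prod_option, Option.map_none, Option.map_some]
  congr 1
  refine Fintype.prod_equiv (Equiv.swap i j) _ _ fun m => ?_
  rw [ha m (Equiv.swap i j m)]

lemma setIntegral_eq_zero_of_swap_antisymm (i j : Fin d) {g : (Fin d → ℝ) → ℝ}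
    (hg : ∀ x ∈ openSimplex d, g (swapCoord i j x) = -g x) : ∫ x in openSimplex d, g x = 0 := by
  have h := (measurePreserving_swapCoord i j).setIntegral_preimage_emb
    (measurableEmbedding_swapCoord i j) g (openSimplex d)
  rw [preimage_swapCoord_openSimplex, setIntegral_congr_fun measurableSet_openSimplex hg,
    integral_neg] at h
  linarith

lemma pairFlux_swapCoord (ε : ℝ) (P : MvPolynomial (Fin d) ℝ) (p : OrderedPair d)
    (x : Fin d → ℝ) : pairFlux ε P p (swapCoord p.1.1 p.1.2 x) = -pairFlux ε P p x := by
  have h1 : swapCoord p.1.1 p.1.2 x p.1.1 = x p.1.2 := by simp [swapCoord]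
  have h2 : swapCoord p.1.1 p.1.2 x p.1.2 = x p.1.1 := by simp [swapCoord]
  simp only [pairFlux, pairDiff, swapCoord_swapCoord, h1, h2]
  rw [← neg_sub (x p.1.1), neg_sq]
  ring

lemma contDiffOn_eval (P : MvPolynomial (Fin d) ℝ) :
    ContDiffOn ℝ 1 (fun z : Fin d → ℝ => eval z P) (simplexT d) := (contDiff_eval P).contDiffOn

lemma continuous_pairFlux {ε : ℝ} (hε : 0 < ε) (P : MvPolynomial (Fin d) ℝ) (p : OrderedPair d) :
    Continuous (pairFlux ε P p) := by
  unfold pairFlux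
  refine Continuous.div₀ ?_ (by fun_prop) fun x => by positivity
  have h1 := continuous_eval P
  have h2 := continuous_swapCoord p.1.1 p.1.2
  have h3 := h1.comp h2
  simp only [Function.comp_def] at h3
  fun_prop

lemma exists_bound_greenIntegrand (a : Option (Fin d) → ℝ) {κ : ℝ} (hκ : 0 ≤ κ)
    {F : (Fin d → ℝ) → ℝ} (hF : ContDiffOn ℝ 1 F (simplexT d)) (P : MvPolynomial (Fin d) ℝ) :
    ∃ C, ∀ ε, 0 ≤ ε → ∀ x ∈ openSimplex d, |greenIntegrand a κ ε F P x| ≤ C := by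
  obtain ⟨A, hA⟩ := exists_bound_carre hκ hF (contDiffOn_eval P)
  obtain ⟨B, hB0, hB⟩ := hF.exists_bound_simplexT
  have hloc : Continuous (localLap a P) := by
    unfold localLap
    have := fun Q : MvPolynomial (Fin d) ℝ => continuous_eval Q
    fun_prop
  obtain ⟨L, hL⟩ := isCompact_simplexT.exists_bound_of_continuousOn
    (s := simplexT d) hloc.continuousOn
  have hp : ∀ p : OrderedPair d, ∃ R, ∀ x ∈ simplexT d,
      |eval x (pairTerm p P) - eval x (eulerPoly d P)| ≤ R := fun p =>
    isCompact_simplexT.exists_bound_of_continuousOn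
      ((continuous_eval _).sub (continuous_eval _)).continuousOn
  choose R hR using hp
  refine ⟨A + B * (L + κ * ∑ p, R p), fun ε hε x hx => ?_⟩
  have hx' := openSimplex_subset hx
  refine (abs_add_le _ _).trans (add_le_add (hA ε hε x hx) ?_)
  rw [abs_mul]
  refine mul_le_mul (hB x hx') ?_ (abs_nonneg _) hB0
  refine (abs_add_le _ _).trans (add_le_add (hL x hx') ?_)
  rw [abs_mul, abs_of_nonneg hκ]
  refine mul_le_mul_of_nonneg_left ?_ hκ
  refine (Finset.abs_sum_le_sum_abs _ _).trans (Finset.sum_le_sum fun p _ => ?_)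
  rw [abs_mul, abs_of_nonneg (by positivity)]
  exact (mul_le_of_le_one_left (abs_nonneg _) (sq_div_sq_add_le_one _ hε)).trans (hR p x hx')

lemma aestronglyMeasurable_greenIntegrand (a : Option (Fin d) → ℝ) (κ ε : ℝ)
    {F : (Fin d → ℝ) → ℝ} (hF : ContDiffOn ℝ 1 F (simplexT d)) (P : MvPolynomial (Fin d) ℝ) :
    AEStronglyMeasurable (greenIntegrand a κ ε F P) (volume.restrict (openSimplex d)) := by
  unfold greenIntegrand
  refine (aestronglyMeasurable_carre κ ε hF (contDiffOn_eval P)).add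
    (hF.aestronglyMeasurable_openSimplex.mul (Measurable.aestronglyMeasurable ?_))
  have h1 : ∀ Q : MvPolynomial (Fin d) ℝ, Measurable fun x : Fin d → ℝ => eval x Q :=
    fun Q => (continuous_eval Q).measurable
  have h2 : ∀ p : OrderedPair d, Measurable (pairDiff p) := fun p => (continuous_pairDiff p).measurable
  unfold localLap
  fun_prop

/-- Every edge term integrates to zero. The remaining flux is odd under a swap while the weight is
even if the exponents a_i agree; in the other case κ = 0 removes it. -/
lemma setIntegral_greenIntegrand_of_pos {a : Option (Fin d) → ℝ} (ha : ∀ k, 0 < a k) {κ ε : ℝ}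
    (hκ : 0 ≤ κ) (hsym : κ = 0 ∨ ∀ i j, a (some i) = a (some j)) (hε : 0 < ε) (hε' : ε ≤ 1)
    {F : (Fin d → ℝ) → ℝ} (hF : ContDiffOn ℝ 1 F (simplexT d)) (P : MvPolynomial (Fin d) ℝ) :
    ∫ x in openSimplex d, greenIntegrand a κ ε F P x * regWeight a κ ε x = 0 := by
  have hedge : ∀ k l, IntegrableOn (edgeDiv a k l (fun y => pairWeight κ ε y *
        (F y * eval y (vertexDeriv k P - vertexDeriv l P)))) (openSimplex d) ∧
      ∫ x in openSimplex d, edgeDiv a k l (fun y => pairWeight κ ε y *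
        (F y * eval y (vertexDeriv k P - vertexDeriv l P))) x = 0 := fun k l =>
    setIntegral_edgeDiv ha k l ((contDiff_pairWeight κ hε).contDiffOn.mul
      (hF.mul (contDiffOn_eval _)))
  have h0 : ∫ x in openSimplex d, 1 / 2 * ∑ k, ∑ l, edgeDiv a k l (fun y => pairWeight κ ε y *
        (F y * eval y (vertexDeriv k P - vertexDeriv l P))) x = 0 := by
    rw [integral_const_mul, integral_finsetSum _ fun k _ =>
      integrable_finsetSum _ fun l _ => (hedge k l).1]
    simp only [integral_finsetSum _ fun l _ => (hedge _ l).1, (hedge _ _).2]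
    simp
  obtain ⟨B, hB0, hB⟩ := hF.exists_bound_simplexT
  have hflux : ∀ p : OrderedPair d, IntegrableOn (fun x => ((2 * (F x * pairFlux ε P p x) -
      (F x - F (swapCoord p.1.1 p.1.2 x)) * pairFlux ε P p x)) * regWeight a κ ε x)
      (openSimplex d) := by
    intro p
    obtain ⟨R, hR⟩ := isCompact_simplexT.exists_bound_of_continuousOn
      (s := simplexT d) (continuous_pairFlux hε P p).continuousOn
    refine integrableOn_mul_regWeight ha hκ hε.le hε' (C := 2 * (B * R) + (B + B) * R) ?_
      fun x hx => ?_
    · have h1 := hF.aestronglyMeasurable_openSimplex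
      have h2 := hF.aestronglyMeasurable_swapCoord p.1.1 p.1.2
      have h3 := (continuous_pairFlux hε P p).aestronglyMeasurable
        (μ := volume.restrict (openSimplex d))
      exact (aestronglyMeasurable_const.mul (h1.mul h3)).sub ((h1.sub h2).mul h3)
    · have e1 := hB x (openSimplex_subset hx)
      have e2 := hB _ (openSimplex_subset (swapCoord_mem_openSimplex hx p.1.1 p.1.2))
      have e3 : |pairFlux ε P p x| ≤ R := hR x (openSimplex_subset hx)
      refine (abs_sub _ _).trans (add_le_add ?_ ?_)
      · rw [abs_mul, abs_mul, abs_two]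
        gcongr
      · rw [abs_mul]
        exact mul_le_mul ((abs_sub _ _).trans (add_le_add e1 e2)) e3 (abs_nonneg _)
          (by positivity)
  obtain ⟨C, hC⟩ := exists_bound_greenIntegrand a hκ hF P
  have hG := integrableOn_mul_regWeight ha hκ hε.le hε'
    (aestronglyMeasurable_greenIntegrand a κ ε hF P) (hC ε hε.le)
  rw [setIntegral_congr_fun measurableSet_openSimplex
    fun x hx => sum_edgeDiv_eq a κ hε hF P hx] at h0
  have h1 : ∀ x, (greenIntegrand a κ ε F P x + κ / 4 * ∑ p : OrderedPair d,
        (2 * (F x * pairFlux ε P p x) - (F x - F (swapCoord p.1.1 p.1.2 x)) * pairFlux ε P p x)) *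
      (pairWeight κ ε x * dirichletDensity a x) = greenIntegrand a κ ε F P x * regWeight a κ ε x +
      κ / 4 * ∑ p : OrderedPair d, ((2 * (F x * pairFlux ε P p x) -
      (F x - F (swapCoord p.1.1 p.1.2 x)) * pairFlux ε P p x)) * regWeight a κ ε x := fun x => by
    rw [← Finset.sum_mul, regWeight]; ring
  simp only [h1] at h0
  rw [integral_add hG ((integrable_finsetSum _ fun p _ => hflux p).const_mul _),
    integral_const_mul, integral_finsetSum _ fun p _ => hflux p] at h0
  rcases hsym with rfl | hsym
  · simpa using h0
  · have h2 : ∀ p : OrderedPair d, ∫ x in openSimplex d, ((2 * (F x * pairFlux ε P p x) -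
      (F x - F (swapCoord p.1.1 p.1.2 x)) * pairFlux ε P p x)) * regWeight a κ ε x = 0 := fun p => by
      refine setIntegral_eq_zero_of_swap_antisymm p.1.1 p.1.2 fun x _ => ?_
      rw [pairFlux_swapCoord, regWeight_swapCoord hsym, swapCoord_swapCoord]
      ring
    simpa [h2] using h0

/-- The subtracted Euler term of each pair adds up to the summand κ·#pairs in λ. -/
lemma greenIntegrand_zero (a : Option (Fin d) → ℝ) (κ : ℝ) (F : (Fin d → ℝ) → ℝ)
    (P : MvPolynomial (Fin d) ℝ) {x : Fin d → ℝ} (hx : x ∈ distinctPts d) :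
    greenIntegrand a κ 0 F P x =
      carre κ 0 F (fun z => eval z P) x + F x * eval x (lapPoly a κ P) := by
  have h : ∀ p : OrderedPair d, pairDiff p x ^ 2 / (pairDiff p x ^ 2 + 0) = 1 := fun p => by
    rw [add_zero, div_self]
    exact pow_ne_zero 2 (sub_ne_zero.2 (hx _ _ (ne_of_lt p.2)))
  rw [greenIntegrand, localLap, lapPoly_apply, lamParam]
  simp only [h, one_mul, Finset.sum_sub_distrib, map_sub, map_add, map_sum, map_mul, eval_X,
    smul_eval, Finset.sum_const, Finset.card_univ, nsmul_eq_mul]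
  ring

/-- Green's identity on the simplex. -/
theorem setIntegral_green {a : Option (Fin d) → ℝ} (ha : ∀ k, 0 < a k) {κ : ℝ}
    (hκ : 0 ≤ κ) (hsym : κ = 0 ∨ ∀ i j, a (some i) = a (some j))
    {F : (Fin d → ℝ) → ℝ} (hF : ContDiffOn ℝ 1 F (simplexT d)) (P : MvPolynomial (Fin d) ℝ) :
    ∫ x in openSimplex d, (carre κ 0 F (fun z => eval z P) x + F x * eval x (lapPoly a κ P)) *
      regWeight a κ 0 x = 0 := by
  obtain ⟨C, hC⟩ := exists_bound_greenIntegrand a hκ hF P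
  set M := Real.exp (κ / 2 * ∑ _p : OrderedPair d, Real.log 2)
  have hdist : ∀ᵐ x ∂volume.restrict (openSimplex d), x ∈ distinctPts d :=
    ae_restrict_of_ae ae_mem_distinctPts
  -- Smoothing by ε = 1/(n + 1) ≤ 1; the bounds on the integrand and on the pair weight are uniform
  -- on [0, 1], so a multiple of the Dirichlet density dominates.
  have hlim := tendsto_integral_of_dominated_convergence
    (μ := volume.restrict (openSimplex d))
    (F := fun (n : ℕ) x => greenIntegrand a κ (1 / ((n : ℝ) + 1)) F P x *
      regWeight a κ (1 / ((n : ℝ) + 1)) x)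
    (f := fun x => greenIntegrand a κ 0 F P x * regWeight a κ 0 x)
    (fun x => C * M * dirichletDensity a x)
    (fun n => (aestronglyMeasurable_greenIntegrand a κ _ hF P).mul
      (measurable_regWeight a κ _).aestronglyMeasurable)
    ((integrableOn_dirichletDensity ha).const_mul _)
    (fun n => (ae_restrict_iff' measurableSet_openSimplex).2 (ae_of_all _ fun x hx => ?_)) ?_
  · have h1 : ∀ n : ℕ, ∫ x in openSimplex d, greenIntegrand a κ (1 / ((n : ℝ) + 1)) F P x *
      regWeight a κ (1 / ((n : ℝ) + 1)) x = 0 := fun n =>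
      setIntegral_greenIntegrand_of_pos ha hκ hsym (by positivity)
        (by rw [div_le_one (by positivity)]; linarith [(Nat.cast_nonneg n : (0 : ℝ) ≤ n)]) hF P
    simp only [h1] at hlim
    have h2 := tendsto_nhds_unique hlim tendsto_const_nhds
    refine Eq.trans (integral_congr_ae ?_) h2
    filter_upwards [hdist] with x hx
    rw [greenIntegrand_zero a κ F P hx]
  · have hn : (0 : ℝ) ≤ 1 / ((n : ℝ) + 1) := by positivity
    have hn' : 1 / ((n : ℝ) + 1) ≤ 1 := by
      rw [div_le_one (by positivity)]; linarith [(Nat.cast_nonneg n : (0 : ℝ) ≤ n)]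
    rw [Real.norm_eq_abs, abs_mul, abs_of_pos (regWeight_pos a κ _ hx), regWeight, ← mul_assoc]
    have h1 := hC _ hn x hx
    have h2 := pairWeight_le hκ hn hn' (openSimplex_subset hx)
    refine mul_le_mul_of_nonneg_right ?_ (dirichletDensity_pos a hx).le
    exact mul_le_mul h1 h2 (pairWeight_pos _ _ _).le ((abs_nonneg _).trans h1)
  · filter_upwards [hdist] with x hx
    have hne : ∀ p : OrderedPair d, pairDiff p x ^ 2 + 0 ≠ 0 := fun p => by
      rw [add_zero]
      exact pow_ne_zero 2 (sub_ne_zero.2 (hx _ _ (ne_of_lt p.2)))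
    have hcont : ContinuousAt (fun ε : ℝ => greenIntegrand a κ ε F P x * regWeight a κ ε x) 0 := by
      unfold greenIntegrand regWeight carre pairWeight
      have h1 : ∀ p : OrderedPair d, ContinuousAt (fun ε : ℝ => pairDiff p x ^ 2 + ε) 0 :=
        fun p => by fun_prop
      refine ContinuousAt.mul (ContinuousAt.add (continuousAt_const.add
        (continuousAt_const.mul (tendsto_finsetSum _ fun p _ => ?_)))
        (continuousAt_const.mul (continuousAt_const.add
          (continuousAt_const.mul (tendsto_finsetSum _ fun p _ => ?_)))))
        (ContinuousAt.mul ?_ continuousAt_const)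
      · exact continuousAt_const.div (h1 p) (hne p)
      · exact (continuousAt_const.div (h1 p) (hne p)).mul continuousAt_const
      · refine Real.continuous_exp.continuousAt.comp
          (continuousAt_const.mul (tendsto_finsetSum _ fun p _ => ?_))
        exact (h1 p).log (hne p)
    exact hcont.tendsto.comp tendsto_one_div_add_atTop_nhds_zero_nat

end Green

/-! ### The measure `W^T`, the energy form and the radial inequality. -/

section WeightMeasure

open Set Filter Topology MvPolynomial

variable {d : ℕ}

namespace SimplexWeight

variable (w : SimplexWeight d)

lemma expo_pos (k : Option (Fin d)) : 0 < w.expo k := by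
  cases w <;> cases k <;> simp only [expo, Option.elim] <;> positivity

lemma pairExpo_nonneg : 0 ≤ w.pairExpo := by
  cases w <;> simp [pairExpo]

lemma pairExpo_eq_zero_or : w.pairExpo = 0 ∨ ∀ i j, w.expo (some i) = w.expo (some j) := by
  cases w with
  | signChange κ => exact Or.inl rfl
  | hyperoctahedral κ' κ μ => exact Or.inr fun i j => rfl

lemma pairWeight_zero (κ : ℝ) {x : Fin d → ℝ} (hx : x ∈ distinctPts d) :
    pairWeight κ 0 x = ∏ p : OrderedPair d, |x p.1.1 - x p.1.2| ^ κ := by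
  rw [pairWeight, Finset.mul_sum, Real.exp_sum]
  refine Finset.prod_congr rfl fun p _ => ?_
  have h : 0 < |x p.1.1 - x p.1.2| := abs_pos.2 (sub_ne_zero.2 (hx _ _ (ne_of_lt p.2)))
  rw [Real.rpow_def_of_pos h, add_zero, pairDiff, Real.log_pow, Real.log_abs]
  congr 1
  push_cast
  ring

lemma weight_eq {x : Fin d → ℝ} (hx : x ∈ openSimplex d) (hx' : x ∈ distinctPts d) :
    w.weight x = regWeight w.expo w.pairExpo 0 x := by
  have hs : ∑ i, |x i| = ∑ i, x i := Finset.sum_congr rfl fun i _ => abs_of_pos (hx (some i))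
  rw [regWeight, pairWeight_zero _ hx', dirichletDensity, Fintype.prod_option]
  cases w with
  | signChange κ =>
    simp only [weight, expo, pairExpo, hs, bary_none, bary_some, Option.elim, Real.rpow_zero,
      Finset.prod_const_one, one_mul]
    rw [mul_comm]
    congr 1
    · congr 1; ring
    · refine Finset.prod_congr rfl fun i _ => ?_
      congr 1; ring
  | hyperoctahedral κ' κ μ =>
    simp only [weight, expo, pairExpo, hs, bary_none, bary_some, Option.elim]
    rw [show (μ : ℝ) + 1 / 2 - 1 = μ - 1 / 2 by ring,
      show (κ' : ℝ) + 1 / 2 - 1 = κ' - 1 / 2 by ring]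
    ring

lemma measure_eq : w.measure = (volume.restrict (openSimplex d)).withDensity
    fun x => ENNReal.ofReal (regWeight w.expo w.pairExpo 0 x) := by
  rw [SimplexWeight.measure, restrict_simplexT]
  refine withDensity_congr_ae ?_
  have h : ∀ᵐ x ∂volume.restrict (openSimplex d), x ∈ distinctPts d :=
    ae_restrict_of_ae ae_mem_distinctPts
  filter_upwards [h, ae_restrict_mem measurableSet_openSimplex] with x h1 h2
  rw [w.weight_eq h2 h1]

lemma measure_absolutelyContinuous : w.measure ≪ volume.restrict (openSimplex d) := by
  rw [measure_eq]
  exact withDensity_absolutelyContinuous _ _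

lemma absolutelyContinuous_measure : volume.restrict (openSimplex d) ≪ w.measure := by
  rw [measure_eq]
  refine withDensity_absolutelyContinuous' (measurable_regWeight _ _ _).ennreal_ofReal.aemeasurable
    ?_
  filter_upwards [ae_restrict_mem measurableSet_openSimplex] with x hx
  exact (ENNReal.ofReal_pos.2 (regWeight_pos _ _ _ hx)).ne'

lemma ae_mem_openSimplex : ∀ᵐ x ∂w.measure, x ∈ openSimplex d :=
  w.measure_absolutelyContinuous.ae_le (ae_restrict_mem measurableSet_openSimplex)

instance isFiniteMeasure_measure : IsFiniteMeasure w.measure := by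
  rw [measure_eq]
  refine isFiniteMeasure_withDensity_ofReal ?_
  have := integrableOn_mul_regWeight w.expo_pos w.pairExpo_nonneg le_rfl zero_le_one
    (g := fun _ => 1) (C := 1) aestronglyMeasurable_const (fun x _ => by simp)
  simp only [one_mul] at this
  exact this.2

lemma integral_measure (g : (Fin d → ℝ) → ℝ) : ∫ x, g x ∂w.measure =
    ∫ x in openSimplex d, g x * regWeight w.expo w.pairExpo 0 x := by
  rw [measure_eq, integral_withDensity_eq_integral_toReal_smul
    (measurable_regWeight _ _ _).ennreal_ofReal (ae_of_all _ fun _ => ENNReal.ofReal_lt_top)]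
  refine setIntegral_congr_fun measurableSet_openSimplex fun x hx => ?_
  simp only [smul_eq_mul]
  rw [ENNReal.toReal_ofReal (regWeight_pos _ _ _ hx).le, mul_comm]

lemma integrable_of_bound {g : (Fin d → ℝ) → ℝ}
    (hg : AEStronglyMeasurable g (volume.restrict (openSimplex d))) {C : ℝ}
    (hC : ∀ x ∈ openSimplex d, |g x| ≤ C) : Integrable g w.measure :=
  Integrable.of_bound (hg.mono_ac w.measure_absolutelyContinuous) C
    (w.ae_mem_openSimplex.mono hC)

lemma memLp_of_contDiffOn {F : (Fin d → ℝ) → ℝ} (hF : ContDiffOn ℝ 1 F (simplexT d)) :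
    MemLp F 2 w.measure := by
  obtain ⟨C, -, hC⟩ := hF.exists_bound_simplexT
  exact MemLp.of_bound (hF.aestronglyMeasurable_openSimplex.mono_ac w.measure_absolutelyContinuous)
    C (w.ae_mem_openSimplex.mono fun x hx => hC x (openSimplex_subset hx))

lemma memLp_eval (P : MvPolynomial (Fin d) ℝ) : MemLp (fun x => eval x P) 2 w.measure :=
  w.memLp_of_contDiffOn (contDiffOn_eval P)

lemma integrable_carre {F G : (Fin d → ℝ) → ℝ} (hF : ContDiffOn ℝ 1 F (simplexT d))
    (hG : ContDiffOn ℝ 1 G (simplexT d)) : Integrable (carre w.pairExpo 0 F G) w.measure := by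
  obtain ⟨C, hC⟩ := exists_bound_carre w.pairExpo_nonneg hF hG
  exact w.integrable_of_bound (aestronglyMeasurable_carre _ _ hF hG) (hC 0 le_rfl)

/-- The energy form of `-Δ^T`. -/
noncomputable def energy (F G : (Fin d → ℝ) → ℝ) : ℝ :=
  ∫ x, carre w.pairExpo 0 F G x ∂w.measure

/-- The operator `Δ^T` on polynomials. -/
noncomputable def polyLap : MvPolynomial (Fin d) ℝ →ₗ[ℝ] MvPolynomial (Fin d) ℝ :=
  lapPoly w.expo w.pairExpo

/-- All second derivatives fall on the polynomial, so F need only be of class C¹. -/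
lemma energy_eval {F : (Fin d → ℝ) → ℝ} (hF : ContDiffOn ℝ 1 F (simplexT d))
    (P : MvPolynomial (Fin d) ℝ) : w.energy F (fun z => eval z P) =
      -∫ x, F x * eval x (w.polyLap P) ∂w.measure := by
  have h := setIntegral_green w.expo_pos w.pairExpo_nonneg w.pairExpo_eq_zero_or hF P
  rw [← w.integral_measure, integral_add (w.integrable_carre hF (contDiffOn_eval P))] at h
  · rw [energy, polyLap]; linarith
  · exact (w.memLp_of_contDiffOn hF).integrable_mul (w.memLp_eval _)

lemma energy_self_nonneg (F : (Fin d → ℝ) → ℝ) : 0 ≤ w.energy F F :=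
  integral_nonneg_of_ae (w.ae_mem_openSimplex.mono fun _ hx =>
    carre_self_nonneg w.pairExpo_nonneg le_rfl F hx)

lemma energy_comm (F G : (Fin d → ℝ) → ℝ) : w.energy F G = w.energy G F :=
  integral_congr_ae (ae_of_all _ fun x => carre_comm _ _ F G x)

lemma two_mul_energy_le {F G : (Fin d → ℝ) → ℝ} (hF : ContDiffOn ℝ 1 F (simplexT d))
    (hG : ContDiffOn ℝ 1 G (simplexT d)) :
    2 * w.energy F G ≤ w.energy F F + w.energy G G := by
  have h := w.energy_self_nonneg fun y => F y - G y
  have h1 : w.energy (fun y => F y - G y) (fun y => F y - G y) =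
      w.energy F F - 2 * w.energy F G + w.energy G G := by
    have hi : Integrable (fun x => carre w.pairExpo 0 F F x - 2 * carre w.pairExpo 0 F G x)
        w.measure := (w.integrable_carre hF hF).sub ((w.integrable_carre hF hG).const_mul 2)
    unfold energy
    rw [← integral_const_mul, ← integral_sub (w.integrable_carre hF hF)
      ((w.integrable_carre hF hG).const_mul 2), ← integral_add hi (w.integrable_carre hG hG)]
    exact integral_congr_ae (w.ae_mem_openSimplex.mono fun x hx => carre_sub_sub _ _ hF hG hx)
  linarith

/-- Continuity upgrades the vanishing to all of the open simplex, which contains a box with infinite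
sides. -/
lemma eq_zero_of_eval_ae_eq_zero {P : MvPolynomial (Fin d) ℝ}
    (h : ∀ᵐ x ∂volume.restrict (openSimplex d), eval x P = 0) : P = 0 := by
  have h1 : EqOn (fun x => eval x P) (fun _ => 0) (openSimplex d) :=
    Measure.eqOn_open_of_ae_eq h isOpen_openSimplex (continuous_eval P).continuousOn
      continuousOn_const
  obtain ⟨x, hx⟩ := openSimplex_nonempty (d := d)
  obtain ⟨ε, hε, hball⟩ := Metric.isOpen_iff.1 isOpen_openSimplex x hx
  refine funext_set (fun i => Ioo (x i - ε) (x i + ε)) (fun i => Ioo_infinite (by linarith))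
    fun y hy => ?_
  rw [map_zero]
  refine h1 (hball ?_)
  rw [Metric.mem_ball, dist_pi_lt_iff hε]
  intro i
  have := hy i (mem_univ i)
  rw [Real.dist_eq, abs_lt]
  constructor <;> linarith [this.1, this.2]

lemma ae_laplacian_eval_eq (P : MvPolynomial (Fin d) ℝ) :
    ∀ᵐ x ∂volume.restrict (simplexT d),
      w.laplacian (fun z => eval z P) x = eval x (w.polyLap P) := by
  rw [restrict_simplexT]
  have h : ∀ᵐ x ∂volume.restrict (openSimplex d), x ∈ distinctPts d :=
    ae_restrict_of_ae ae_mem_distinctPts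
  filter_upwards [h, ae_restrict_mem measurableSet_openSimplex] with x h1 h2
  exact w.laplacian_eval P (fun i => h2 (some i)) h1

/-- Makes the condition on test eigenfunctions purely algebraic. -/
lemma ae_laplacian_eigen_iff (P : MvPolynomial (Fin d) ℝ) (ν : ℝ) :
    (∀ᵐ x ∂volume.restrict (simplexT d),
        -w.laplacian (fun z => eval z P) x = ν * eval x P) ↔ -w.polyLap P = ν • P := by
  constructor
  · intro h
    rw [← sub_eq_zero]
    refine eq_zero_of_eval_ae_eq_zero ?_
    rw [← restrict_simplexT]
    filter_upwards [h, w.ae_laplacian_eval_eq P] with x h1 h2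
    rw [h2] at h1
    rw [map_sub, map_neg, smul_eval, h1, sub_self]
  · intro h
    filter_upwards [w.ae_laplacian_eval_eq P] with x h2
    have := congrArg (eval x) h
    rw [map_neg, smul_eval] at this
    rw [h2, this]

/-- The radial polynomial `∑ X_i`. -/
noncomputable def radialPoly (d : ℕ) : MvPolynomial (Fin d) ℝ := ∑ i, X i

lemma pderiv_radialPoly (i : Fin d) : pderiv i (radialPoly d) = 1 := by
  rw [radialPoly, map_sum, Finset.sum_eq_single i]
  · exact pderiv_X_self i
  · intro j _ hj; exact pderiv_X_of_ne hj
  · simp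

lemma eulerPoly_radialPoly : eulerPoly d (radialPoly d) = radialPoly d := by
  rw [eulerPoly_apply]
  simp [pderiv_radialPoly]
  rfl

lemma rename_radialPoly (σ : Equiv.Perm (Fin d)) :
    rename σ (radialPoly d) = radialPoly d := by
  rw [radialPoly, map_sum]
  simp only [rename_X]
  exact Equiv.sum_comp σ fun i => X i

lemma pairTerm_radialPoly (p : OrderedPair d) : pairTerm p (radialPoly d) = 1 := by
  apply mul_left_cancel₀ (X_sub_X_sq_ne_zero p)
  rw [sq_mul_pairTerm, pairNum_apply, pderiv_radialPoly, pderiv_radialPoly, rename_radialPoly]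
  ring

lemma eval_radialPoly (x : Fin d → ℝ) : eval x (radialPoly d) = 1 - bary none x := by
  simp [radialPoly]

/-- On the face 1 - |x| = 0 the value is the strictly negative constant `-w.expo none`. This is why
mass cannot concentrate there without a large energy. -/
lemma eval_polyLap_radialPoly (x : Fin d → ℝ) : eval x (w.polyLap (radialPoly d)) =
    (lamParam w.expo w.pairExpo + 1) * bary none x - w.expo none := by
  rw [polyLap, lapPoly_apply]
  simp only [pderiv_radialPoly, pairTerm_radialPoly, eulerPoly_radialPoly, map_sub, map_add,
    map_sum, map_mul, smul_eval, eval_radialPoly, map_one]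
  simp [lamParam, Fintype.sum_option]
  ring

/-- |x| is invariant under swaps, so the nonlocal part drops; the covariance formula leaves E(P²) -
|x| E(P²). -/
lemma carre_sq_radialPoly (κ : ℝ) (P : MvPolynomial (Fin d) ℝ) (x : Fin d → ℝ) :
    carre κ 0 (fun z => eval z (P ^ 2)) (fun z => eval z (radialPoly d)) x =
      2 * (bary none x * (eval x P * eval x (eulerPoly d P))) := by
  unfold carre
  simp only [eval_swapCoord, rename_radialPoly, sub_self, mul_zero, zero_div,
    Finset.sum_const_zero, add_zero, fderiv_eval_baryEdge]
  rw [sum_polarization (fun k => bary k x) (fun k => eval x (vertexDeriv k (P ^ 2)))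
    (fun k => eval x (vertexDeriv k (radialPoly d))) (sum_bary x), sum_bary_mul_vertexDeriv,
    sum_bary_mul_vertexDeriv, eulerPoly_radialPoly, eval_radialPoly]
  have h : ∑ k, bary k x * (eval x (vertexDeriv k (P ^ 2)) *
      eval x (vertexDeriv k (radialPoly d))) = eval x (eulerPoly d (P ^ 2)) := by
    simp [Fintype.sum_option, pderiv_radialPoly, eval_eulerPoly]
  have h2 : eval x (eulerPoly d (P ^ 2)) = 2 * eval x P * eval x (eulerPoly d P) := by
    rw [eval_eulerPoly, eval_eulerPoly, Finset.mul_sum]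
    refine Finset.sum_congr rfl fun i _ => ?_
    rw [pderiv_pow]
    simp
    ring
  rw [h, h2]
  ring

/-- The local part is S - (EP)² with S = ∑ x_i (∂_i P)². Cauchy-Schwarz gives (EP)² ≤ (1 - t) S, and
(1 + t)(1 - t) ≤ 1 gives (1 + t)(EP)² ≤ S. -/
lemma bary_mul_sq_eulerPoly_le_carre {κ : ℝ} (hκ : 0 ≤ κ) (P : MvPolynomial (Fin d) ℝ)
    {x : Fin d → ℝ} (hx : x ∈ openSimplex d) :
    bary none x * eval x (eulerPoly d P) ^ 2 ≤
      carre κ 0 (fun z => eval z P) (fun z => eval z P) x := by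
  unfold carre
  simp only [fderiv_eval_baryEdge]
  rw [sum_polarization (fun k => bary k x) (fun k => eval x (vertexDeriv k P))
    (fun k => eval x (vertexDeriv k P)) (sum_bary x), sum_bary_mul_vertexDeriv]
  have h1 : ∑ k, bary k x * (eval x (vertexDeriv k P) * eval x (vertexDeriv k P)) =
      ∑ i, x i * eval x (pderiv i P) ^ 2 := by
    simp [Fintype.sum_option, sq]
  have h2 : eval x (eulerPoly d P) ^ 2 ≤ (∑ i, x i) * ∑ i, x i * eval x (pderiv i P) ^ 2 := by
    rw [eval_eulerPoly]
    refine Finset.sum_sq_le_sum_mul_sum_of_sq_le_mul _ (fun i _ => (hx (some i)).le)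
      (fun i _ => mul_nonneg (hx (some i)).le (sq_nonneg _)) fun i _ => le_of_eq (by ring)
  have h3 : 0 ≤ κ / 4 * ∑ p : OrderedPair d, (x p.1.1 + x p.1.2) *
      ((eval x P - eval (swapCoord p.1.1 p.1.2 x) P) *
        (eval x P - eval (swapCoord p.1.1 p.1.2 x) P)) / (pairDiff p x ^ 2 + 0) := by
    refine mul_nonneg (by positivity) (Finset.sum_nonneg fun p _ => ?_)
    have e1 := (hx (some p.1.1)).le
    have e2 := (hx (some p.1.2)).le
    simp only [bary_some] at e1 e2
    exact div_nonneg (mul_nonneg (add_nonneg e1 e2) (mul_self_nonneg _)) (by positivity)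
  have h4 : 0 ≤ ∑ i, x i * eval x (pderiv i P) ^ 2 :=
    Finset.sum_nonneg fun i _ => mul_nonneg (hx (some i)).le (sq_nonneg _)
  have h5 : ∑ i, x i = 1 - bary none x := by simp
  have h6 := hx none
  rw [h5] at h2
  rw [h1]
  set S := ∑ i, x i * eval x (pderiv i P) ^ 2
  set E := eval x (eulerPoly d P)
  set t := bary none x
  have h7 : (1 + t) * E ^ 2 ≤ S := by
    calc (1 + t) * E ^ 2 ≤ (1 + t) * ((1 - t) * S) := by gcongr
      _ = S - t ^ 2 * S := by ring
      _ ≤ S := by nlinarith [mul_nonneg (sq_nonneg t) h4]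
  nlinarith

/-- The radial inequality behind the uncertainty principle, for polynomials. -/
theorem radial_inequality (P : MvPolynomial (Fin d) ℝ) {s : ℝ} (hs : 0 < s) :
    w.expo none * ∫ x, eval x P ^ 2 ∂w.measure ≤
      (lamParam w.expo w.pairExpo + 1 + s) * ∫ x, bary none x * eval x P ^ 2 ∂w.measure +
        s⁻¹ * w.energy (fun z => eval z P) (fun z => eval z P) := by
  -- Green's identity for P² against |x|.
  have h := w.energy_eval (contDiffOn_eval (P ^ 2)) (radialPoly d)
  rw [energy] at h
  simp only [carre_sq_radialPoly, eval_polyLap_radialPoly] at h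
  simp only [map_pow] at h
  have hcont : ∀ g : (Fin d → ℝ) → ℝ, Continuous g → Integrable g w.measure := fun g hg => by
    obtain ⟨C, hC⟩ := isCompact_simplexT.exists_bound_of_continuousOn
      (s := simplexT d) hg.continuousOn
    exact w.integrable_of_bound hg.aestronglyMeasurable fun x hx => hC x (openSimplex_subset hx)
  have c1 := continuous_eval P
  have c2 := continuous_eval (eulerPoly d P)
  have i1 : Integrable (fun x => eval x P ^ 2) w.measure := hcont _ (by fun_prop)
  have i2 : Integrable (fun x => bary none x * eval x P ^ 2) w.measure := hcont _ (by fun_prop)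
  have i3 : Integrable (fun x => 2 * (bary none x * (eval x P * eval x (eulerPoly d P))))
    w.measure := hcont _ (by fun_prop)
  have h1 : ∫ x, eval x P ^ 2 * ((lamParam w.expo w.pairExpo + 1) * bary none x - w.expo none)
      ∂w.measure = (lamParam w.expo w.pairExpo + 1) * (∫ x, bary none x * eval x P ^ 2 ∂w.measure)
        - w.expo none * ∫ x, eval x P ^ 2 ∂w.measure := by
    rw [← integral_const_mul, ← integral_const_mul, ← integral_sub (i2.const_mul _)
      (i1.const_mul _)]
    exact integral_congr_ae (ae_of_all _ fun x => by ring)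
  have i4 := w.integrable_carre (contDiffOn_eval P) (contDiffOn_eval P)
  have h2 : ∫ x, 2 * (bary none x * (eval x P * eval x (eulerPoly d P))) ∂w.measure ≤
      s * (∫ x, bary none x * eval x P ^ 2 ∂w.measure) +
        s⁻¹ * w.energy (fun z => eval z P) (fun z => eval z P) := by
    rw [energy, ← integral_const_mul, ← integral_const_mul, ← integral_add (i2.const_mul _)
      (i4.const_mul _)]
    refine integral_mono_ae i3 ((i2.const_mul _).add (i4.const_mul _)) ?_
    filter_upwards [w.ae_mem_openSimplex] with x hx
    have e1 := bary_mul_sq_eulerPoly_le_carre w.pairExpo_nonneg P hx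
    have e2 := mul_le_mul_of_nonneg_left e1 (inv_pos.2 hs).le
    -- The completed square behind 2 P·EP ≤ s P² + s⁻¹ (EP)².
    have e3 : 0 ≤ bary none x * s⁻¹ * (s * eval x P - eval x (eulerPoly d P)) ^ 2 :=
      mul_nonneg (mul_nonneg (hx none).le (inv_pos.2 hs).le) (sq_nonneg _)
    have e4 : bary none x * s⁻¹ * (s * eval x P - eval x (eulerPoly d P)) ^ 2 =
        s * (bary none x * eval x P ^ 2) + s⁻¹ * (bary none x * eval x (eulerPoly d P) ^ 2) -
          2 * (bary none x * (eval x P * eval x (eulerPoly d P))) := by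
      field_simp
      ring
    linarith
  rw [h1] at h
  rw [h] at h2
  linarith

end SimplexWeight

end WeightMeasure

/-! ### Spectral theory of a symmetric operator triangular on a filtration. -/

section EigenFiltration

open Filter Topology
open scoped InnerProductSpace

/-- A symmetric operator on a space `E`, densely embedded in an inner product space `H`, that acts
on the `n`-th quotient of a filtration by finite dimensional subspaces as the scalar `eig n`. -/
structure EigenFiltration (E H : Type*) [AddCommGroup E] [Module ℝ E] [NormedAddCommGroup H]
    [InnerProductSpace ℝ H] where
  /-- The embedding. -/
  toH : E →ₗ[ℝ] H
  /-- The operator. -/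
  op : E →ₗ[ℝ] E
  /-- The filtration. -/
  filt : ℕ → Submodule ℝ E
  /-- The eigenvalues. -/
  eig : ℕ → ℝ
  injective : Function.Injective toH
  dense : DenseRange toH
  filt_zero : filt 0 = ⊥
  mono : Monotone filt
  finiteDimensional : ∀ n, FiniteDimensional ℝ (filt n)
  exists_mem : ∀ P, ∃ n, P ∈ filt n
  op_sub_smul_mem : ∀ n P, P ∈ filt (n + 1) → op P - eig n • P ∈ filt n
  symm : ∀ P Q, ⟪toH (op P), toH Q⟫_ℝ = ⟪toH P, toH (op Q)⟫_ℝ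
  eig_nonneg : ∀ n, 0 ≤ eig n

namespace EigenFiltration

variable {E H : Type*} [AddCommGroup E] [Module ℝ E] [NormedAddCommGroup H]
    [InnerProductSpace ℝ H] (S : EigenFiltration E H)

instance (n : ℕ) : FiniteDimensional ℝ (S.filt n) := S.finiteDimensional n

lemma op_mem {n : ℕ} {P : E} (hP : P ∈ S.filt n) : S.op P ∈ S.filt n := by
  cases n with
  | zero =>
    rw [S.filt_zero, Submodule.mem_bot] at hP ⊢
    rw [hP, map_zero]
  | succ n =>
    have h := S.mono n.le_succ (S.op_sub_smul_mem n P hP)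
    simpa using add_mem h (Submodule.smul_mem _ (S.eig n) hP)

/-- The vector op Q - eig n • Q lies in `filt n` by triangularity and is orthogonal to `filt n` by
symmetry, hence is zero. -/
lemma op_eq_smul {n : ℕ} {Q : E} (hQ : Q ∈ S.filt (n + 1))
    (h : ∀ R ∈ S.filt n, ⟪S.toH Q, S.toH R⟫_ℝ = 0) : S.op Q = S.eig n • Q := by
  rw [← sub_eq_zero]
  apply S.injective
  rw [map_zero, ← inner_self_eq_zero (𝕜 := ℝ)]
  have hR := S.op_sub_smul_mem n Q hQ
  have h1 : ∀ v, ⟪S.toH (S.op Q - S.eig n • Q), v⟫_ℝ =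
      ⟪S.toH (S.op Q), v⟫_ℝ - S.eig n * ⟪S.toH Q, v⟫_ℝ := fun v => by
    rw [map_sub, map_smul, inner_sub_left, real_inner_smul_left]
  rw [h1, S.symm, h _ (S.op_mem hR), h _ hR, mul_zero, sub_zero]

lemma exists_approx (h : H) (n : ℕ) : ∃ P ∈ S.filt n,
    S.toH P = ((S.filt n).map S.toH).starProjection h :=
  Submodule.mem_map.1 (((S.filt n).map S.toH).starProjection_apply_mem h)

/-- The orthogonal projection of `h` to the `n`-th space of the filtration. -/
noncomputable def approx (h : H) (n : ℕ) : E := (S.exists_approx h n).choose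

lemma approx_mem (h : H) (n : ℕ) : S.approx h n ∈ S.filt n := (S.exists_approx h n).choose_spec.1

lemma toH_approx (h : H) (n : ℕ) :
    S.toH (S.approx h n) = ((S.filt n).map S.toH).starProjection h :=
  (S.exists_approx h n).choose_spec.2

lemma inner_approx (h : H) {n : ℕ} {R : E} (hR : R ∈ S.filt n) :
    ⟪S.toH (S.approx h n), S.toH R⟫_ℝ = ⟪h, S.toH R⟫_ℝ := by
  rw [← sub_eq_zero, ← inner_sub_left, ← neg_eq_zero, ← inner_neg_left, neg_sub, toH_approx]
  exact Submodule.starProjection_inner_eq_zero _ _ (Submodule.mem_map_of_mem hR)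

lemma tendsto_toH_approx [CompleteSpace H] (h : H) :
    Tendsto (fun n => S.toH (S.approx h n)) atTop (𝓝 h) := by
  simp only [toH_approx]
  refine Submodule.starProjection_tendsto_self (fun n => (S.filt n).map S.toH)
    (fun m n hmn => Submodule.map_mono (S.mono hmn)) h fun x _ => ?_
  have hx : x ∈ closure (Set.range S.toH) := S.dense x
  refine closure_mono ?_ hx
  rintro _ ⟨P, rfl⟩
  obtain ⟨n, hn⟩ := S.exists_mem P
  exact Submodule.mem_iSup_of_mem n (Submodule.mem_map_of_mem hn)

/-- The component of `h` in the `n`-th eigenspace. -/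
noncomputable def comp (h : H) (n : ℕ) : E := S.approx h (n + 1) - S.approx h n

lemma comp_mem (h : H) (n : ℕ) : S.comp h n ∈ S.filt (n + 1) :=
  sub_mem (S.approx_mem h _) (S.mono n.le_succ (S.approx_mem h _))

lemma inner_comp (h : H) {n : ℕ} {R : E} (hR : R ∈ S.filt n) :
    ⟪S.toH (S.comp h n), S.toH R⟫_ℝ = 0 := by
  rw [comp, map_sub, inner_sub_left, S.inner_approx h hR, S.inner_approx h (S.mono n.le_succ hR),
    sub_self]

lemma op_comp (h : H) (n : ℕ) : S.op (S.comp h n) = S.eig n • S.comp h n :=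
  S.op_eq_smul (S.comp_mem h n) fun _ hR => S.inner_comp h hR

lemma inner_comp_comp (h : H) {m n : ℕ} (hmn : m ≠ n) :
    ⟪S.toH (S.comp h m), S.toH (S.comp h n)⟫_ℝ = 0 := by
  rcases lt_or_gt_of_ne hmn with h1 | h1
  · rw [real_inner_comm]
    exact S.inner_comp h (S.mono h1 (S.comp_mem h m))
  · exact S.inner_comp h (S.mono h1 (S.comp_mem h n))

lemma inner_left_comp (h : H) (n : ℕ) :
    ⟪h, S.toH (S.comp h n)⟫_ℝ = ⟪S.toH (S.comp h n), S.toH (S.comp h n)⟫_ℝ := by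
  rw [← S.inner_approx h (S.comp_mem h n), ← sub_eq_zero, ← inner_sub_left, ← map_sub, comp,
    sub_sub_cancel, real_inner_comm]
  exact S.inner_comp h (S.approx_mem h n)

lemma sum_comp (h : H) (N : ℕ) : ∑ n ∈ Finset.range N, S.comp h n = S.approx h N := by
  have h0 : S.approx h 0 = 0 := by
    have := S.approx_mem h 0
    rwa [S.filt_zero, Submodule.mem_bot] at this
  simp only [comp]
  rw [Finset.sum_range_sub, h0, sub_zero]

lemma inner_sum_comp (h : H) (b c : ℕ → ℝ) {M N : ℕ} (hMN : N ≤ M) :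
    ⟪S.toH (∑ n ∈ Finset.range M, b n • S.comp h n),
      S.toH (∑ n ∈ Finset.range N, c n • S.comp h n)⟫_ℝ =
      ∑ n ∈ Finset.range N, b n * c n * ⟪S.toH (S.comp h n), S.toH (S.comp h n)⟫_ℝ := by
  simp only [map_sum, map_smul, sum_inner, inner_sum, real_inner_smul_left, real_inner_smul_right]
  refine Finset.sum_congr rfl fun n hn => ?_
  rw [Finset.sum_eq_single n]
  · ring
  · intro m _ hm
    rw [S.inner_comp_comp h hm, mul_zero, mul_zero]
  · intro h1
    exact absurd (Finset.mem_range.2 ((Finset.mem_range.1 hn).trans_le hMN)) h1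

/-- The image of `approx h N` under the square root of the operator. -/
noncomputable def sqrtApprox (h : H) (N : ℕ) : E :=
  ∑ n ∈ Finset.range N, √(S.eig n) • S.comp h n

lemma inner_sqrtApprox (h : H) {M N : ℕ} (hMN : N ≤ M) :
    ⟪S.toH (S.sqrtApprox h M), S.toH (S.sqrtApprox h N)⟫_ℝ =
      ∑ n ∈ Finset.range N, S.eig n * ⟪S.toH (S.comp h n), S.toH (S.comp h n)⟫_ℝ := by
  rw [sqrtApprox, sqrtApprox, S.inner_sum_comp h _ _ hMN]
  exact Finset.sum_congr rfl fun n _ => by rw [Real.mul_self_sqrt (S.eig_nonneg n)]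

lemma inner_op_approx (h : H) (N : ℕ) :
    ⟪S.toH (S.op (S.approx h N)), S.toH (S.approx h N)⟫_ℝ =
      ⟪S.toH (S.sqrtApprox h N), S.toH (S.sqrtApprox h N)⟫_ℝ := by
  have := S.inner_sum_comp h S.eig (fun _ => 1) (le_refl N)
  simp only [one_smul, sum_comp, mul_one] at this
  rw [S.inner_sqrtApprox h le_rfl, ← this, ← S.sum_comp h N, map_sum]
  simp only [op_comp]

lemma inner_approx_self (h : H) (N : ℕ) :
    ⟪S.toH (S.approx h N), S.toH (S.approx h N)⟫_ℝ =
      ∑ n ∈ Finset.range N, ⟪S.toH (S.comp h n), S.toH (S.comp h n)⟫_ℝ := by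
  have := S.inner_sum_comp h (fun _ => 1) (fun _ => 1) (le_refl N)
  simpa only [one_smul, sum_comp, mul_one, one_mul] using this

/-- `g` is the image of `f` under the square root of the operator. -/
def IsSqrt (f g : H) : Prop := ∀ (P : E) (ν : ℝ), S.op P = ν • P →
  ⟪g, S.toH P⟫_ℝ = √ν * ⟪f, S.toH P⟫_ℝ

variable {S}

/-- With v the truncated square root of f, ‖v‖² = ⟨g, v⟩ ≤ ‖g‖ ‖v‖: the components of f are
eigenvectors, on which g is prescribed. -/
lemma IsSqrt.inner_op_approx_le {f g : H} (h : S.IsSqrt f g) (N : ℕ) :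
    ⟪S.toH (S.op (S.approx f N)), S.toH (S.approx f N)⟫_ℝ ≤ ‖g‖ ^ 2 := by
  rw [inner_op_approx]
  have h1 : ⟪S.toH (S.sqrtApprox f N), S.toH (S.sqrtApprox f N)⟫_ℝ =
      ⟪g, S.toH (S.sqrtApprox f N)⟫_ℝ := by
    rw [S.inner_sqrtApprox f le_rfl, sqrtApprox]
    simp only [map_sum, map_smul, inner_sum, real_inner_smul_right]
    refine Finset.sum_congr rfl fun n _ => ?_
    rw [h _ _ (S.op_comp f n), S.inner_left_comp, ← mul_assoc, Real.mul_self_sqrt (S.eig_nonneg n)]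
  have h2 := real_inner_le_norm g (S.toH (S.sqrtApprox f N))
  rw [← h1, real_inner_self_eq_norm_sq] at h2
  rw [real_inner_self_eq_norm_sq]
  nlinarith [sq_nonneg (‖g‖ - ‖S.toH (S.sqrtApprox f N)‖)]

/-- Orthogonality to `filt 1` kills the component of index 0; the others have eigenvalue at least c,
and the truncations converge to f. -/
lemma IsSqrt.gap [CompleteSpace H] {f g : H} (h : S.IsSqrt f g)
    (h0 : ∀ R ∈ S.filt 1, ⟪f, S.toH R⟫_ℝ = 0) {c : ℝ} (hc : ∀ n, 1 ≤ n → c ≤ S.eig n) :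
    c * ‖f‖ ^ 2 ≤ ‖g‖ ^ 2 := by
  have h1 : ∀ N, c * ‖S.toH (S.approx f N)‖ ^ 2 ≤ ‖g‖ ^ 2 := by
    intro N
    refine le_trans ?_ (h.inner_op_approx_le N)
    rw [inner_op_approx, S.inner_sqrtApprox f le_rfl, ← real_inner_self_eq_norm_sq,
      S.inner_approx_self, Finset.mul_sum]
    refine Finset.sum_le_sum fun n _ => ?_
    rcases Nat.eq_zero_or_pos n with rfl | hn
    · rw [← S.inner_left_comp, h0 _ (S.comp_mem f 0), mul_zero, mul_zero]
    · exact mul_le_mul_of_nonneg_right (hc n hn) real_inner_self_nonneg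
  exact le_of_tendsto' (((S.tendsto_toH_approx f).norm.pow 2).const_mul c) h1

variable (S)

/-- The squared norms of the truncated square roots increase and are bounded by B; by orthogonality
of the components the truncations form a Cauchy sequence, whose limit is g. -/
lemma exists_isSqrt [CompleteSpace H] {f : H} {B : ℝ}
    (hB : ∀ N, ⟪S.toH (S.op (S.approx f N)), S.toH (S.approx f N)⟫_ℝ ≤ B) :
    ∃ g, S.IsSqrt f g := by
  set a : ℕ → ℝ := fun N =>
    ∑ n ∈ Finset.range N, S.eig n * ⟪S.toH (S.comp f n), S.toH (S.comp f n)⟫_ℝ with ha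
  have hmono : Monotone a := monotone_nat_of_le_succ fun n => by
    simp only [ha, Finset.sum_range_succ]
    exact le_add_of_nonneg_right (mul_nonneg (S.eig_nonneg n) real_inner_self_nonneg)
  have hbdd : BddAbove (Set.range a) := ⟨B, by
    rintro _ ⟨N, rfl⟩
    have := hB N
    rwa [inner_op_approx, S.inner_sqrtApprox f le_rfl] at this⟩
  have hcauchy : CauchySeq a := (tendsto_atTop_ciSup hmono hbdd).cauchySeq
  have hdist : ∀ {M N}, N ≤ M →
      ‖S.toH (S.sqrtApprox f M) - S.toH (S.sqrtApprox f N)‖ ^ 2 = a M - a N := by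
    intro M N hMN
    rw [norm_sub_sq_real, ← real_inner_self_eq_norm_sq, ← real_inner_self_eq_norm_sq,
      S.inner_sqrtApprox f hMN, S.inner_sqrtApprox f le_rfl, S.inner_sqrtApprox f le_rfl]
    ring
  have hs : CauchySeq fun N => S.toH (S.sqrtApprox f N) := by
    rw [Metric.cauchySeq_iff']
    intro ε hε
    obtain ⟨N, hN⟩ := Metric.cauchySeq_iff'.1 hcauchy (ε ^ 2) (by positivity)
    refine ⟨N, fun n hn => ?_⟩
    rw [dist_eq_norm]
    refine lt_of_pow_lt_pow_left₀ 2 hε.le ?_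
    rw [hdist hn]
    exact (le_abs_self _).trans_lt (hN n hn)
  obtain ⟨g, hg⟩ := cauchySeq_tendsto_of_complete hs
  refine ⟨g, fun P ν hP => ?_⟩
  -- Symmetry forces eig n = ν or orthogonality, so a negative ν, where √ν = 0, is harmless.
  have h1 : ∀ n, √(S.eig n) * ⟪S.toH (S.comp f n), S.toH P⟫_ℝ =
      √ν * ⟪S.toH (S.comp f n), S.toH P⟫_ℝ := by
    intro n
    have h2 := S.symm (S.comp f n) P
    rw [op_comp, hP, map_smul, map_smul, real_inner_smul_left, real_inner_smul_right] at h2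
    rcases mul_eq_mul_right_iff.1 h2 with h3 | h3 <;> rw [h3]
    simp
  obtain ⟨m, hm⟩ := S.exists_mem P
  refine tendsto_nhds_unique (hg.inner tendsto_const_nhds) (tendsto_const_nhds.congr' ?_)
  filter_upwards [eventually_ge_atTop m] with N hN
  rw [sqrtApprox]
  simp only [map_sum, map_smul, sum_inner, real_inner_smul_left, h1]
  rw [← Finset.mul_sum, ← sum_inner, ← map_sum, sum_comp, S.inner_approx f (S.mono hN hm)]

end EigenFiltration

end EigenFiltration

/-! ### Density of polynomials in `L²(W^T)`, and the resulting filtration. -/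

section PolynomialDensity

open Set Filter Topology MvPolynomial
open scoped InnerProductSpace ENNReal

variable {d : ℕ}

/-- The algebra of polynomial functions on `ℝ^d`. -/
noncomputable def polyFunctions (d : ℕ) : Subalgebra ℝ C(Fin d → ℝ, ℝ) :=
  (aeval fun i : Fin d => (⟨fun x => x i, continuous_apply i⟩ : C(Fin d → ℝ, ℝ))).range

lemma exists_eval_of_mem_polyFunctions {g : C(Fin d → ℝ, ℝ)} (hg : g ∈ polyFunctions d) :
    ∃ P : MvPolynomial (Fin d) ℝ, ∀ x, g x = eval x P := by
  obtain ⟨P, rfl⟩ := hg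
  refine ⟨P, fun x => ?_⟩
  induction P using MvPolynomial.induction_on with
  | C a => simp
  | add p q hp hq => simp_all
  | mul_X p i hp => simp_all

lemma separatesPoints_polyFunctions : (polyFunctions d).SeparatesPoints := by
  intro x y hxy
  obtain ⟨i, hi⟩ := Function.ne_iff.1 hxy
  refine ⟨_, ⟨⟨fun x => x i, continuous_apply i⟩, ⟨X i, ?_⟩, rfl⟩, hi⟩
  simp

lemma exists_eval_near {f : (Fin d → ℝ) → ℝ} (hf : Continuous f) {K : Set (Fin d → ℝ)}
    (hK : IsCompact K) {ε : ℝ} (hε : 0 < ε) :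
    ∃ P : MvPolynomial (Fin d) ℝ, ∀ x ∈ K, |eval x P - f x| < ε := by
  obtain ⟨g, hg, h⟩ :=
    ContinuousMap.exists_mem_subalgebra_near_continuous_of_isCompact_of_separatesPoints
      separatesPoints_polyFunctions ⟨f, hf⟩ hK hε
  obtain ⟨P, hP⟩ := exists_eval_of_mem_polyFunctions hg
  exact ⟨P, fun x hx => by simpa [hP] using h x hx⟩

namespace SimplexWeight

variable (w : SimplexWeight d)

/-- The class of a polynomial in `L²(W^T)`. -/
noncomputable def polyToL2 : MvPolynomial (Fin d) ℝ →ₗ[ℝ] Lp ℝ 2 w.measure where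
  toFun P := (w.memLp_eval P).toLp
  map_add' P Q := by
    rw [← MemLp.toLp_add]
    exact MemLp.toLp_congr _ _ (ae_of_all _ fun x => by simp)
  map_smul' c P := by
    rw [RingHom.id_apply, ← MemLp.toLp_const_smul]
    exact MemLp.toLp_congr _ _ (ae_of_all _ fun x => by simp)

lemma coeFn_polyToL2 (P : MvPolynomial (Fin d) ℝ) :
    w.polyToL2 P =ᵐ[w.measure] fun x => eval x P := (w.memLp_eval P).coeFn_toLp

lemma inner_polyToL2 (u : Lp ℝ 2 w.measure) (P : MvPolynomial (Fin d) ℝ) :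
    ⟪u, w.polyToL2 P⟫_ℝ = ∫ x, u x * eval x P ∂w.measure := by
  rw [L2.inner_def]
  refine integral_congr_ae ((w.coeFn_polyToL2 P).mono fun x hx => ?_)
  simp only [hx, RCLike.inner_apply, conj_trivial]
  ring

lemma injective_polyToL2 : Function.Injective w.polyToL2 := by
  rw [injective_iff_map_eq_zero]
  intro P hP
  refine eq_zero_of_eval_ae_eq_zero (w.absolutelyContinuous_measure.ae_le ?_)
  filter_upwards [w.coeFn_polyToL2 P, Lp.coeFn_zero ℝ 2 w.measure] with x h1 h2
  rw [← h1, hP, h2]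
  rfl

/-- Bounded continuous functions are dense for a finite measure, and Stone-Weierstrass on the
compact simplex approximates them uniformly. -/
lemma denseRange_polyToL2 : DenseRange w.polyToL2 := by
  intro u
  rw [Metric.mem_closure_iff]
  intro ε hε
  obtain ⟨_, ⟨g, rfl⟩, hg⟩ := Metric.mem_closure_iff.1
    (BoundedContinuousFunction.toLp_denseRange ℝ w.measure ℝ
      (p := 2) ENNReal.ofNat_ne_top u) (ε / 2) (by positivity)
  -- The factor between the sup norm and the L² norm; below it is replaced by m + 1 to have a
  -- positive denominator.
  set m := (w.measure univ).toReal ^ (2 : ℝ≥0∞).toReal⁻¹ with hm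
  have hm0 : 0 ≤ m := by positivity
  obtain ⟨P, hP⟩ := exists_eval_near g.continuous (isCompact_simplexT (d := d))
    (ε := ε / (2 * (m + 1))) (by positivity)
  refine ⟨_, ⟨P, rfl⟩, ?_⟩
  have h1 : dist (BoundedContinuousFunction.toLp (E := ℝ) 2 w.measure ℝ g) (w.polyToL2 P) ≤
      m * (ε / (2 * (m + 1))) := by
    rw [dist_eq_norm]
    refine Lp.norm_le_of_ae_bound (by positivity) ?_
    filter_upwards [w.coeFn_polyToL2 P, Lp.coeFn_sub
      (BoundedContinuousFunction.toLp (E := ℝ) 2 w.measure ℝ g) (w.polyToL2 P),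
      BoundedContinuousFunction.coeFn_toLp (𝕜 := ℝ) (p := 2) w.measure g,
      w.ae_mem_openSimplex] with x e1 e2 e3 e4
    rw [e2, Pi.sub_apply, e1, e3, norm_sub_rev]
    exact (hP x (openSimplex_subset e4)).le
  have h2 : m * (ε / (2 * (m + 1))) < ε / 2 := by
    rw [← mul_div_assoc, div_lt_div_iff₀ (by positivity) (by positivity)]
    nlinarith
  linarith [dist_triangle u (BoundedContinuousFunction.toLp (E := ℝ) 2 w.measure ℝ g)
    (w.polyToL2 P)]

lemma integral_eval_mul_polyLap_comm (P Q : MvPolynomial (Fin d) ℝ) :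
    ∫ x, eval x P * eval x (w.polyLap Q) ∂w.measure =
      ∫ x, eval x Q * eval x (w.polyLap P) ∂w.measure := by
  have h1 := w.energy_eval (contDiffOn_eval P) Q
  have h2 := w.energy_eval (contDiffOn_eval Q) P
  rw [w.energy_comm] at h1
  linarith

lemma inner_polyToL2_polyToL2 (P Q : MvPolynomial (Fin d) ℝ) :
    ⟪w.polyToL2 P, w.polyToL2 Q⟫_ℝ = ∫ x, eval x P * eval x Q ∂w.measure := by
  rw [inner_polyToL2]
  exact integral_congr_ae ((w.coeFn_polyToL2 P).mono fun x hx => by simp only [hx])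

lemma lamParam_add_one_pos : 0 < lamParam w.expo w.pairExpo + 1 := by
  have h1 : 0 < ∑ k, w.expo k := Finset.sum_pos (fun k _ => w.expo_pos k) ⟨none, Finset.mem_univ _⟩
  have h2 : 0 ≤ w.pairExpo * Fintype.card (OrderedPair d) :=
    mul_nonneg w.pairExpo_nonneg (Nat.cast_nonneg _)
  rw [lamParam]
  linarith

lemma le_eigVal {n : ℕ} (hn : 1 ≤ n) :
    lamParam w.expo w.pairExpo + 1 ≤ eigVal w.expo w.pairExpo n := by
  have h1 := w.lamParam_add_one_pos
  have h2 : (1 : ℝ) ≤ n := by exact_mod_cast hn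
  rw [eigVal]
  nlinarith

lemma eigVal_nonneg (n : ℕ) : 0 ≤ eigVal w.expo w.pairExpo n := by
  rcases Nat.eq_zero_or_pos n with rfl | hn
  · simp [eigVal]
  · exact w.lamParam_add_one_pos.le.trans (w.le_eigVal hn)

/-- The polynomials filtered by degree in `L²(W^T)`, with the operator `-Δ^T`. -/
noncomputable def eigenFiltration :
    EigenFiltration (MvPolynomial (Fin d) ℝ) (Lp ℝ 2 w.measure) where
  toH := w.polyToL2
  op := -w.polyLap
  filt := degLT d
  eig := eigVal w.expo w.pairExpo
  injective := w.injective_polyToL2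
  dense := w.denseRange_polyToL2
  filt_zero := degLT_zero
  mono := degLT_mono
  finiteDimensional := fun n => inferInstance
  exists_mem := exists_mem_degLT
  op_sub_smul_mem := fun n P hP => by
    have := neg_mem (lapPoly_add_smul_mem_degLT w.expo w.pairExpo hP)
    rwa [neg_add, ← sub_eq_add_neg] at this
  symm := fun P Q => by
    simp only [LinearMap.neg_apply, map_neg, inner_neg_left, inner_neg_right]
    rw [real_inner_comm, inner_polyToL2_polyToL2, inner_polyToL2_polyToL2,
      w.integral_eval_mul_polyLap_comm]
  eig_nonneg := w.eigVal_nonneg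

end SimplexWeight

end PolynomialDensity

/-! ### The radial inequality and the spectral gap for real functions. -/

section RealValued

open Set Filter Topology MvPolynomial
open scoped InnerProductSpace ENNReal

variable {d : ℕ}

namespace SimplexWeight

variable (w : SimplexWeight d)

lemma inner_toLp_polyToL2 {u : (Fin d → ℝ) → ℝ} (hu : MemLp u 2 w.measure)
    (P : MvPolynomial (Fin d) ℝ) :
    ⟪hu.toLp u, w.polyToL2 P⟫_ℝ = ∫ x, u x * eval x P ∂w.measure := by
  rw [inner_polyToL2]
  exact integral_congr_ae (hu.coeFn_toLp.mono fun x hx => by simp only [hx])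

lemma norm_sq_eq_integral (u : Lp ℝ 2 w.measure) : ‖u‖ ^ 2 = ∫ x, u x ^ 2 ∂w.measure := by
  rw [← real_inner_self_eq_norm_sq, L2.inner_def]
  exact integral_congr_ae (ae_of_all _ fun x => by simp [sq])

lemma norm_sq_toLp {u : (Fin d → ℝ) → ℝ} (hu : MemLp u 2 w.measure) :
    ‖hu.toLp u‖ ^ 2 = ∫ x, u x ^ 2 ∂w.measure := by
  rw [norm_sq_eq_integral]
  exact integral_congr_ae (hu.coeFn_toLp.mono fun x hx => by simp only [hx])

lemma inner_op_eq_energy (P : MvPolynomial (Fin d) ℝ) :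
    ⟪w.polyToL2 (w.eigenFiltration.op P), w.polyToL2 P⟫_ℝ =
      w.energy (fun z => eval z P) (fun z => eval z P) := by
  rw [w.energy_eval (contDiffOn_eval P)]
  change ⟪w.polyToL2 (-w.polyLap P), w.polyToL2 P⟫_ℝ = _
  rw [map_neg, inner_neg_left, real_inner_comm, inner_polyToL2_polyToL2]

/-- A function of class `C¹` lies in the domain of the square root of `-Δ^T`. -/
lemma exists_isSqrt_toLp {F : (Fin d → ℝ) → ℝ} (hF : ContDiffOn ℝ 1 F (simplexT d)) :
    ∃ g, w.eigenFiltration.IsSqrt ((w.memLp_of_contDiffOn hF).toLp F) g := by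
  refine w.eigenFiltration.exists_isSqrt (B := w.energy F F) fun N => ?_
  set S := w.eigenFiltration
  set P := S.approx ((w.memLp_of_contDiffOn hF).toLp F) N
  have h1 : ⟪S.toH (S.op P), S.toH P⟫_ℝ = w.energy (fun z => eval z P) (fun z => eval z P) :=
    w.inner_op_eq_energy P
  -- The operator preserves `filt N`, so F may replace its projection P in the pairing: energy(P, P)
  -- = energy(F, P). With the inequality `h3` this gives energy(P, P) ≤ energy(F, F).
  have h2 : ⟪S.toH P, S.toH (S.op P)⟫_ℝ = w.energy F (fun z => eval z P) := by
    rw [S.inner_approx _ (S.op_mem (S.approx_mem _ _)), w.energy_eval hF]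
    change ⟪_, w.polyToL2 (-w.polyLap P)⟫_ℝ = _
    rw [map_neg, inner_neg_right, inner_toLp_polyToL2]
  have h3 := w.two_mul_energy_le hF (contDiffOn_eval P)
  rw [real_inner_comm] at h2
  linarith

lemma integrable_bary_mul_sq {u : (Fin d → ℝ) → ℝ} (hu : MemLp u 2 w.measure) :
    Integrable (fun x => bary none x * u x ^ 2) w.measure := by
  refine hu.integrable_sq.bdd_mul (c := 1) (continuous_bary none).aestronglyMeasurable ?_
  filter_upwards [w.ae_mem_openSimplex] with x hx
  rw [Real.norm_eq_abs, abs_of_nonneg (hx none).le]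
  exact bary_le_one (openSimplex_subset hx) none

/-- Pointwise, P² ≤ (1 + δ) u² + (1 + δ⁻¹)(P - u)², and t ≤ 1 in the error term. -/
lemma integral_bary_mul_sq_eval_le (u : Lp ℝ 2 w.measure) (P : MvPolynomial (Fin d) ℝ) {δ : ℝ}
    (hδ : 0 < δ) : ∫ x, bary none x * eval x P ^ 2 ∂w.measure ≤
      (1 + δ) * ∫ x, bary none x * u x ^ 2 ∂w.measure +
        (1 + δ⁻¹) * ‖w.polyToL2 P - u‖ ^ 2 := by
  have i1 := w.integrable_bary_mul_sq (w.memLp_eval P)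
  have i2 := (w.integrable_bary_mul_sq (Lp.memLp u)).const_mul (1 + δ)
  have i3 := (Lp.memLp (w.polyToL2 P - u)).integrable_sq.const_mul (1 + δ⁻¹)
  rw [norm_sq_eq_integral, ← integral_const_mul, ← integral_const_mul, ← integral_add i2 i3]
  refine integral_mono_ae i1 (i2.add i3) ?_
  filter_upwards [w.ae_mem_openSimplex, w.coeFn_polyToL2 P, Lp.coeFn_sub (w.polyToL2 P) u]
    with x hx h1 h2
  rw [h2, Pi.sub_apply, h1]
  have h3 := hx none
  have h4 := bary_le_one (openSimplex_subset hx) none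
  set t := bary none x
  set p := eval x P
  have h5 : t * (δ⁻¹ * (δ * u x - (p - u x)) ^ 2) =
      t * (δ * u x ^ 2 - 2 * u x * (p - u x) + δ⁻¹ * (p - u x) ^ 2) := by
    field_simp
    ring
  have h6 : 0 ≤ t * (δ⁻¹ * (δ * u x - (p - u x)) ^ 2) := by positivity
  have h7 : t * ((1 + δ⁻¹) * (p - u x) ^ 2) ≤ 1 * ((1 + δ⁻¹) * (p - u x) ^ 2) := by gcongr
  rw [h5] at h6
  linarith

/-- The radial inequality for functions in the domain of the square root of `-Δ^T`. -/
lemma radial_inequality_of_isSqrt {u g : Lp ℝ 2 w.measure} (h : w.eigenFiltration.IsSqrt u g)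
    {s : ℝ} (hs : 0 < s) : w.expo none * ‖u‖ ^ 2 ≤
      (lamParam w.expo w.pairExpo + 1 + s) * ∫ x, bary none x * u x ^ 2 ∂w.measure +
        s⁻¹ * ‖g‖ ^ 2 := by
  set M := ∫ x, bary none x * u x ^ 2 ∂w.measure
  have hA := w.lamParam_add_one_pos
  set A := lamParam w.expo w.pairExpo + 1
  -- For fixed δ the error (1 + δ⁻¹)‖P_N - u‖² vanishes as N → ∞; only afterwards δ tends to 0.
  have h1 : ∀ δ : ℝ, 0 < δ →
      w.expo none * ‖u‖ ^ 2 ≤ (A + s) * ((1 + δ) * M) + s⁻¹ * ‖g‖ ^ 2 := by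
    intro δ hδ
    have ht := w.eigenFiltration.tendsto_toH_approx u
    have t1 := (ht.norm.pow 2).const_mul (w.expo none)
    have t2 : Tendsto (fun N => (A + s) * ((1 + δ) * M +
        (1 + δ⁻¹) * ‖w.eigenFiltration.toH (w.eigenFiltration.approx u N) - u‖ ^ 2) +
        s⁻¹ * ‖g‖ ^ 2) atTop (𝓝 ((A + s) * ((1 + δ) * M +
        (1 + δ⁻¹) * ‖u - u‖ ^ 2) + s⁻¹ * ‖g‖ ^ 2)) :=
      ((((((ht.sub_const u).norm.pow 2).const_mul _).const_add _).const_mul _).add_const _)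
    rw [sub_self, norm_zero, zero_pow two_ne_zero, mul_zero, add_zero] at t2
    refine le_of_tendsto_of_tendsto' t1 t2 fun N => ?_
    set P := w.eigenFiltration.approx u N
    have e1 := h.inner_op_approx_le N
    have e2 : ‖w.eigenFiltration.toH P‖ ^ 2 = ∫ x, eval x P ^ 2 ∂w.measure :=
      w.norm_sq_toLp (w.memLp_eval P)
    have e3 := w.radial_inequality P hs
    have e4 : ⟪w.eigenFiltration.toH (w.eigenFiltration.op P), w.eigenFiltration.toH P⟫_ℝ =
      w.energy (fun z => eval z P) (fun z => eval z P) := w.inner_op_eq_energy P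
    have e5 := w.integral_bary_mul_sq_eval_le u P hδ
    rw [e4] at e1
    rw [e2]
    refine e3.trans (add_le_add ?_ ?_)
    · exact mul_le_mul_of_nonneg_left e5 (by positivity)
    · exact mul_le_mul_of_nonneg_left e1 (by positivity)
  have t3 : Tendsto (fun δ : ℝ => (A + s) * ((1 + δ) * M) + s⁻¹ * ‖g‖ ^ 2) (𝓝[>] 0)
      (𝓝 ((A + s) * ((1 + 0) * M) + s⁻¹ * ‖g‖ ^ 2)) := by
    refine Tendsto.mono_left (Continuous.tendsto ?_ 0) nhdsWithin_le_nhds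
    fun_prop
  rw [add_zero, one_mul] at t3
  exact ge_of_tendsto t3 (eventually_mem_nhdsWithin.mono fun δ hδ => h1 δ hδ)

/-- The spectral gap of `-Δ^T`. -/
lemma spectral_gap {u g : Lp ℝ 2 w.measure} (h : w.eigenFiltration.IsSqrt u g)
    (hu : ∫ x, u x ∂w.measure = 0) :
    (lamParam w.expo w.pairExpo + 1) * ‖u‖ ^ 2 ≤ ‖g‖ ^ 2 := by
  refine h.gap (fun R hR => ?_) fun n hn => w.le_eigVal hn
  rcases eq_or_ne R 0 with rfl | hR0
  · rw [map_zero, inner_zero_right]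
  -- Index 1 of the filtration consists of the constants, to which a function of mean zero is
  -- orthogonal.
  have h1 := totalDegree_lt_of_mem_degLT hR hR0
  rw [totalDegree_eq_zero_iff_eq_C.1 (Nat.lt_one_iff.1 h1)]
  refine (w.inner_polyToL2 u _).trans ?_
  simp only [eval_C]
  rw [integral_mul_const, hu, zero_mul]

end SimplexWeight

end RealValued

/-! ### Real and imaginary parts, the spread, and the uncertainty inequality. -/

section Uncertainty

open Set Filter Topology MvPolynomial
open scoped InnerProductSpace ENNReal

variable {d : ℕ} {𝕜 : Type*} [RCLike 𝕜]

lemma ContDiffOn.rclike_re {f : (Fin d → ℝ) → 𝕜} {s : Set (Fin d → ℝ)} (hf : ContDiffOn ℝ 1 f s) :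
    ContDiffOn ℝ 1 (fun x => RCLike.re (f x)) s :=
  (RCLike.reCLM (K := 𝕜)).contDiff.comp_contDiffOn hf

lemma ContDiffOn.rclike_im {f : (Fin d → ℝ) → 𝕜} {s : Set (Fin d → ℝ)} (hf : ContDiffOn ℝ 1 f s) :
    ContDiffOn ℝ 1 (fun x => RCLike.im (f x)) s :=
  (RCLike.imCLM (K := 𝕜)).contDiff.comp_contDiffOn hf

/-- √(x_i y_i) ≤ (x_i + y_i)/2, summed over i, together with |y| ≤ 1. The dependence on y is gone.
-/
lemma one_sub_dotProduct_psiInv_ge {x y : Fin d → ℝ} (hx : x ∈ simplexT d) (hy : y ∈ simplexT d) :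
    bary none x / 2 ≤ 1 - psiInv x ⬝ᵥ psiInv y := by
  have h1 : psiInv x ⬝ᵥ psiInv y ≤ ∑ i, (x i + y i) / 2 := by
    refine Finset.sum_le_sum fun i _ => ?_
    have e1 := Real.sq_sqrt (bary_nonneg hx (some i))
    have e2 := Real.sq_sqrt (bary_nonneg hy (some i))
    simp only [bary_some] at e1 e2
    simp only [psiInv]
    nlinarith [sq_nonneg (√(x i) - √(y i))]
  have h2 := bary_nonneg hy none
  rw [← Finset.sum_div, Finset.sum_add_distrib] at h1
  simp only [bary_none] at h2 ⊢
  linarith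

namespace SimplexWeight

variable (w : SimplexWeight d)

lemma memLp_rclike_of_contDiffOn {f : (Fin d → ℝ) → 𝕜} (hf : ContDiffOn ℝ 1 f (simplexT d)) :
    MemLp f 2 w.measure :=
  memLp_re_im_iff.1 ⟨w.memLp_of_contDiffOn hf.rclike_re, w.memLp_of_contDiffOn hf.rclike_im⟩

lemma integrable_mul_eval {g : (Fin d → ℝ) → 𝕜} (hg : MemLp g 2 w.measure)
    (P : MvPolynomial (Fin d) ℝ) :
    Integrable (fun x => g x * ((eval x P : ℝ) : 𝕜)) w.measure :=
  hg.integrable_mul (w.memLp_eval P).ofReal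

lemma re_integral_mul_eval {g : (Fin d → ℝ) → 𝕜} (hg : MemLp g 2 w.measure)
    (P : MvPolynomial (Fin d) ℝ) :
    RCLike.re (∫ x, g x * ((eval x P : ℝ) : 𝕜) ∂w.measure) =
      ∫ x, RCLike.re (g x) * eval x P ∂w.measure := by
  rw [← integral_re (w.integrable_mul_eval hg P)]
  simp only [RCLike.re_mul_ofReal]

lemma im_integral_mul_eval {g : (Fin d → ℝ) → 𝕜} (hg : MemLp g 2 w.measure)
    (P : MvPolynomial (Fin d) ℝ) :
    RCLike.im (∫ x, g x * ((eval x P : ℝ) : 𝕜) ∂w.measure) =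
      ∫ x, RCLike.im (g x) * eval x P ∂w.measure := by
  rw [← integral_im (w.integrable_mul_eval hg P)]
  simp only [RCLike.im_mul_ofReal]

variable {w}

lemma IsSqrtNegLaplacian.isSqrt_re {f g : (Fin d → ℝ) → 𝕜} (h : w.IsSqrtNegLaplacian f g)
    (hf : MemLp f 2 w.measure) :
    w.eigenFiltration.IsSqrt (hf.re.toLp _) (h.1.re.toLp _) := by
  intro P ν hP
  have h1 := congrArg RCLike.re (h.2 P ν ((w.ae_laplacian_eigen_iff P ν).2 hP))
  rw [RCLike.re_ofReal_mul, w.re_integral_mul_eval hf, w.re_integral_mul_eval h.1] at h1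
  exact ((w.inner_toLp_polyToL2 h.1.re P).trans h1).trans
    (congrArg _ (w.inner_toLp_polyToL2 hf.re P).symm)

lemma IsSqrtNegLaplacian.isSqrt_im {f g : (Fin d → ℝ) → 𝕜} (h : w.IsSqrtNegLaplacian f g)
    (hf : MemLp f 2 w.measure) :
    w.eigenFiltration.IsSqrt (hf.im.toLp _) (h.1.im.toLp _) := by
  intro P ν hP
  have h1 := congrArg RCLike.im (h.2 P ν ((w.ae_laplacian_eigen_iff P ν).2 hP))
  rw [RCLike.im_ofReal_mul, w.im_integral_mul_eval hf, w.im_integral_mul_eval h.1] at h1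
  exact ((w.inner_toLp_polyToL2 h.1.im P).trans h1).trans
    (congrArg _ (w.inner_toLp_polyToL2 hf.im P).symm)

variable (w)

/-- A real function of class `C¹` has an image under the square root of `-Δ^T`. -/
lemma exists_integral_mul_eval_eq {F : (Fin d → ℝ) → ℝ} (hF : ContDiffOn ℝ 1 F (simplexT d)) :
    ∃ g : (Fin d → ℝ) → ℝ, MemLp g 2 w.measure ∧ ∀ (P : MvPolynomial (Fin d) ℝ) (ν : ℝ),
      -w.polyLap P = ν • P →
        ∫ x, g x * eval x P ∂w.measure = √ν * ∫ x, F x * eval x P ∂w.measure := by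
  obtain ⟨g, h⟩ := w.exists_isSqrt_toLp hF
  refine ⟨g, Lp.memLp g, fun P ν hP => ?_⟩
  rw [← w.inner_polyToL2 g P, ← w.inner_toLp_polyToL2 (w.memLp_of_contDiffOn hF) P]
  exact h P ν hP

lemma exists_isSqrtNegLaplacian {f : (Fin d → ℝ) → 𝕜} (hf : ContDiffOn ℝ 1 f (simplexT d)) :
    ∃ g : (Fin d → ℝ) → 𝕜, w.IsSqrtNegLaplacian f g := by
  obtain ⟨g₁, hg₁, h₁⟩ := w.exists_integral_mul_eval_eq hf.rclike_re
  obtain ⟨g₂, hg₂, h₂⟩ := w.exists_integral_mul_eval_eq hf.rclike_im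
  have hfm := w.memLp_rclike_of_contDiffOn hf
  have hg : MemLp (fun x => (g₁ x : 𝕜) + RCLike.I * (g₂ x : 𝕜)) 2 w.measure := by
    have m₁ : MemLp (fun x => (g₁ x : 𝕜)) 2 w.measure := hg₁.ofReal
    have m₂ : MemLp (fun x => (g₂ x : 𝕜)) 2 w.measure := hg₂.ofReal
    exact m₁.add (m₂.const_mul RCLike.I)
  refine ⟨_, hg, fun P ν hP => ?_⟩
  have hP' := (w.ae_laplacian_eigen_iff P ν).1 hP
  refine RCLike.ext ?_ ?_
  · rw [RCLike.re_ofReal_mul, w.re_integral_mul_eval hg, w.re_integral_mul_eval hfm, ← h₁ P ν hP']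
    simp
  · rw [RCLike.im_ofReal_mul, w.im_integral_mul_eval hg, w.im_integral_mul_eval hfm]
    -- The factor im I is kept so that one argument serves both fields: it is 1 over ℂ, and over ℝ,
    -- where I = 0, it is 0 like the imaginary part of f.
    have e₃ : ∀ x, RCLike.im ((g₁ x : 𝕜) + RCLike.I * (g₂ x : 𝕜)) * eval x P =
        g₂ x * eval x P * RCLike.im (RCLike.I : 𝕜) := fun x => by simp; ring
    simp only [e₃]
    rw [integral_mul_const, h₂ P ν hP', mul_assoc, ← integral_mul_const]
    congr 2 with x
    rw [mul_right_comm, RCLike.I_im]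

lemma integrable_mul_norm_sq {f : (Fin d → ℝ) → 𝕜} (hf : MemLp f 2 w.measure)
    {φ : (Fin d → ℝ) → ℝ} (hφ : Continuous φ) :
    Integrable (fun x => φ x * ‖f x‖ ^ 2) w.measure := by
  obtain ⟨C, hC⟩ := isCompact_simplexT.exists_bound_of_continuousOn (s := simplexT d)
    hφ.continuousOn
  exact ((memLp_two_iff_integrable_sq_norm hf.1).1 hf).bdd_mul (c := C)
    hφ.aestronglyMeasurable (w.ae_mem_openSimplex.mono fun x hx => hC x (openSimplex_subset hx))

lemma integral_mul_norm_sq {f : (Fin d → ℝ) → 𝕜} (hf : MemLp f 2 w.measure)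
    {φ : (Fin d → ℝ) → ℝ} (hφ : Continuous φ) :
    ∫ x, φ x * ‖f x‖ ^ 2 ∂w.measure = (∫ x, φ x * RCLike.re (f x) ^ 2 ∂w.measure) +
      ∫ x, φ x * RCLike.im (f x) ^ 2 ∂w.measure := by
  have h1 := w.integrable_mul_norm_sq hf.re hφ
  have h2 := w.integrable_mul_norm_sq hf.im hφ
  simp only [Real.norm_eq_abs, sq_abs] at h1 h2
  rw [← integral_add h1 h2]
  refine integral_congr_ae (ae_of_all _ fun x => ?_)
  simp only [RCLike.norm_sq_eq_def]
  ring

lemma integral_norm_sq {f : (Fin d → ℝ) → 𝕜} (hf : MemLp f 2 w.measure) :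
    ∫ x, ‖f x‖ ^ 2 ∂w.measure = ‖hf.re.toLp _‖ ^ 2 + ‖hf.im.toLp _‖ ^ 2 := by
  have := w.integral_mul_norm_sq hf (φ := fun _ => 1) continuous_const
  simp only [one_mul] at this
  rw [this, norm_sq_toLp, norm_sq_toLp]

lemma integral_bary_mul_norm_sq {f : (Fin d → ℝ) → 𝕜} (hf : MemLp f 2 w.measure) :
    ∫ x, bary none x * ‖f x‖ ^ 2 ∂w.measure =
      (∫ x, bary none x * hf.re.toLp _ x ^ 2 ∂w.measure) +
        ∫ x, bary none x * hf.im.toLp _ x ^ 2 ∂w.measure := by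
  rw [w.integral_mul_norm_sq hf (continuous_bary none)]
  congr 1
  · exact integral_congr_ae (hf.re.coeFn_toLp.mono fun x hx => by simp only [hx])
  · exact integral_congr_ae (hf.im.coeFn_toLp.mono fun x hx => by simp only [hx])

/-- The spread is affine in the numbers √y_i, with the moments of √x_i as coefficients. -/
lemma continuous_spread {f : (Fin d → ℝ) → 𝕜} (hf : MemLp f 2 w.measure) :
    Continuous (w.spread f) := by
  have h : w.spread f = fun y => (∫ x, ‖f x‖ ^ 2 ∂w.measure) -
      ∑ i, √(y i) * ∫ x, √(x i) * ‖f x‖ ^ 2 ∂w.measure := by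
    funext y
    have hi : ∀ i ∈ Finset.univ, Integrable (fun x => √(y i) * (√(x i) * ‖f x‖ ^ 2)) w.measure :=
      fun i _ => (w.integrable_mul_norm_sq hf (φ := fun x => √(x i)) (by fun_prop)).const_mul _
    simp only [← integral_const_mul]
    rw [spread, ← integral_finsetSum _ hi,
      ← integral_sub ((memLp_two_iff_integrable_sq_norm hf.1).1 hf) (integrable_finsetSum _ hi)]
    refine integral_congr_ae (ae_of_all _ fun x => ?_)
    simp only [dotProduct, psiInv, sub_mul, one_mul, Finset.sum_mul]
    congr 1
    exact Finset.sum_congr rfl fun i _ => by ring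
  rw [h]
  fun_prop

lemma integral_bary_le_spread {f : (Fin d → ℝ) → 𝕜} (hf : MemLp f 2 w.measure)
    {y : Fin d → ℝ} (hy : y ∈ simplexT d) :
    (∫ x, bary none x * ‖f x‖ ^ 2 ∂w.measure) / 2 ≤ w.spread f y := by
  rw [spread, ← integral_div]
  refine integral_mono_ae ((w.integrable_mul_norm_sq hf (continuous_bary none)).div_const 2)
    (w.integrable_mul_norm_sq hf (φ := fun x => 1 - psiInv x ⬝ᵥ psiInv y) ?_) ?_
  · unfold dotProduct psiInv
    fun_prop
  · filter_upwards [w.ae_mem_openSimplex] with x hx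
    have := one_sub_dotProduct_psiInv_ge (openSimplex_subset hx) hy
    calc bary none x * ‖f x‖ ^ 2 / 2 = bary none x / 2 * ‖f x‖ ^ 2 := by ring
      _ ≤ _ := by gcongr

lemma uncertainty {f g : (Fin d → ℝ) → 𝕜} (hf : MemLp f 2 w.measure)
    (h : w.IsSqrtNegLaplacian f g) (h0 : ∫ x, f x ∂w.measure = 0)
    (h1 : ∫ x, ‖f x‖ ^ 2 ∂w.measure = 1) :
    w.expo none ^ 2 / (2 * (w.expo none + 2)) ≤
      (∫ x, bary none x * ‖f x‖ ^ 2 ∂w.measure) * ∫ x, ‖g x‖ ^ 2 ∂w.measure := by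
  have hb := w.expo_pos none
  have hA := w.lamParam_add_one_pos
  have hre := h.isSqrt_re hf
  have him := h.isSqrt_im hf
  have hint : Integrable f w.measure := hf.integrable (by norm_num)
  have z1 : ∫ x, hf.re.toLp _ x ∂w.measure = 0 := by
    rw [integral_congr_ae hf.re.coeFn_toLp, integral_re hint, h0, map_zero]
  have z2 : ∫ x, hf.im.toLp _ x ∂w.measure = 0 := by
    rw [integral_congr_ae hf.im.coeFn_toLp, integral_im hint, h0, map_zero]
  have g1 := w.spectral_gap hre z1
  have g2 := w.spectral_gap him z2
  have hM : 0 ≤ ∫ x, bary none x * ‖f x‖ ^ 2 ∂w.measure :=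
    integral_nonneg_of_ae (w.ae_mem_openSimplex.mono fun x hx =>
      mul_nonneg (hx none).le (sq_nonneg _))
  have eM := w.integral_bary_mul_norm_sq hf
  have eG := w.integral_norm_sq h.1
  have eF := w.integral_norm_sq hf
  rw [h1] at eF
  set M := ∫ x, bary none x * ‖f x‖ ^ 2 ∂w.measure
  set G := ∫ x, ‖g x‖ ^ 2 ∂w.measure
  set A := lamParam w.expo w.pairExpo + 1
  set b := w.expo none
  -- The spectral gap with ‖f‖ = 1. It lets A be replaced by G, so that the final bound involves
  -- only the product M·G.
  have hAG : A ≤ G := by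
    calc A = A * 1 := by ring
      _ ≤ G := by rw [eF, eG]; linarith
  have hG : 0 < G := hA.trans_le hAG
  have r : ∀ s : ℝ, 0 < s → b * 1 ≤ (A + s) * M + s⁻¹ * G := by
    intro s hs
    have := add_le_add (w.radial_inequality_of_isSqrt hre hs)
      (w.radial_inequality_of_isSqrt him hs)
    rw [eF, eM, eG]
    linarith
  -- This s makes s⁻¹G = b/2, which is absorbed in the left side.
  have hr := r (2 * G / b) (by positivity)
  have e1 : (2 * G / b)⁻¹ * G = b / 2 := by field_simp
  have e2 : (A + 2 * G / b) * M ≤ (G + 2 * G / b) * M := by gcongr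
  have e3 : (G + 2 * G / b) * M = (b + 2) / b * (M * G) := by field_simp
  have e4 : b / 2 ≤ (b + 2) / b * (M * G) := by linarith
  calc b ^ 2 / (2 * (b + 2)) = b / (b + 2) * (b / 2) := by field_simp
    _ ≤ b / (b + 2) * ((b + 2) / b * (M * G)) := by gcongr
    _ = M * G := by field_simp

end SimplexWeight

end Uncertainty

theorem mainTheorem4 {𝕜 : Type*} [RCLike 𝕜] (d : ℕ) (w : SimplexWeight d) :
    ∃ C : ℝ, 0 < C ∧
      ∀ f : (Fin d → ℝ) → 𝕜, ContDiffOn ℝ 1 f (simplexT d) →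
        ∫ x, f x ∂w.measure = 0 →
        ∫ x, ‖f x‖ ^ 2 ∂w.measure = 1 →
        ∃ m : ℝ, IsLeast (w.spread f '' simplexT d) m ∧
          (∃ g : (Fin d → ℝ) → 𝕜, w.IsSqrtNegLaplacian f g) ∧
          ∀ g : (Fin d → ℝ) → 𝕜, w.IsSqrtNegLaplacian f g →
            C ≤ m * ∫ x, ‖g x‖ ^ 2 ∂w.measure := by
  have hb := w.expo_pos none
  -- The constant of `SimplexWeight.uncertainty`, halved because the spread is only bounded below by
  -- M/2.
  refine ⟨w.expo none ^ 2 / (2 * (w.expo none + 2)) / 2, by positivity, fun f hf h0 h1 => ?_⟩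
  have hfm := w.memLp_rclike_of_contDiffOn hf
  obtain ⟨y, hy, hmin⟩ := isCompact_simplexT.exists_isMinOn
    (openSimplex_nonempty.mono openSimplex_subset) (w.continuous_spread hfm).continuousOn
  refine ⟨w.spread f y, ⟨Set.mem_image_of_mem _ hy, ?_⟩, w.exists_isSqrtNegLaplacian hf,
    fun g hg => ?_⟩
  · rintro _ ⟨z, hz, rfl⟩
    exact hmin hz
  · have h2 := w.uncertainty hfm hg h0 h1
    have h3 := mul_le_mul_of_nonneg_right (w.integral_bary_le_spread hfm hy)
      (integral_nonneg (μ := w.measure) fun x => sq_nonneg ‖g x‖)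
    linarith
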